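/- **Setting.** Let $\mathfrak g_o$ be a finite-dimensional real semisimple Lie algebra with Killing form $B$, and let $\theta$ be a Cartan involution, i.e. an involutive automorphism such that $-B(x,\theta y)$ is positive definite. Write $\mathfrak g_o=\mathfrak k_o\oplus\mathfrak p_o$ for its eigenspace decomposition, $\mathfrak g=\mathfrak k\oplus\mathfrak p$ for the complexification, with $\theta$ extended linearly, and $\sigma$ for the conjugation of $\mathfrak g$ with respect to $\mathfrak g_o$. Let $G_o$ be the (connected) adjoint group of $\mathfrak g_o$, and $K$ the connected subgroup of the adjoint group of $\mathfrak g$ with Lie algebra $\mathfrak k$. A *KS-triple* is an $\mathfrak{sl}_2$-triple $(h,e,f)$ in $\mathfrak g$ ($h\ne 0$, $[h,e]=2e$, $[h,f]=-2f$, $[e,f]=h$) with $e,f\in\mathfrak p$, $f=\sigma(e)$ and $h\in i\mathfrak k_o$. The *Kostant–Sekiguchi correspondence* relates the orbit $G_o.e_o$ to the orbit $K.e'$ whenever $(h_o,e_o,f_o)$ is an $\mathfrak{sl}_2$-triple in $\mathfrak g_o$ with $\theta h_o=-h_o$, $\theta e_o=-f_o$ and $e'=\tfrac12\bigl(h_o-i(e_o+f_o)\bigr)$.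 A *$\theta$-stable Levi subalgebra* of $\mathfrak g$ is the $\theta$-stable Levi factor $\mathfrak l$ of a $\theta$-stable parabolic subalgebra $\mathfrak q=\mathfrak l\oplus\mathfrak u$. A nilpotent $e\in\mathfrak p$ is *noticed* if the only $\theta$-stable Levi subalgebra containing $e$ is $\mathfrak g$. A KS-triple $(h,e,f)$ is noticed if $e$ is; a nilpotent $K$-orbit in $\mathfrak p$ is noticed if it is the orbit of a noticed element; a nilpotent $G_o$-orbit in $\mathfrak g_o$ is noticed if it corresponds to a noticed $K$-orbit under the Kostant–Sekiguchi correspondence. An *abstract weighted Vogan diagram* $\Gamma=(D,\theta,J,\omega)$ consists of a Dynkin diagram $D$ with nodes $1,\dots,n$, an automorphism $\theta$ of $D$ with $\theta^2=1$, a set $J$ of $\theta$-fixed ("painted") nodes, and weights $\omega_i=\omega_{\theta(i)}\in\{0,1,2\}$. Let $\Delta^+$ be the set of positive roots $\alpha=\sum n_i\alpha_i$ of the root system with Dynkin diagram $D$, with the induced action of $\theta$, and put $\omega_\alpha=\sum n_i\omega_i$, $p_\alpha=\sum_{i\in J}n_i$. Let $N^\theta$ be the number of $\theta$-fixed nodes,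 $N^\theta_2$ the number of two-element $\theta$-orbits of nodes, and $$P_{np}^{(j)}=\{\alpha\in\Delta^+:\omega_\alpha=j,\ \theta\alpha=\alpha,\ p_\alpha\text{ even},\ \alpha\ne\gamma+\theta\gamma\text{ for all }\gamma\in\Delta^+\},$$ $$P_{p}^{(j)}=\{\alpha\in\Delta^+:\omega_\alpha=j,\ \theta\alpha=\alpha,\ p_\alpha\text{ odd}\}\cup\{\gamma+\theta\gamma\in\Delta^+:\gamma\in\Delta^+,\ 2\omega_\gamma=j\},$$ $$K^{(j)}=\{\{\alpha,\theta\alpha\}:\alpha\in\Delta^+,\ \theta\alpha\ne\alpha,\ \omega_\alpha=j\}.$$ $\Gamma$ is *noticed* if $$N^\theta+N^\theta_2+2|P_{np}^{(0)}|+2|K^{(0)}|=|P_p^{(2)}|+|K^{(2)}|.$$ A weighted Vogan diagram $\Gamma$ is *associated to* the KS-triple $(h,e,f)$ if there are a $\theta$-stable Cartan subalgebra $\mathfrak h\ni h$ of $\mathfrak g$ with $\mathfrak h\cap\mathfrak k$ maximal abelian in $\mathfrak k$, and a $\theta$-stable set of simple roots $\alpha_1,\dots,\alpha_n$ of $(\mathfrak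 g,\mathfrak h)$ with $\alpha_i(h)\ge 0$, such that $D$ is the Dynkin diagram of $\alpha_1,\dots,\alpha_n$, $\alpha_{\theta(i)}=\theta\alpha_i$, $J$ is the set of $\theta$-fixed nodes $i$ with $\mathfrak g_{\alpha_i}\subset\mathfrak p$, and $\omega_i=\alpha_i(h)$. **Theorem.** Let $(h,e,f)$ be a KS-triple of $\mathfrak g$. Then an associated weighted Vogan diagram exists and some $G_o$-orbit in $\mathfrak g_o$ corresponds to $K.e$. Moreover, for every weighted Vogan diagram $\Gamma$ associated to $(h,e,f)$ and every $G_o$-orbit $\mathcal O_o$ in $\mathfrak g_o$ corresponding to $K.e$ under the Kostant–Sekiguchi correspondence, the following are equivalent: 1. $(h,e,f)$ is a noticed KS-triple; 2. $K.e$ is a noticed nilpotent $K$-orbit in $\mathfrak p$; 3. $\mathcal O_o$ is a noticed nilpotent $G_o$-orbit in $\mathfrak g_o$; 4. $\Gamma$ is a noticed weighted Vogan diagram. -/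

import Mathlib

open scoped TensorProduct

noncomputable section

namespace NoticedOrbits

/-! ### Complexification, Cartan involution, symmetric pair -/

section Complexification

variable {L₀ : Type*} [LieRing L₀] [LieAlgebra ℝ L₀]

/-- Every element of the complexification has the form `1 ⊗ a + i ⊗ b`. -/
theorem exists_re_im (x : ℂ ⊗[ℝ] L₀) :
    ∃ a b : L₀, x = (1 : ℂ) ⊗ₜ[ℝ] a + Complex.I ⊗ₜ[ℝ] b := by
  induction x using TensorProduct.induction_on with
  | zero => exact ⟨0, 0, by simp⟩
  | tmul z y =>
    refine ⟨z.re • y, z.im • y, ?_⟩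
    rw [← TensorProduct.smul_tmul, ← TensorProduct.smul_tmul, ← TensorProduct.add_tmul]
    congr 1
    apply Complex.ext <;> simp
  | add x y hx hy =>
    obtain ⟨a, b, rfl⟩ := hx
    obtain ⟨c, d, rfl⟩ := hy
    refine ⟨a + c, b + d, ?_⟩
    rw [TensorProduct.tmul_add, TensorProduct.tmul_add]
    abel

/-- The complexification of a semisimple real Lie algebra has nondegenerate Killing form. -/
instance isKilling_complexification [FiniteDimensional ℝ L₀] [LieAlgebra.IsKilling ℝ L₀] :
    LieAlgebra.IsKilling ℂ (ℂ ⊗[ℝ] L₀) where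
  killingCompl_top_eq_bot := by
    rw [eq_bot_iff]
    intro x hx
    have hB : killingForm ℂ (ℂ ⊗[ℝ] L₀) = (killingForm ℝ L₀).baseChange ℂ :=
      LieModule.traceForm_baseChange ..
    obtain ⟨a, b, rfl⟩ := exists_re_im x
    rw [LieIdeal.mem_killingCompl] at hx
    have key : ∀ y : L₀, killingForm ℝ L₀ y a = 0 ∧ killingForm ℝ L₀ y b = 0 := by
      intro y
      have h1 := hx ((1 : ℂ) ⊗ₜ[ℝ] y) trivial
      rw [hB] at h1
      simp only [map_add, LinearMap.BilinForm.baseChange_tmul, mul_one, one_mul,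
        Algebra.smul_def] at h1
      exact ⟨by simpa using congrArg Complex.re h1, by simpa using congrArg Complex.im h1⟩
    have zero : ∀ c : L₀, (∀ y, killingForm ℝ L₀ y c = 0) → c = 0 := by
      intro c hc
      have : c ∈ LieIdeal.killingCompl ℝ L₀ ⊤ := by
        rw [LieIdeal.mem_killingCompl]
        exact fun y _ => hc y
      simpa using this
    rw [zero a fun y => (key y).1, zero b fun y => (key y).2]
    simp

/-- A Cartan involution of a real Lie algebra: an involutive automorphism `θ` such that
`(x, y) ↦ -B(x, θ y)` is positive definite, where `B` is the Killing form. -/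
structure IsCartanInvolution (θ : L₀ ≃ₗ⁅ℝ⁆ L₀) : Prop where
  involutive : ∀ x, θ (θ x) = x
  pos : ∀ x, x ≠ 0 → 0 < -(killingForm ℝ L₀ x (θ x))

/-- The complex-linear extension of `θ` to the complexification. -/
def complexTheta (θ : L₀ ≃ₗ⁅ℝ⁆ L₀) : (ℂ ⊗[ℝ] L₀) →ₗ[ℂ] (ℂ ⊗[ℝ] L₀) :=
  LinearMap.baseChange ℂ (θ : L₀ →ₗ[ℝ] L₀)

/-- The conjugation `σ` of the complexification with respect to the real form `L₀`. -/
def conjugation : (ℂ ⊗[ℝ] L₀) →ₗ[ℝ] (ℂ ⊗[ℝ] L₀) :=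
  LinearMap.rTensor L₀ (Complex.conjAe : ℂ →ₗ[ℝ] ℂ)

/-- The complex subalgebra `𝔨`, the fixed points of `θ`. -/
def kSpace (θ : L₀ ≃ₗ⁅ℝ⁆ L₀) : Submodule ℂ (ℂ ⊗[ℝ] L₀) :=
  LinearMap.ker (complexTheta θ - LinearMap.id)

/-- The complex subspace `𝔭`, the `-1`-eigenspace of `θ`. -/
def pSpace (θ : L₀ ≃ₗ⁅ℝ⁆ L₀) : Submodule ℂ (ℂ ⊗[ℝ] L₀) :=
  LinearMap.ker (complexTheta θ + LinearMap.id)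

end Complexification

/-! ### Adjoint groups and orbits -/

section Groups

variable (𝕂 : Type*) [RCLike 𝕂]

/-- The exponential of an endomorphism of a finite-dimensional vector space, computed as a matrix
exponential (it does not depend on the basis). -/
def expEnd {V : Type*} [AddCommGroup V] [Module 𝕂 V] [FiniteDimensional 𝕂 V]
    (A : Module.End 𝕂 V) : Module.End 𝕂 V :=
  Matrix.toLin (Module.finBasis 𝕂 V) (Module.finBasis 𝕂 V)
    (NormedSpace.exp (LinearMap.toMatrix (Module.finBasis 𝕂 V) (Module.finBasis 𝕂 V) A))

/-- The group generated by the `exp (ad x)` with `x ∈ S`. For a subalgebra `S` this is the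
connected subgroup of the adjoint group with Lie algebra (the image under `ad` of) `S`. -/
def adGroup {L : Type*} [LieRing L] [LieAlgebra 𝕂 L] [FiniteDimensional 𝕂 L] (S : Set L) :
    Subgroup (L ≃ₗ[𝕂] L) :=
  Subgroup.closure {φ | ∃ x ∈ S, (φ : L →ₗ[𝕂] L) = expEnd 𝕂 (LieAlgebra.ad 𝕂 L x)}

end Groups

section Noticed

variable {L₀ : Type*} [LieRing L₀] [LieAlgebra ℝ L₀] [FiniteDimensional ℝ L₀]

/-- The orbit `K.x` in the complexification, where `K` is the connected subgroup of the adjoint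
group with Lie algebra `𝔨`. -/
def kOrbit (θ : L₀ ≃ₗ⁅ℝ⁆ L₀) (x : ℂ ⊗[ℝ] L₀) : Set (ℂ ⊗[ℝ] L₀) :=
  MulAction.orbit (adGroup ℂ (kSpace θ : Set (ℂ ⊗[ℝ] L₀))) x

/-- The orbit `G₀.x`, where `G₀` is the (connected) adjoint group of the real Lie algebra. -/
def realOrbit (x : L₀) : Set L₀ :=
  MulAction.orbit (adGroup ℝ (Set.univ : Set L₀)) x

/-! ### Triples and the Kostant–Sekiguchi correspondence -/

/-- A KS-triple: a normal `𝔰𝔩₂`-triple (`h ∈ 𝔨`, `e, f ∈ 𝔭`) such that `f = σ e` and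
`h ∈ i 𝔨₀`. -/
structure IsKSTriple (θ : L₀ ≃ₗ⁅ℝ⁆ L₀) (h e f : ℂ ⊗[ℝ] L₀) : Prop where
  sl2 : IsSl2Triple h e f
  e_mem : e ∈ pSpace θ
  f_mem : f ∈ pSpace θ
  f_eq : f = conjugation e
  h_mem : ∃ x : L₀, θ x = x ∧ h = Complex.I ⊗ₜ[ℝ] x

/-- A real `𝔰𝔩₂`-triple adapted to `θ`, i.e. `θ h₀ = -h₀` and `θ e₀ = -f₀`. -/
structure IsRealCayleyTriple (θ : L₀ ≃ₗ⁅ℝ⁆ L₀) (h₀ e₀ f₀ : L₀) : Prop where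
  sl2 : IsSl2Triple h₀ e₀ f₀
  theta_h : θ h₀ = -h₀
  theta_e : θ e₀ = -f₀

/-- The nilpositive element `(h₀ - i (e₀ + f₀)) / 2` of the Cayley transform of a real triple. -/
def cayleyE (h₀ e₀ f₀ : L₀) : ℂ ⊗[ℝ] L₀ :=
  (1 / 2 : ℂ) • ((1 : ℂ) ⊗ₜ[ℝ] h₀ - Complex.I ⊗ₜ[ℝ] (e₀ + f₀))

/-- The Kostant–Sekiguchi correspondence between (nonzero) nilpotent `G₀`-orbits in the real Lie
algebra and nilpotent `K`-orbits in `𝔭`, as a relation: `G₀.e₀` corresponds to `K.e` where `e`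
comes from `e₀` by the Cayley transform of an adapted triple. -/
def KSCorrespond (θ : L₀ ≃ₗ⁅ℝ⁆ L₀) (O₀ : Set L₀) (O : Set (ℂ ⊗[ℝ] L₀)) : Prop :=
  ∃ h₀ e₀ f₀ : L₀, IsRealCayleyTriple θ h₀ e₀ f₀ ∧
    O₀ = realOrbit e₀ ∧ O = kOrbit θ (cayleyE h₀ e₀ f₀)

variable [LieAlgebra.IsSemisimple ℝ L₀]

/-! ### Noticed elements and orbits -/

/-- `q` is a parabolic subalgebra containing the Cartan subalgebra `H`: it contains the Borel
subalgebra attached to `H` and to some base of the root system. -/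
def IsParabolicOver (H q : LieSubalgebra ℂ (ℂ ⊗[ℝ] L₀)) [H.IsCartanSubalgebra] : Prop :=
  H ≤ q ∧ ∃ b : (LieAlgebra.IsKilling.rootSystem H).Base, ∀ α : H.root, b.IsPos α →
    (LieAlgebra.rootSpace H (α : LieModule.Weight ℂ H (ℂ ⊗[ℝ] L₀))).toSubmodule ≤ q.toSubmodule

/-- The Levi factor containing `H` of a parabolic subalgebra `q ⊇ H`: the sum of `H` and of the
root spaces of those roots `α` for which both `α` and `-α` are roots of `q`. -/
def leviFactor (H q : LieSubalgebra ℂ (ℂ ⊗[ℝ] L₀)) [H.IsCartanSubalgebra] :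
    Submodule ℂ (ℂ ⊗[ℝ] L₀) :=
  H.toSubmodule ⊔
    ⨆ α : {α : H.root //
        (LieAlgebra.rootSpace H (α : LieModule.Weight ℂ H (ℂ ⊗[ℝ] L₀))).toSubmodule
            ≤ q.toSubmodule ∧
        (LieAlgebra.rootSpace H
            (-(α : LieModule.Weight ℂ H (ℂ ⊗[ℝ] L₀)) : H → ℂ)).toSubmodule ≤ q.toSubmodule},
      (LieAlgebra.rootSpace H (α.1 : LieModule.Weight ℂ H (ℂ ⊗[ℝ] L₀))).toSubmodule

/-- A `θ`-stable Levi subalgebra: the `θ`-stable Levi factor `l` of a `θ`-stable parabolic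
subalgebra `q = l ⊕ u`. -/
def IsThetaStableLevi (θ : L₀ ≃ₗ⁅ℝ⁆ L₀) (l : LieSubalgebra ℂ (ℂ ⊗[ℝ] L₀)) : Prop :=
  ∃ (H q : LieSubalgebra ℂ (ℂ ⊗[ℝ] L₀)) (_ : H.IsCartanSubalgebra),
    IsParabolicOver H q ∧ l.toSubmodule = leviFactor H q ∧
    (∀ x ∈ q, complexTheta θ x ∈ q) ∧ (∀ x ∈ l, complexTheta θ x ∈ l)

/-- A nilpotent element of `𝔭` is noticed if the only `θ`-stable Levi subalgebra containing it is
the whole Lie algebra. -/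
structure IsNoticed (θ : L₀ ≃ₗ⁅ℝ⁆ L₀) (e : ℂ ⊗[ℝ] L₀) : Prop where
  mem : e ∈ pSpace θ
  nilpotent : IsNilpotent (LieAlgebra.ad ℂ (ℂ ⊗[ℝ] L₀) e)
  minimal : ∀ l : LieSubalgebra ℂ (ℂ ⊗[ℝ] L₀), IsThetaStableLevi θ l → e ∈ l → l = ⊤

/-- A KS-triple `(h, e, f)` is noticed if `e` is. -/
def IsNoticedKSTriple (θ : L₀ ≃ₗ⁅ℝ⁆ L₀) (h e f : ℂ ⊗[ℝ] L₀) : Prop :=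
  IsKSTriple θ h e f ∧ IsNoticed θ e

/-- A noticed nilpotent `K`-orbit in `𝔭`: the `K`-orbit of a noticed element. -/
def IsNoticedKOrbit (θ : L₀ ≃ₗ⁅ℝ⁆ L₀) (O : Set (ℂ ⊗[ℝ] L₀)) : Prop :=
  ∃ x, IsNoticed θ x ∧ O = kOrbit θ x

/-- A noticed nilpotent `G₀`-orbit: one that corresponds to a noticed nilpotent `K`-orbit. -/
def IsNoticedRealOrbit (θ : L₀ ≃ₗ⁅ℝ⁆ L₀) (O₀ : Set L₀) : Prop :=
  ∃ O, KSCorrespond θ O₀ O ∧ IsNoticedKOrbit θ O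

end Noticed

/-! ### Abstract weighted Vogan diagrams -/

/-- An abstract weighted Vogan diagram `(D, θ, J, ω)` with `n` nodes: a Dynkin diagram `D` (given
by its Cartan matrix, entry `i j` being `⟨αᵢ, αⱼ^∨⟩`; finite type is expressed by positive
definiteness after symmetrization), an automorphism `θ` of `D` with `θ² = 1`, a set `J` of painted
`θ`-fixed nodes, and `θ`-invariant weights `ω` in `{0, 1, 2}`. -/
structure WeightedVoganDiagram (n : ℕ) where
  cartan : Matrix (Fin n) (Fin n) ℤ
  cartan_diag : ∀ i, cartan i i = 2
  cartan_nonpos : ∀ i j, i ≠ j → cartan i j ≤ 0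
  finite_type : ∃ d : Fin n → ℝ, (∀ i, 0 < d i) ∧
    (cartan.map (Int.cast : ℤ → ℝ) * Matrix.diagonal d).PosDef
  theta : Equiv.Perm (Fin n)
  theta_theta : ∀ i, theta (theta i) = i
  cartan_theta : ∀ i j, cartan (theta i) (theta j) = cartan i j
  painted : Set (Fin n)
  theta_of_painted : ∀ i ∈ painted, theta i = i
  weight : Fin n → ℕ
  weight_le : ∀ i, weight i ≤ 2
  weight_theta : ∀ i, weight (theta i) = weight i

namespace WeightedVoganDiagram

variable {n : ℕ} (Γ : WeightedVoganDiagram n)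

/-- The root system of the Dynkin diagram, in coordinates with respect to the simple roots: the
smallest set containing the simple roots and stable under the simple reflections. -/
inductive IsRoot : (Fin n → ℤ) → Prop
  | simple (i : Fin n) : IsRoot (Pi.single i 1)
  | reflect (i : Fin n) (v : Fin n → ℤ) (hv : IsRoot v) :
      IsRoot (v - Pi.single i (∑ j, v j * Γ.cartan j i))

/-- The positive roots, in coordinates. -/
def posRoots : Set (Fin n → ℤ) := {v | Γ.IsRoot v ∧ ∀ i, 0 ≤ v i}

/-- The action of `θ` on the root lattice: `θ (∑ nᵢ αᵢ) = ∑ nᵢ α_{θ i}`. -/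
def thetaRoot (v : Fin n → ℤ) : Fin n → ℤ := fun i => v (Γ.theta.symm i)

/-- The weight `ω_α = ∑ nᵢ ωᵢ`. -/
def rootWeight (v : Fin n → ℤ) : ℤ := ∑ i, v i * (Γ.weight i : ℤ)

open Classical in
/-- The painted length `p_α = ∑_{i ∈ J} nᵢ`. -/
def paintedLength (v : Fin n → ℤ) : ℤ := ∑ i with i ∈ Γ.painted, v i

/-- The set `P_np^(j)`. -/
def pNonpainted (j : ℤ) : Set (Fin n → ℤ) :=
  {α | α ∈ Γ.posRoots ∧ Γ.rootWeight α = j ∧ Γ.thetaRoot α = α ∧ Even (Γ.paintedLength α) ∧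
    ¬ ∃ γ ∈ Γ.posRoots, α = γ + Γ.thetaRoot γ}

/-- The set `P_p^(j)`. -/
def pPainted (j : ℤ) : Set (Fin n → ℤ) :=
  {α | α ∈ Γ.posRoots ∧ Γ.rootWeight α = j ∧ Γ.thetaRoot α = α ∧ Odd (Γ.paintedLength α)} ∪
  {α | α ∈ Γ.posRoots ∧ ∃ γ ∈ Γ.posRoots, α = γ + Γ.thetaRoot γ ∧ 2 * Γ.rootWeight γ = j}

/-- The set `K^(j)` of unordered pairs `{α, θ α}`. -/
def kPairs (j : ℤ) : Set (Set (Fin n → ℤ)) :=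
  (fun α => {α, Γ.thetaRoot α}) ''
    {α | α ∈ Γ.posRoots ∧ Γ.thetaRoot α ≠ α ∧ Γ.rootWeight α = j}

/-- The number `N^θ` of nodes fixed by `θ`. -/
def numFixed : ℕ := {i | Γ.theta i = i}.ncard

/-- The number `N^θ_2` of two-element `θ`-orbits of nodes. -/
def numPairs : ℕ := ((fun i => ({i, Γ.theta i} : Set (Fin n))) '' {i | Γ.theta i ≠ i}).ncard

/-- Noticed abstract weighted Vogan diagrams. -/
def IsNoticed : Prop :=
  Γ.numFixed + Γ.numPairs + 2 * (Γ.pNonpainted 0).ncard + 2 * (Γ.kPairs 0).ncard =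
    (Γ.pPainted 2).ncard + (Γ.kPairs 2).ncard

/-- `Γ` is a weighted Vogan diagram associated to a KS-triple with neutral element `h`: there are a
`θ`-stable Cartan subalgebra `H ∋ h` with `H ∩ 𝔨` maximal abelian in `𝔨`, and a `θ`-stable base of
the root system of `H`, numbered by the nodes of `Γ`, such that the Dynkin diagram and the action
of `θ` on it are those of `Γ`, the painted nodes are the noncompact `θ`-fixed simple roots, and the
weights are the values `αᵢ(h)`. -/
def IsAssociated {L₀ : Type*} [LieRing L₀] [LieAlgebra ℝ L₀] [FiniteDimensional ℝ L₀]
    [LieAlgebra.IsSemisimple ℝ L₀] (θ : L₀ ≃ₗ⁅ℝ⁆ L₀) (h : ℂ ⊗[ℝ] L₀) : Prop :=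
  ∃ (H : LieSubalgebra ℂ (ℂ ⊗[ℝ] L₀)) (_ : H.IsCartanSubalgebra)
    (b : (LieAlgebra.IsKilling.rootSystem H).Base) (α : Fin n ≃ b.support) (hh : h ∈ H),
    (∀ x ∈ H, complexTheta θ x ∈ H) ∧
    (∀ x ∈ kSpace θ, (∀ y ∈ H, y ∈ kSpace θ → ⁅x, y⁆ = 0) → x ∈ H) ∧
    (∀ i j, Γ.cartan i j = b.cartanMatrix (α i) (α j)) ∧
    (∀ i, (LieAlgebra.rootSpace H
        ((α i).1 : LieModule.Weight ℂ H (ℂ ⊗[ℝ] L₀))).toSubmodule.map (complexTheta θ) =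
      (LieAlgebra.rootSpace H
        ((α (Γ.theta i)).1 : LieModule.Weight ℂ H (ℂ ⊗[ℝ] L₀))).toSubmodule) ∧
    (∀ i, i ∈ Γ.painted ↔ Γ.theta i = i ∧
      (LieAlgebra.rootSpace H
        ((α i).1 : LieModule.Weight ℂ H (ℂ ⊗[ℝ] L₀))).toSubmodule ≤ pSpace θ) ∧
    (∀ i, ((α i).1 : LieModule.Weight ℂ H (ℂ ⊗[ℝ] L₀)) ⟨h, hh⟩ = (Γ.weight i : ℂ))

end WeightedVoganDiagram

end NoticedOrbits

end

open scoped TensorProduct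

noncomputable section

namespace NoticedOrbits

/-! ### Exponentials of endomorphisms and of derivations -/

section Exponential

variable {𝕂 : Type*} [RCLike 𝕂]

open scoped Matrix.Norms.Operator in
/-- Exponentials of matrices intertwined by `T` are intertwined by `T`. -/
theorem matrix_mul_exp_of_intertwine {m n : Type*} [Fintype m] [DecidableEq m] [Fintype n]
    [DecidableEq n] (A : Matrix m m 𝕂) (B : Matrix n n 𝕂) (T : Matrix n m 𝕂)
    (hT : T * A = B * T) : T * NormedSpace.exp A = NormedSpace.exp B * T := by
  have hpow : ∀ k : ℕ, T * A ^ k = B ^ k * T := by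
    intro k
    induction k with
    | zero => simp
    | succ k ih => rw [pow_succ, pow_succ, ← Matrix.mul_assoc, ih, Matrix.mul_assoc, hT,
        Matrix.mul_assoc]
  have hA : HasSum (fun k : ℕ => ((k.factorial : 𝕂)⁻¹) • A ^ k) (NormedSpace.exp A) :=
    NormedSpace.exp_series_hasSum_exp' A
  have hB : HasSum (fun k : ℕ => ((k.factorial : 𝕂)⁻¹) • B ^ k) (NormedSpace.exp B) :=
    NormedSpace.exp_series_hasSum_exp' B
  have h1 : HasSum (fun k : ℕ => T * (((k.factorial : 𝕂)⁻¹) • A ^ k)) (T * NormedSpace.exp A) :=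
    hA.map (AddMonoidHom.mk' (fun X : Matrix m m 𝕂 => T * X) (fun _ _ => Matrix.mul_add _ _ _))
      (continuous_const.matrix_mul continuous_id)
  have h2 : HasSum (fun k : ℕ => (((k.factorial : 𝕂)⁻¹) • B ^ k) * T) (NormedSpace.exp B * T) :=
    hB.map (AddMonoidHom.mk' (fun X : Matrix n n 𝕂 => X * T) (fun _ _ => Matrix.add_mul _ _ _))
      (continuous_id.matrix_mul continuous_const)
  refine h1.unique ?_
  convert! h2 using 2 with k
  rw [Matrix.mul_smul, hpow, Matrix.smul_mul]

variable {V W : Type*} [AddCommGroup V] [Module 𝕂 V] [FiniteDimensional 𝕂 V]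
  [AddCommGroup W] [Module 𝕂 W] [FiniteDimensional 𝕂 W]

theorem comp_expEnd_of_intertwine (A : Module.End 𝕂 V) (B : Module.End 𝕂 W) (T : V →ₗ[𝕂] W)
    (hT : T ∘ₗ A = B ∘ₗ T) : T ∘ₗ expEnd 𝕂 A = expEnd 𝕂 B ∘ₗ T := by
  have key := matrix_mul_exp_of_intertwine
    (LinearMap.toMatrix (Module.finBasis 𝕂 V) (Module.finBasis 𝕂 V) A)
    (LinearMap.toMatrix (Module.finBasis 𝕂 W) (Module.finBasis 𝕂 W) B)
    (LinearMap.toMatrix (Module.finBasis 𝕂 V) (Module.finBasis 𝕂 W) T)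
    (by rw [← LinearMap.toMatrix_comp, ← LinearMap.toMatrix_comp, hT])
  apply (LinearMap.toMatrix (Module.finBasis 𝕂 V) (Module.finBasis 𝕂 W)).injective
  rw [LinearMap.toMatrix_comp _ (Module.finBasis 𝕂 V), LinearMap.toMatrix_comp _
    (Module.finBasis 𝕂 W), expEnd, expEnd, LinearMap.toMatrix_toLin, LinearMap.toMatrix_toLin, key]

theorem expEnd_add_of_commute (A B : Module.End 𝕂 V) (h : Commute A B) :
    expEnd 𝕂 (A + B) = expEnd 𝕂 A ∘ₗ expEnd 𝕂 B := by
  rw [expEnd, expEnd, expEnd, ← Matrix.toLin_mul, map_add, Matrix.exp_add_of_commute]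
  change _ * _ = _ * _
  rw [← LinearMap.toMatrix_comp, ← LinearMap.toMatrix_comp]
  exact congrArg _ h

/-- The exponential of a derivation is multiplicative. -/
theorem expEnd_bilinear (D : Module.End 𝕂 V) (μ : V →ₗ[𝕂] V →ₗ[𝕂] V)
    (hD : ∀ x y, D (μ x y) = μ (D x) y + μ x (D y)) (x y : V) :
    expEnd 𝕂 D (μ x y) = μ (expEnd 𝕂 D x) (expEnd 𝕂 D y) := by
  have h1 := comp_expEnd_of_intertwine (D.rTensor V + D.lTensor V) D (TensorProduct.lift μ)
    (by ext a b; simp [hD])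
  have h2 : expEnd 𝕂 (D.rTensor V + D.lTensor V) =
      expEnd 𝕂 (D.rTensor V) ∘ₗ expEnd 𝕂 (D.lTensor V) := by
    apply expEnd_add_of_commute
    change _ ∘ₗ _ = _ ∘ₗ _
    ext a b; simp
  have h3 (z : V) := comp_expEnd_of_intertwine D (D.rTensor V) ((TensorProduct.mk 𝕂 V V).flip z)
    (by ext a; simp)
  have h4 (z : V) := comp_expEnd_of_intertwine D (D.lTensor V) (TensorProduct.mk 𝕂 V V z)
    (by ext a; simp)
  have e1 := LinearMap.congr_fun h1 (x ⊗ₜ y)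
  have e3 := LinearMap.congr_fun (h3 (expEnd 𝕂 D y)) x
  have e4 := LinearMap.congr_fun (h4 x) y
  simp only [LinearMap.comp_apply, LinearMap.flip_apply, TensorProduct.mk_apply,
    TensorProduct.lift.tmul, h2] at e1 e3 e4
  rw [← e4, ← e3] at e1
  simpa using e1.symm

end Exponential

section AdjointGroup

variable {𝕂 : Type*} [RCLike 𝕂] {L : Type*} [LieRing L] [LieAlgebra 𝕂 L] [FiniteDimensional 𝕂 L]

theorem adGroup_apply_lie {S : Set L} {φ : L ≃ₗ[𝕂] L} (hφ : φ ∈ adGroup 𝕂 S) (x y : L) :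
    φ ⁅x, y⁆ = ⁅φ x, φ y⁆ := by
  induction hφ using Subgroup.closure_induction generalizing x y with
  | mem φ h =>
    obtain ⟨z, -, hz⟩ := h
    have e : ∀ w, φ w = expEnd 𝕂 (LieAlgebra.ad 𝕂 L z) w := fun w => LinearMap.congr_fun hz w
    rw [e, e, e]
    exact expEnd_bilinear (LieAlgebra.ad 𝕂 L z) (LieModule.toEnd 𝕂 L L : L →ₗ[𝕂] L →ₗ[𝕂] L)
      (fun a b => by simp) x y
  | one => rfl
  | mul a b _ _ ha hb => rw [LinearEquiv.mul_apply, hb, ha]; rfl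
  | inv a _ ha =>
    apply a.injective
    rw [ha]
    have : ∀ w, a (a⁻¹ w) = w := fun w => a.apply_symm_apply w
    rw [this, this, this]

theorem adGroup_apply_comm {S : Set L} (T : L →ₗ[𝕂] L) (hT : ∀ x ∈ S, ∀ y, T ⁅x, y⁆ = ⁅x, T y⁆)
    {φ : L ≃ₗ[𝕂] L} (hφ : φ ∈ adGroup 𝕂 S) (x : L) : φ (T x) = T (φ x) := by
  induction hφ using Subgroup.closure_induction generalizing x with
  | mem φ h =>
    obtain ⟨z, hzS, hz⟩ := h
    have e : ∀ w, φ w = expEnd 𝕂 (LieAlgebra.ad 𝕂 L z) w := fun w => LinearMap.congr_fun hz w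
    rw [e, e]
    exact (LinearMap.congr_fun (comp_expEnd_of_intertwine (LieAlgebra.ad 𝕂 L z)
      (LieAlgebra.ad 𝕂 L z) T (by ext w; simp [hT z hzS])) x).symm
  | one => rfl
  | mul a b _ _ ha hb => rw [LinearEquiv.mul_apply, hb, ha]; rfl
  | inv a _ ha =>
    apply a.injective
    have : ∀ w, a (a⁻¹ w) = w := fun w => a.apply_symm_apply w
    rw [this, ha, this]

/-- An element of an adjoint group, as a Lie algebra automorphism. -/
def lieEquivOfAdGroup {S : Set L} {φ : L ≃ₗ[𝕂] L} (hφ : φ ∈ adGroup 𝕂 S) : L ≃ₗ⁅𝕂⁆ L :=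
  { φ with map_lie' := fun {x y} => adGroup_apply_lie hφ x y }

@[simp] theorem lieEquivOfAdGroup_apply {S : Set L} {φ : L ≃ₗ[𝕂] L} (hφ : φ ∈ adGroup 𝕂 S)
    (x : L) : lieEquivOfAdGroup hφ x = φ x := rfl

end AdjointGroup

/-! ### Elements of the complexification as pairs of real elements -/

section CplxBasic

variable {L₀ : Type*} [LieRing L₀] [LieAlgebra ℝ L₀]

/-- The element `a + i b` of the complexification. -/
def cplx (a b : L₀) : ℂ ⊗[ℝ] L₀ := (1 : ℂ) ⊗ₜ[ℝ] a + Complex.I ⊗ₜ[ℝ] b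

theorem exists_cplx (x : ℂ ⊗[ℝ] L₀) : ∃ a b : L₀, x = cplx a b := exists_re_im x

theorem tmul_eq_cplx (z : ℂ) (a : L₀) : z ⊗ₜ[ℝ] a = cplx (z.re • a) (z.im • a) := by
  rw [cplx, ← TensorProduct.smul_tmul, ← TensorProduct.smul_tmul, ← TensorProduct.add_tmul]
  congr 1
  apply Complex.ext <;> simp

theorem one_tmul_eq_cplx (a : L₀) : (1 : ℂ) ⊗ₜ[ℝ] a = cplx a 0 := by simp [cplx]

theorem I_tmul_eq_cplx (a : L₀) : Complex.I ⊗ₜ[ℝ] a = cplx 0 a := by simp [cplx]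

theorem cplx_inj {a b c d : L₀} : cplx a b = cplx c d ↔ a = c ∧ b = d := by
  constructor
  · intro h
    have hre := congrArg (TensorProduct.lid ℝ L₀ ∘ LinearMap.rTensor L₀ Complex.reLm) h
    have him := congrArg (TensorProduct.lid ℝ L₀ ∘ LinearMap.rTensor L₀ Complex.imLm) h
    simp only [cplx, Function.comp_apply, map_add, LinearMap.rTensor_tmul,
      TensorProduct.lid_tmul] at hre him
    simpa using And.intro hre him
  · rintro ⟨rfl, rfl⟩; rfl

theorem cplx_eq_zero {a b : L₀} : cplx a b = 0 ↔ a = 0 ∧ b = 0 := by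
  rw [← cplx_inj (c := (0 : L₀)) (d := 0)]; simp [cplx]

theorem cplx_add (a b c d : L₀) : cplx a b + cplx c d = cplx (a + c) (b + d) := by
  simp only [cplx, TensorProduct.tmul_add]; abel

theorem cplx_neg (a b : L₀) : -cplx a b = cplx (-a) (-b) := by
  simp only [cplx, TensorProduct.tmul_neg]; abel

theorem cplx_sub (a b c d : L₀) : cplx a b - cplx c d = cplx (a - c) (b - d) := by
  simp only [cplx, TensorProduct.tmul_sub]; abel

theorem smul_cplx (z : ℂ) (a b : L₀) :
    z • cplx a b = cplx (z.re • a - z.im • b) (z.im • a + z.re • b) := by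
  have h : z • cplx a b = (z * 1) ⊗ₜ[ℝ] a + (z * Complex.I) ⊗ₜ[ℝ] b := by
    simp [cplx, TensorProduct.smul_tmul']
  rw [h, tmul_eq_cplx, tmul_eq_cplx, cplx_add]
  simp [sub_eq_add_neg]

theorem two_nsmul_cplx (a b : L₀) : 2 • cplx a b = cplx (2 • a) (2 • b) := by
  simp only [two_nsmul, cplx_add]

theorem lie_cplx (a b c d : L₀) :
    ⁅cplx a b, cplx c d⁆ = cplx (⁅a, c⁆ - ⁅b, d⁆) (⁅a, d⁆ + ⁅b, c⁆) := by
  simp only [cplx, add_lie, lie_add, LieAlgebra.ExtendScalars.bracket_tmul, mul_one, one_mul,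
    Complex.I_mul_I, TensorProduct.tmul_add, TensorProduct.tmul_sub, TensorProduct.neg_tmul]
  abel

theorem complexTheta_cplx (θ : L₀ ≃ₗ⁅ℝ⁆ L₀) (a b : L₀) :
    complexTheta θ (cplx a b) = cplx (θ a) (θ b) := by
  simp [complexTheta, cplx]

theorem conjugation_cplx (a b : L₀) : conjugation (cplx a b) = cplx a (-b) := by
  simp [conjugation, cplx, TensorProduct.neg_tmul, TensorProduct.tmul_neg]

theorem complexTheta_lie (θ : L₀ ≃ₗ⁅ℝ⁆ L₀) (x y : ℂ ⊗[ℝ] L₀) :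
    complexTheta θ ⁅x, y⁆ = ⁅complexTheta θ x, complexTheta θ y⁆ := by
  obtain ⟨a, b, rfl⟩ := exists_cplx x
  obtain ⟨c, d, rfl⟩ := exists_cplx y
  simp [lie_cplx, complexTheta_cplx, LieEquiv.map_lie]

theorem conjugation_lie (x y : ℂ ⊗[ℝ] L₀) :
    conjugation ⁅x, y⁆ = ⁅conjugation x, conjugation y⁆ := by
  obtain ⟨a, b, rfl⟩ := exists_cplx x
  obtain ⟨c, d, rfl⟩ := exists_cplx y
  simp [lie_cplx, conjugation_cplx, add_comm]

theorem conjugation_conjugation (x : ℂ ⊗[ℝ] L₀) : conjugation (conjugation x) = x := by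
  obtain ⟨a, b, rfl⟩ := exists_cplx x
  simp [conjugation_cplx]

theorem complexTheta_conjugation (θ : L₀ ≃ₗ⁅ℝ⁆ L₀) (x : ℂ ⊗[ℝ] L₀) :
    complexTheta θ (conjugation x) = conjugation (complexTheta θ x) := by
  obtain ⟨a, b, rfl⟩ := exists_cplx x
  simp [conjugation_cplx, complexTheta_cplx]

theorem mem_kSpace {θ : L₀ ≃ₗ⁅ℝ⁆ L₀} {x : ℂ ⊗[ℝ] L₀} : x ∈ kSpace θ ↔ complexTheta θ x = x := by
  simp [kSpace, sub_eq_zero]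

theorem mem_pSpace {θ : L₀ ≃ₗ⁅ℝ⁆ L₀} {x : ℂ ⊗[ℝ] L₀} : x ∈ pSpace θ ↔ complexTheta θ x = -x := by
  simp [pSpace, add_eq_zero_iff_eq_neg]

theorem complexTheta_complexTheta {θ : L₀ ≃ₗ⁅ℝ⁆ L₀} (hθ : ∀ x, θ (θ x) = x) (x : ℂ ⊗[ℝ] L₀) :
    complexTheta θ (complexTheta θ x) = x := by
  obtain ⟨a, b, rfl⟩ := exists_cplx x
  simp [complexTheta_cplx, hθ]

theorem cplx_lie_add (x y z : ℂ ⊗[ℝ] L₀) : ⁅x, y + z⁆ = ⁅x, y⁆ + ⁅x, z⁆ := lie_add x y z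

theorem cplx_lie_smul (c : ℂ) (x y : ℂ ⊗[ℝ] L₀) : ⁅x, c • y⁆ = c • ⁅x, y⁆ := lie_smul c x y

theorem cplx_smul_lie (c : ℂ) (x y : ℂ ⊗[ℝ] L₀) : ⁅c • x, y⁆ = c • ⁅x, y⁆ := smul_lie c x y

/-- The complex-linear extension of an involution, as a Lie algebra automorphism. -/
def thetaEquiv (θ : L₀ ≃ₗ⁅ℝ⁆ L₀) (hθ : ∀ x, θ (θ x) = x) : (ℂ ⊗[ℝ] L₀) ≃ₗ⁅ℂ⁆ (ℂ ⊗[ℝ] L₀) :=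
  { complexTheta θ with
    map_lie' := fun {x y} => complexTheta_lie θ x y
    invFun := complexTheta θ
    left_inv := complexTheta_complexTheta hθ
    right_inv := complexTheta_complexTheta hθ }

@[simp] theorem thetaEquiv_apply (θ : L₀ ≃ₗ⁅ℝ⁆ L₀) (hθ : ∀ x, θ (θ x) = x) (x : ℂ ⊗[ℝ] L₀) :
    thetaEquiv θ hθ x = complexTheta θ x := rfl

end CplxBasic

section Killing

/-- Invariance of the Killing form, moving an operator across as its negative. -/
theorem killingForm_lie_left {K L : Type*} [CommRing K] [LieRing L] [LieAlgebra K L] (z x y : L) :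
    killingForm K L ⁅z, x⁆ y = -killingForm K L x ⁅z, y⁆ := by
  rw [← lie_skew, map_neg, LinearMap.neg_apply, LieModule.traceForm_apply_lie_apply]

variable {L₀ : Type*} [LieRing L₀] [LieAlgebra ℝ L₀] [FiniteDimensional ℝ L₀]

theorem killingForm_cplx (a b c d : L₀) :
    killingForm ℂ (ℂ ⊗[ℝ] L₀) (cplx a b) (cplx c d) =
      ((killingForm ℝ L₀ a c - killingForm ℝ L₀ b d : ℝ) : ℂ) +
        ((killingForm ℝ L₀ a d + killingForm ℝ L₀ b c : ℝ) : ℂ) * Complex.I := by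
  have hB : killingForm ℂ (ℂ ⊗[ℝ] L₀) = (killingForm ℝ L₀).baseChange ℂ :=
    LieModule.traceForm_baseChange ..
  rw [hB]
  simp only [cplx, map_add, LinearMap.add_apply, LinearMap.BilinForm.baseChange_tmul, mul_one,
    one_mul, Complex.I_mul_I, Algebra.smul_def, Complex.coe_algebraMap]
  push_cast
  ring

/-- The form `(x, y) ↦ -B(x, θ (σ y))` attached to the compact real form. -/
def herm (θ : L₀ ≃ₗ⁅ℝ⁆ L₀) (x y : ℂ ⊗[ℝ] L₀) : ℂ :=
  -killingForm ℂ (ℂ ⊗[ℝ] L₀) x (complexTheta θ (conjugation y))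

variable {θ : L₀ ≃ₗ⁅ℝ⁆ L₀}

theorem herm_smul_left (z : ℂ) (x y : ℂ ⊗[ℝ] L₀) : herm θ (z • x) y = z * herm θ x y := by
  simp [herm]

theorem herm_neg_right (x y : ℂ ⊗[ℝ] L₀) : herm θ x (-y) = -herm θ x y := by
  simp only [herm, map_neg]

theorem herm_lie_left (z x y : ℂ ⊗[ℝ] L₀) (hθ : ∀ x, θ (θ x) = x) :
    herm θ ⁅z, x⁆ y = -herm θ x ⁅complexTheta θ (conjugation z), y⁆ := by
  have h : complexTheta θ (conjugation (complexTheta θ (conjugation z))) = z := by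
    rw [← complexTheta_conjugation, complexTheta_complexTheta hθ, conjugation_conjugation]
  rw [herm, herm, killingForm_lie_left, conjugation_lie, complexTheta_lie, h]

theorem killingForm_theta (θ : L₀ ≃ₗ⁅ℝ⁆ L₀) (x y : L₀) :
    killingForm ℝ L₀ (θ x) (θ y) = killingForm ℝ L₀ x y :=
  LieAlgebra.killingForm_of_equiv_apply θ x y

namespace IsCartanInvolution

variable (hθ : IsCartanInvolution θ)
include hθ

theorem herm_symm (x y : ℂ ⊗[ℝ] L₀) : herm θ y x = (starRingEnd ℂ) (herm θ x y) := by
  obtain ⟨a, b, rfl⟩ := exists_cplx x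
  obtain ⟨c, d, rfl⟩ := exists_cplx y
  have h : ∀ u v, killingForm ℝ L₀ u (θ v) = killingForm ℝ L₀ v (θ u) := fun u v => by
    rw [← killingForm_theta θ, hθ.involutive, LieModule.traceForm_comm]
  simp only [herm, conjugation_cplx, complexTheta_cplx, killingForm_cplx, map_neg, map_add,
    map_mul, Complex.conj_ofReal, Complex.conj_I]
  rw [h c a, h d b, h c b, h d a]
  push_cast
  ring

theorem herm_self_eq (a b : L₀) : herm θ (cplx a b) (cplx a b) =
    ((-killingForm ℝ L₀ a (θ a) + -killingForm ℝ L₀ b (θ b) : ℝ) : ℂ) := by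
  have h : ∀ u v, killingForm ℝ L₀ u (θ v) = killingForm ℝ L₀ v (θ u) := fun u v => by
    rw [← killingForm_theta θ, hθ.involutive, LieModule.traceForm_comm]
  simp only [herm, conjugation_cplx, complexTheta_cplx, killingForm_cplx, map_neg]
  rw [h b a]
  push_cast
  ring

theorem killing_theta_nonpos (a : L₀) : 0 ≤ -killingForm ℝ L₀ a (θ a) := by
  by_cases h : a = 0
  · simp [h]
  · exact (hθ.pos a h).le

theorem eq_zero_of_killing_theta {a : L₀} (h : killingForm ℝ L₀ a (θ a) = 0) : a = 0 := by
  by_contra h'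
  have := hθ.pos a h'
  rw [h] at this
  simp at this

theorem eq_zero_of_herm_self {x : ℂ ⊗[ℝ] L₀} (h : herm θ x x = 0) : x = 0 := by
  obtain ⟨a, b, rfl⟩ := exists_cplx x
  rw [hθ.herm_self_eq, Complex.ofReal_eq_zero] at h
  have ha := hθ.killing_theta_nonpos a
  have hb := hθ.killing_theta_nonpos b
  rw [cplx_eq_zero]
  exact ⟨hθ.eq_zero_of_killing_theta (by linarith), hθ.eq_zero_of_killing_theta (by linarith)⟩

/-- If `x` is skew for the compact form then `ad (i x)` is symmetric. -/
theorem herm_I_lie {y : L₀} (hy : θ y = y) (u v : ℂ ⊗[ℝ] L₀) :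
    herm θ ⁅Complex.I ⊗ₜ[ℝ] y, u⁆ v = herm θ u ⁅Complex.I ⊗ₜ[ℝ] y, v⁆ := by
  rw [herm_lie_left _ _ _ hθ.involutive, I_tmul_eq_cplx, conjugation_cplx, complexTheta_cplx,
    map_neg, hy, map_zero, ← neg_zero, ← cplx_neg, neg_lie, neg_zero, herm_neg_right, neg_neg]

theorem lie_I_lie_I_eq_zero {y : L₀} (hy : θ y = y) {w : ℂ ⊗[ℝ] L₀}
    (h : ⁅Complex.I ⊗ₜ[ℝ] y, ⁅Complex.I ⊗ₜ[ℝ] y, w⁆⁆ = 0) : ⁅Complex.I ⊗ₜ[ℝ] y, w⁆ = 0 := by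
  apply hθ.eq_zero_of_herm_self
  rw [hθ.herm_I_lie hy, h]
  simp [herm]

/-- The eigenvalues of `ad (i y)`, for `y ∈ 𝔨₀`, are real. -/
theorem im_eq_zero_of_lie_I_eq_smul {y : L₀} (hy : θ y = y) {w : ℂ ⊗[ℝ] L₀} (hw : w ≠ 0) {c : ℂ}
    (h : ⁅Complex.I ⊗ₜ[ℝ] y, w⁆ = c • w) : c.im = 0 := by
  have h1 := hθ.herm_I_lie hy w w
  have h0 : herm θ w w ≠ 0 := fun h0 => hw (hθ.eq_zero_of_herm_self h0)
  rw [h, herm_smul_left, hθ.herm_symm (c • w) w, herm_smul_left, map_mul, ← hθ.herm_symm w w] at h1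
  exact Complex.conj_eq_iff_im.mp (mul_right_cancel₀ h0 h1).symm

/-- For `h₀ ∈ 𝔭₀` the operator `ad h₀` is semisimple. -/
theorem lie_lie_eq_zero_of_theta_neg {h₀ w : L₀} (hh : θ h₀ = -h₀) (h : ⁅h₀, ⁅h₀, w⁆⁆ = 0) :
    ⁅h₀, w⁆ = 0 := by
  apply hθ.eq_zero_of_killing_theta
  rw [killingForm_lie_left, ← killingForm_theta θ, LieEquiv.map_lie, hθ.involutive, hh, neg_lie,
    h]
  simp

end IsCartanInvolution

end Killing

/-! ### The Cayley transform -/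

section Cayley

variable {L₀ : Type*} [LieRing L₀] [LieAlgebra ℝ L₀] {θ : L₀ ≃ₗ⁅ℝ⁆ L₀}

theorem cayleyE_eq (h₀ e₀ f₀ : L₀) :
    cayleyE h₀ e₀ f₀ = cplx ((1 / 2 : ℝ) • h₀) (-((1 / 2 : ℝ) • (e₀ + f₀))) := by
  rw [cayleyE, one_tmul_eq_cplx, I_tmul_eq_cplx, cplx_sub, smul_cplx, cplx_inj]
  constructor
  · simp
  · simp

theorem IsRealCayleyTriple.theta_f {h₀ e₀ f₀ : L₀} (t : IsRealCayleyTriple θ h₀ e₀ f₀)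
    (hθ : ∀ x, θ (θ x) = x) : θ f₀ = -e₀ := by
  rw [← hθ e₀, t.theta_e]; simp

/-- The Cayley transform of an adapted real triple is a KS-triple. -/
theorem IsRealCayleyTriple.isKSTriple {h₀ e₀ f₀ : L₀} (t : IsRealCayleyTriple θ h₀ e₀ f₀)
    (hθ : ∀ x, θ (θ x) = x) :
    IsKSTriple θ (Complex.I ⊗ₜ[ℝ] (e₀ - f₀)) (cayleyE h₀ e₀ f₀)
      (conjugation (cayleyE h₀ e₀ f₀)) := by
  have hf := t.theta_f hθ
  have h1 := t.sl2.lie_e_f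
  have h2 := t.sl2.lie_h_e_nsmul
  have h3 := t.sl2.lie_h_f_nsmul
  have h1' : ⁅f₀, e₀⁆ = -h₀ := by rw [← lie_skew, h1]
  have h2' : ⁅e₀, h₀⁆ = -(2 • e₀) := by rw [← lie_skew, h2]
  have h3' : ⁅f₀, h₀⁆ = 2 • f₀ := by rw [← lie_skew, h3, neg_neg]
  have hne : e₀ - f₀ ≠ 0 := by
    intro h0
    have : e₀ = f₀ := sub_eq_zero.mp h0
    rw [← this, lie_self] at h1
    exact t.sl2.h_ne_zero h1.symm
  rw [cayleyE_eq, conjugation_cplx, I_tmul_eq_cplx]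
  refine ⟨⟨?_, ?_, ?_, ?_⟩, ?_, ?_, ?_, ?_⟩
  · rw [Ne, cplx_eq_zero]; exact fun h => hne h.2
  · simp only [lie_cplx, cplx_inj, lie_smul, smul_lie, neg_lie, lie_add, add_lie, h1, h1', h2, h3,
      h2', h3', neg_neg, lie_self]
    constructor <;> module
  · simp only [lie_cplx, cplx_inj, lie_smul, smul_lie, lie_neg, neg_lie, lie_add, sub_lie, h2',
      h3', h1, h1', lie_self, two_nsmul_cplx, zero_lie, lie_zero]
    constructor <;> module
  · simp only [lie_cplx, cplx_inj, lie_smul, smul_lie, lie_neg, neg_lie, lie_add, sub_lie, h2',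
      h3', h1, h1', lie_self, two_nsmul_cplx, zero_lie, lie_zero, cplx_neg]
    constructor <;> module
  · rw [mem_pSpace, complexTheta_cplx, cplx_neg, cplx_inj]
    simp only [map_neg, map_smul, map_add, t.theta_h, t.theta_e, hf]
    constructor <;> module
  · rw [mem_pSpace, complexTheta_cplx, cplx_neg, cplx_inj]
    simp only [map_neg, map_smul, map_add, t.theta_h, t.theta_e, hf]
    constructor <;> module
  · rw [conjugation_cplx]
  · refine ⟨e₀ - f₀, ?_, (I_tmul_eq_cplx _).symm⟩
    rw [map_sub, t.theta_e, hf]; abel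

/-- Every KS-triple is a Cayley transform. -/
theorem IsKSTriple.exists_realCayleyTriple {h e f : ℂ ⊗[ℝ] L₀} (t : IsKSTriple θ h e f) :
    ∃ h₀ e₀ f₀ : L₀, IsRealCayleyTriple θ h₀ e₀ f₀ ∧ cayleyE h₀ e₀ f₀ = e := by
  obtain ⟨x, hx, rfl⟩ := t.h_mem
  obtain ⟨a, b, rfl⟩ := exists_cplx e
  have hf := t.f_eq
  rw [conjugation_cplx] at hf
  subst hf
  have he := mem_pSpace.mp t.e_mem
  rw [complexTheta_cplx, cplx_neg, cplx_inj] at he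
  have h1 := t.sl2.lie_e_f
  have h2 := t.sl2.lie_h_e_nsmul
  have hba : ⁅b, a⁆ = -⁅a, b⁆ := by rw [lie_skew]
  simp only [I_tmul_eq_cplx, lie_cplx, two_nsmul_cplx, cplx_inj, lie_neg, hba, zero_lie, zero_sub,
    zero_add] at h1 h2
  have hxe : x = (-2 : ℝ) • ⁅a, b⁆ := by rw [← h1.2]; module
  have hxa : ⁅x, a⁆ = 2 • b := h2.2
  have hxb : ⁅x, b⁆ = -(2 • a) := by rw [← h2.1, neg_neg]
  have hax : ⁅a, x⁆ = -(2 • b) := by rw [← lie_skew, hxa]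
  have hbx : ⁅b, x⁆ = 2 • a := by rw [← lie_skew, hxb, neg_neg]
  have hab : ⁅a, b⁆ = (-1 / 2 : ℝ) • x := by rw [hxe]; module
  have hba' : ⁅b, a⁆ = (1 / 2 : ℝ) • x := by rw [hba, hab]; module
  have ha0 : a ≠ 0 := by
    rintro rfl
    apply t.sl2.h_ne_zero
    rw [hxe]; simp
  refine ⟨(2 : ℝ) • a, -b + (1 / 2 : ℝ) • x, -b - (1 / 2 : ℝ) • x, ⟨⟨?_, ?_, ?_, ?_⟩, ?_, ?_⟩, ?_⟩
  · simpa using ha0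
  · simp only [lie_smul, smul_lie, lie_neg, neg_lie, lie_add, add_lie, lie_sub, hbx, hxb, lie_self]
    module
  · simp only [lie_smul, smul_lie, lie_neg, lie_add, hab, hax]
    module
  · simp only [lie_smul, smul_lie, lie_neg, lie_sub, hab, hax]
    module
  · rw [map_smul, he.1]; module
  · rw [map_add, map_smul, map_neg, he.2, hx]; module
  · rw [cayleyE_eq, cplx_inj]
    constructor <;> module

end Cayley

/-! ### Centralizers of `𝔰𝔩₂`-triples -/

section Sl2

open Module

theorem lie_f_eq_zero_of_lie_e_of_lie_h (K : Type*) {L : Type*} [Field K] [CharZero K] [LieRing L]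
    [LieAlgebra K L] [FiniteDimensional K L] {h e f : L}
    (t : IsSl2Triple h e f) {y : L} (he : ⁅e, y⁆ = 0)
    (hh : ⁅h, y⁆ = 0) : ⁅f, y⁆ = 0 := by
  by_cases hy : y = 0
  · simp [hy]
  have P : t.HasPrimitiveVectorWith y (0 : K) := ⟨hy, by simpa using hh, he⟩
  simpa using P.pow_toEnd_f_eq_zero_of_eq_nat (n := 0) (by simp)

theorem eq_zero_of_lie_f_of_lie_h {K : Type*} {L : Type*} [Field K] [CharZero K] [LieRing L]
    [LieAlgebra K L] [FiniteDimensional K L] {h e f : L}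
    (t : IsSl2Triple h e f) {y : L} (hf : ⁅f, y⁆ = 0) {c : K}
    (hh : ⁅h, y⁆ = c • y) (hc : ∀ n : ℕ, c ≠ -(n : K)) : y = 0 := by
  by_contra hy
  have P : t.symm.HasPrimitiveVectorWith y (-c) := ⟨hy, by rw [neg_lie, hh, neg_smul], hf⟩
  obtain ⟨n, hn⟩ := P.exists_nat
  exact hc n (by rw [← hn, neg_neg])

/-- If `ad h` is semisimple, the centralizer of `e` is the sum of the centralizer of the triple and
of a subspace of the image of `ad e`. -/
theorem exists_centralizer_decomposition (K : Type*) {L : Type*} [Field K] [CharZero K] [LieRing L]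
    [LieAlgebra K L] [FiniteDimensional K L] {h e f : L}
    (t : IsSl2Triple h e f)
    (hss : ∀ w : L, ⁅h, ⁅h, w⁆⁆ = 0 → ⁅h, w⁆ = 0) {y : L} (hy : ⁅e, y⁆ = 0) :
    ∃ y₀ w : L, ⁅e, y₀⁆ = 0 ∧ ⁅h, y₀⁆ = 0 ∧ ⁅f, y₀⁆ = 0 ∧ y = y₀ + ⁅e, ⁅f, w⁆⁆ := by
  let V : Submodule K L := LinearMap.ker (LieAlgebra.ad K L e)
  have hV : ∀ {w}, w ∈ V ↔ ⁅e, w⁆ = 0 := by simp [V]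
  have hmap : ∀ w ∈ V, LieAlgebra.ad K L h w ∈ V := by
    intro w hw
    rw [hV] at hw ⊢
    rw [LieAlgebra.ad_apply, leibniz_lie, hw, lie_zero, add_zero, ← lie_skew e h,
      t.lie_h_e_nsmul, neg_lie, nsmul_lie, hw]
    simp
  let T : V →ₗ[K] V := (LieAlgebra.ad K L h).restrict hmap
  have hT : ∀ w, (T w : L) = ⁅h, (w : L)⁆ := fun w => rfl
  have hdisj : Disjoint (LinearMap.ker T) (LinearMap.range T) := by
    rw [Submodule.disjoint_def]
    rintro _ hx ⟨w, rfl⟩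
    rw [LinearMap.mem_ker, Subtype.ext_iff, hT, hT] at hx
    rw [Subtype.ext_iff, hT]
    exact hss _ hx
  have htop := Submodule.eq_top_of_disjoint _ _
    (by rw [add_comm, LinearMap.finrank_range_add_finrank_ker]) hdisj
  have hmem : (⟨y, hV.mpr hy⟩ : V) ∈ LinearMap.ker T ⊔ LinearMap.range T := by rw [htop]; trivial
  obtain ⟨a, ha, b, ⟨w, rfl⟩, hab⟩ := Submodule.mem_sup.mp hmem
  rw [LinearMap.mem_ker, Subtype.ext_iff, hT] at ha
  have hae := hV.mp a.2
  refine ⟨a, w, hae, ha, lie_f_eq_zero_of_lie_e_of_lie_h K t hae ha, ?_⟩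
  have h1 : ⁅h, (w : L)⁆ = ⁅e, ⁅f, (w : L)⁆⁆ := by
    rw [← t.lie_e_f, lie_lie, hV.mp w.2]; simp
  rw [← h1, ← hT]
  exact congrArg Subtype.val hab.symm

/-- If `ad h` is semisimple, the Killing form on the centralizer of `e` only depends on the
components in the centralizer of the triple. -/
theorem exists_centralizer_killingForm (K : Type*) {L : Type*} [Field K] [CharZero K] [LieRing L]
    [LieAlgebra K L] [FiniteDimensional K L] {h e f : L}
    (t : IsSl2Triple h e f)
    (hss : ∀ w : L, ⁅h, ⁅h, w⁆⁆ = 0 → ⁅h, w⁆ = 0) {y : L} (hy : ⁅e, y⁆ = 0) :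
    ∃ y₀ : L, ⁅e, y₀⁆ = 0 ∧ ⁅h, y₀⁆ = 0 ∧ ⁅f, y₀⁆ = 0 ∧
      ∀ x, ⁅e, x⁆ = 0 → killingForm K L x y = killingForm K L x y₀ := by
  obtain ⟨y₀, w, h1, h2, h3, rfl⟩ := exists_centralizer_decomposition K t hss hy
  refine ⟨y₀, h1, h2, h3, fun x hx => ?_⟩
  rw [map_add, ← neg_eq_iff_eq_neg.mpr (killingForm_lie_left (K := K) e x ⁅f, w⁆), hx]
  simp

/-- The nilpositive element of an `𝔰𝔩₂`-triple is ad-nilpotent. -/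
theorem isNilpotent_ad_of_isSl2Triple (K : Type*) {L : Type*} [Field K] [CharZero K] [LieRing L]
    [LieAlgebra K L] [FiniteDimensional K L] {h e f : L}
    (t : IsSl2Triple h e f) :
    IsNilpotent (LieAlgebra.ad K L e) := by
  by_contra hnil
  have hpow : ∀ n, (LieAlgebra.ad K L e) ^ n ≠ 0 := fun n hn => hnil ⟨n, hn⟩
  let D : Module.End K (Module.End K L) :=
    LinearMap.mulLeft K (LieAlgebra.ad K L h) - LinearMap.mulRight K (LieAlgebra.ad K L h)
  have hD : ∀ A, D A = LieAlgebra.ad K L h * A - A * LieAlgebra.ad K L h := fun A => rfl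
  have h1 : D (LieAlgebra.ad K L e) = (2 : K) • LieAlgebra.ad K L e := by
    rw [hD]
    ext x
    have : ⁅⁅h, e⁆, x⁆ = (2 : K) • ⁅e, x⁆ := by rw [t.lie_h_e_smul K, smul_lie]
    rw [lie_lie] at this
    simpa using this
  have h2 : ∀ n : ℕ, D ((LieAlgebra.ad K L e) ^ n) = (2 * n : K) • (LieAlgebra.ad K L e) ^ n := by
    intro n
    induction n with
    | zero => simp [hD]
    | succ n ih =>
      have : ∀ A B, D (A * B) = D A * B + A * D B := fun A B => by
        simp only [hD]; noncomm_ring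
      rw [pow_succ, this, ih, h1, smul_mul_assoc, mul_smul_comm, ← add_smul]
      congr 1; push_cast; ring
  have hev : ∀ n : ℕ, D.HasEigenvalue (2 * n : K) := fun n =>
    Module.End.hasEigenvalue_of_hasEigenvector
      (Module.End.hasEigenvector_iff.mpr ⟨Module.End.mem_eigenspace_iff.mpr (h2 n), hpow n⟩)
  have hfin : (Set.range fun n : ℕ => (2 * n : K)).Finite :=
    (Module.End.finite_hasEigenvalue D).subset (by rintro _ ⟨n, rfl⟩; exact hev n)
  exact (Set.infinite_range_of_injective (fun m n hmn => by simpa using hmn)) hfin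

end Sl2

/-! ### Compact centralizers of KS-triples -/

section CompactCentralizer

variable {L₀ : Type*} [LieRing L₀] [LieAlgebra ℝ L₀] {θ : L₀ ≃ₗ⁅ℝ⁆ L₀}

/-- Some nonzero element of `𝔨₀` centralizes `e`. -/
def HasCompactCentralizer (θ : L₀ ≃ₗ⁅ℝ⁆ L₀) (e : ℂ ⊗[ℝ] L₀) : Prop :=
  ∃ y : L₀, y ≠ 0 ∧ θ y = y ∧ ⁅(1 : ℂ) ⊗ₜ[ℝ] y, e⁆ = 0

variable {h e f : ℂ ⊗[ℝ] L₀}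

theorem IsKSTriple.conj_e (t : IsKSTriple θ h e f) : conjugation e = f := t.f_eq.symm

theorem IsKSTriple.conj_f (t : IsKSTriple θ h e f) : conjugation f = e := by
  rw [t.f_eq, conjugation_conjugation]

theorem IsKSTriple.theta_h (t : IsKSTriple θ h e f) : complexTheta θ h = h := by
  obtain ⟨x, hx, rfl⟩ := t.h_mem
  rw [I_tmul_eq_cplx, complexTheta_cplx, hx, map_zero]

variable [FiniteDimensional ℝ L₀]

theorem IsKSTriple.hasCompactCentralizer_of_mem (t : IsKSTriple θ h e f) {v : ℂ ⊗[ℝ] L₀}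
    (hv : v ≠ 0) (hk : v ∈ kSpace θ) (hh : ⁅h, v⁆ = 0) (he : ⁅e, v⁆ = 0) :
    HasCompactCentralizer θ e := by
  have hf := lie_f_eq_zero_of_lie_e_of_lie_h ℂ t.sl2 he hh
  have hk' : conjugation v ∈ kSpace θ := by
    rw [mem_kSpace] at hk ⊢
    rw [complexTheta_conjugation, hk]
  have he' : ⁅e, conjugation v⁆ = 0 := by
    rw [← t.conj_f, ← conjugation_lie, hf, map_zero]
  obtain ⟨a, b, rfl⟩ := exists_cplx v
  rw [mem_kSpace, complexTheta_cplx, cplx_inj] at hk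
  rw [conjugation_cplx] at he'
  have h2 : ∀ c, ⁅e, cplx (2 • c) (0 : L₀)⁆ = 0 → ⁅(1 : ℂ) ⊗ₜ[ℝ] c, e⁆ = 0 := by
    intro c hc
    have : cplx (2 • c) (0 : L₀) = (2 : ℂ) • cplx c 0 := by rw [smul_cplx, cplx_inj]; simp [two_smul]
    rw [this, cplx_lie_smul, smul_eq_zero_iff_right two_ne_zero] at hc
    rw [one_tmul_eq_cplx, ← lie_skew, hc, neg_zero]
  by_cases ha : a = 0
  · subst ha
    refine ⟨b, ?_, hk.2, h2 b ?_⟩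
    · rintro rfl; exact hv (by simp [cplx])
    · have : cplx (2 • b) (0 : L₀) = (-2 * Complex.I) • cplx 0 b := by
        rw [smul_cplx, cplx_inj]; simp [two_smul]
      rw [this, cplx_lie_smul, he, smul_zero]
  · refine ⟨a, ha, hk.1, h2 a ?_⟩
    have : cplx (2 • a) (0 : L₀) = cplx a b + cplx a (-b) := by
      rw [cplx_add, cplx_inj]; simp [two_smul]
    rw [this, cplx_lie_add, he, he', add_zero]

omit [FiniteDimensional ℝ L₀] in
theorem IsKSTriple.lie_eq_zero_of_mem_compact (t : IsKSTriple θ h e f) {y : L₀}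
    (hy : ⁅(1 : ℂ) ⊗ₜ[ℝ] y, e⁆ = 0) : ⁅(1 : ℂ) ⊗ₜ[ℝ] y, f⁆ = 0 ∧ ⁅(1 : ℂ) ⊗ₜ[ℝ] y, h⁆ = 0 := by
  have hf : ⁅(1 : ℂ) ⊗ₜ[ℝ] y, f⁆ = 0 := by
    have : conjugation ((1 : ℂ) ⊗ₜ[ℝ] y) = (1 : ℂ) ⊗ₜ[ℝ] y := by
      rw [one_tmul_eq_cplx, conjugation_cplx, neg_zero]
    rw [← t.conj_e, ← this, ← conjugation_lie, hy, map_zero]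
  refine ⟨hf, ?_⟩
  rw [← t.sl2.lie_e_f, leibniz_lie, hy, hf]
  simp

variable (hθ : IsCartanInvolution θ)
include hθ

theorem IsKSTriple.lie_h_semisimple (t : IsKSTriple θ h e f) (w : ℂ ⊗[ℝ] L₀)
    (hw : ⁅h, ⁅h, w⁆⁆ = 0) : ⁅h, w⁆ = 0 := by
  obtain ⟨x, hx, rfl⟩ := t.h_mem
  exact hθ.lie_I_lie_I_eq_zero hx hw

/-- If no compact element centralizes `e`, the Killing form is isotropic on `𝔨^e`. -/
theorem IsKSTriple.killingForm_self_eq_zero (t : IsKSTriple θ h e f)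
    (hc : ¬ HasCompactCentralizer θ e) {z : ℂ ⊗[ℝ] L₀} (hz : z ∈ kSpace θ) (hze : ⁅e, z⁆ = 0) :
    killingForm ℂ (ℂ ⊗[ℝ] L₀) z z = 0 := by
  obtain ⟨y₀, h1, h2, -, h4⟩ := exists_centralizer_killingForm ℂ t.sl2
    (t.lie_h_semisimple hθ) hze
  have hte := mem_pSpace.mp t.e_mem
  have ha : y₀ + complexTheta θ y₀ = 0 := by
    by_contra hne
    refine hc (t.hasCompactCentralizer_of_mem hne ?_ ?_ ?_)
    · rw [mem_kSpace, map_add, complexTheta_complexTheta hθ.involutive, add_comm]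
    · rw [cplx_lie_add, h2, zero_add]
      conv_lhs => rw [← t.theta_h]
      rw [← complexTheta_lie, h2, map_zero]
    · rw [cplx_lie_add, h1, zero_add]
      have : e = -complexTheta θ e := by rw [hte, neg_neg]
      rw [this, neg_lie, ← complexTheta_lie, h1, map_zero, neg_zero]
  have hy₀ : complexTheta θ y₀ = -y₀ := by rw [eq_neg_iff_add_eq_zero, add_comm]; exact ha
  rw [h4 z hze]
  have h5 := LieAlgebra.killingForm_of_equiv_apply (thetaEquiv θ hθ.involutive) z y₀
  rw [thetaEquiv_apply, thetaEquiv_apply, mem_kSpace.mp hz, hy₀, map_neg] at h5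
  exact self_eq_neg.mp h5.symm

/-- For the Cayley transform of a real triple the existence of a compact centralizer only depends
on the centralizer of the real nilpotent element, together with the Killing form. -/
theorem IsRealCayleyTriple.hasCompactCentralizer_iff {h₀ e₀ f₀ : L₀}
    (t : IsRealCayleyTriple θ h₀ e₀ f₀) :
    HasCompactCentralizer θ (cayleyE h₀ e₀ f₀) ↔
      ∃ y : L₀, ⁅e₀, y⁆ = 0 ∧ killingForm ℝ L₀ y y < 0 := by
  have hf := t.theta_f hθ.involutive
  constructor
  · rintro ⟨y, hy, hθy, hc⟩
    have hpos := hθ.pos y hy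
    rw [hθy] at hpos
    refine ⟨y, ?_, by linarith⟩
    rw [one_tmul_eq_cplx, cayleyE_eq, lie_cplx, cplx_eq_zero] at hc
    simp only [lie_smul, zero_lie, smul_zero, neg_zero, sub_zero, lie_neg, add_zero,
      neg_eq_zero] at hc
    have h1 : ⁅y, h₀⁆ = 0 := (smul_eq_zero_iff_right (by norm_num)).mp hc.1
    have h2 : ⁅y, e₀ + f₀⁆ = 0 := (smul_eq_zero_iff_right (by norm_num)).mp hc.2
    have h3 : ⁅y, ⁅h₀, e₀ + f₀⁆⁆ = 0 := by rw [leibniz_lie, h1, h2]; simp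
    have h4 : ⁅h₀, e₀ + f₀⁆ + (2 : ℝ) • (e₀ + f₀) = (4 : ℝ) • e₀ := by
      rw [lie_add, t.sl2.lie_h_e_nsmul, t.sl2.lie_h_f_nsmul]; module
    have h5 : ⁅y, (4 : ℝ) • e₀⁆ = 0 := by rw [← h4, lie_add, h3, lie_smul, h2]; simp
    rw [lie_smul] at h5
    rw [← lie_skew, (smul_eq_zero_iff_right (by norm_num)).mp h5, neg_zero]
  · rintro ⟨y, hy, hneg⟩
    obtain ⟨y₀, h1, h2, h3, h4⟩ := exists_centralizer_killingForm ℝ t.sl2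
      (fun w => hθ.lie_lie_eq_zero_of_theta_neg t.theta_h) hy
    have hneg' : killingForm ℝ L₀ y₀ y₀ < 0 := by
      rw [← h4 y₀ h1, LieModule.traceForm_comm, h4 y hy] at *
      exact hneg
    have hz : y₀ + θ y₀ ≠ 0 := by
      intro h0
      have : θ y₀ = -y₀ := by rw [eq_neg_iff_add_eq_zero, add_comm]; exact h0
      have h5 := hθ.killing_theta_nonpos y₀
      rw [this, map_neg, neg_neg] at h5
      linarith
    have e1 : ⁅θ y₀, e₀⁆ = 0 := by
      rw [← neg_neg e₀, ← hf, lie_neg, ← LieEquiv.map_lie, ← lie_skew, h3]; simp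
    have e2 : ⁅θ y₀, f₀⁆ = 0 := by
      rw [← neg_neg f₀, ← t.theta_e, lie_neg, ← LieEquiv.map_lie, ← lie_skew, h1]; simp
    have e3 : ⁅θ y₀, h₀⁆ = 0 := by
      rw [← neg_neg h₀, ← t.theta_h, lie_neg, ← LieEquiv.map_lie, ← lie_skew, h2]; simp
    have h1' : ⁅y₀, e₀⁆ = 0 := by rw [← lie_skew, h1, neg_zero]
    have h2' : ⁅y₀, h₀⁆ = 0 := by rw [← lie_skew, h2, neg_zero]
    have h3' : ⁅y₀, f₀⁆ = 0 := by rw [← lie_skew, h3, neg_zero]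
    refine ⟨y₀ + θ y₀, hz, ?_, ?_⟩
    · rw [map_add, hθ.involutive, add_comm]
    · rw [one_tmul_eq_cplx, cayleyE_eq, lie_cplx, cplx_eq_zero]
      simp [e1, e2, e3, h1', h2', h3']

/-- Compact centralizers are detected by dimensions. -/
theorem IsKSTriple.not_hasCompactCentralizer_iff (t : IsKSTriple θ h e f) :
    ¬ HasCompactCentralizer θ e ↔
      Module.finrank ℂ ↥(kSpace θ ⊓ (LieAlgebra.ad ℂ (ℂ ⊗[ℝ] L₀) h).eigenspace 0) =
      Module.finrank ℂ ↥(pSpace θ ⊓ (LieAlgebra.ad ℂ (ℂ ⊗[ℝ] L₀) h).eigenspace 2) := by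
  set A := kSpace θ ⊓ (LieAlgebra.ad ℂ (ℂ ⊗[ℝ] L₀) h).eigenspace 0 with hA
  set P := pSpace θ ⊓ (LieAlgebra.ad ℂ (ℂ ⊗[ℝ] L₀) h).eigenspace 2 with hP
  have memA : ∀ {x}, x ∈ A ↔ complexTheta θ x = x ∧ ⁅h, x⁆ = 0 := by
    intro x; simp [hA, mem_kSpace, Module.End.mem_eigenspace_iff]
  have memP : ∀ {x}, x ∈ P ↔ complexTheta θ x = -x ∧ ⁅h, x⁆ = (2 : ℂ) • x := by
    intro x; simp [hP, mem_pSpace, Module.End.mem_eigenspace_iff]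
  have hte := mem_pSpace.mp t.e_mem
  have htf := mem_pSpace.mp t.f_mem
  have hE : ∀ x ∈ A, LieAlgebra.ad ℂ (ℂ ⊗[ℝ] L₀) e x ∈ P := by
    intro x hx
    rw [memA] at hx
    rw [memP, LieAlgebra.ad_apply, complexTheta_lie, hte, hx.1, leibniz_lie, hx.2,
      t.sl2.lie_h_e_smul ℂ, cplx_smul_lie]
    simp
  have hF : ∀ x ∈ P, LieAlgebra.ad ℂ (ℂ ⊗[ℝ] L₀) f x ∈ A := by
    intro x hx
    rw [memP] at hx
    rw [memA, LieAlgebra.ad_apply, complexTheta_lie, htf, hx.1, leibniz_lie, hx.2,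
      t.sl2.lie_lie_smul_f ℂ, neg_lie, neg_lie, cplx_smul_lie, cplx_lie_smul]
    simp
  let E : A →ₗ[ℂ] P := (LieAlgebra.ad ℂ (ℂ ⊗[ℝ] L₀) e).restrict hE
  let F : P →ₗ[ℂ] A := (LieAlgebra.ad ℂ (ℂ ⊗[ℝ] L₀) f).restrict hF
  have vE : ∀ x, (E x : ℂ ⊗[ℝ] L₀) = ⁅e, (x : ℂ ⊗[ℝ] L₀)⁆ := fun x => rfl
  have vF : ∀ x, (F x : ℂ ⊗[ℝ] L₀) = ⁅f, (x : ℂ ⊗[ℝ] L₀)⁆ := fun x => rfl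
  have hadj : ∀ u v, herm θ ⁅e, u⁆ v = herm θ u ⁅f, v⁆ := by
    intro u v
    rw [herm_lie_left _ _ _ hθ.involutive, t.conj_e, htf, neg_lie, herm_neg_right, neg_neg]
  have hinj : Function.Injective (E ∘ₗ F) := by
    rw [← LinearMap.ker_eq_bot, LinearMap.ker_eq_bot']
    intro x hx
    rw [LinearMap.comp_apply, Subtype.ext_iff, vE, vF] at hx
    have h1 : ⁅f, (x : ℂ ⊗[ℝ] L₀)⁆ = 0 := by
      apply hθ.eq_zero_of_herm_self
      rw [← hadj, hx]
      simp [herm]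
    have := eq_zero_of_lie_f_of_lie_h t.sl2 h1 (memP.mp x.2).2 (by
      intro n hn
      have h2 : (2 + n : ℂ) = 0 := by rw [hn]; ring
      have h3 := congrArg Complex.re h2
      simp only [Complex.add_re, Complex.re_ofNat, Complex.natCast_re, Complex.zero_re] at h3
      have : (0 : ℝ) ≤ n := n.cast_nonneg
      linarith)
    exact Subtype.ext this
  have hsurj : Function.Surjective E := by
    have := LinearMap.injective_iff_surjective.mp hinj
    exact Function.Surjective.of_comp (g := F) this
  have hrank := LinearMap.finrank_range_add_finrank_ker E
  rw [LinearMap.range_eq_top.mpr hsurj, finrank_top] at hrank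
  have hker : ¬ HasCompactCentralizer θ e ↔ LinearMap.ker E = ⊥ := by
    rw [LinearMap.ker_eq_bot']
    constructor
    · intro hc x hx
      by_contra hne
      rw [Subtype.ext_iff, vE] at hx
      have hm := memA.mp x.2
      exact hc (t.hasCompactCentralizer_of_mem (fun h0 => hne (Subtype.ext h0))
        (mem_kSpace.mpr hm.1) hm.2 hx)
    · rintro hc ⟨y, hy, hθy, hye⟩
      have hh := (t.lie_eq_zero_of_mem_compact hye).2
      have hm : (1 : ℂ) ⊗ₜ[ℝ] y ∈ A := by
        rw [memA, ← lie_skew, hh, one_tmul_eq_cplx, complexTheta_cplx, hθy]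
        simp
      have := hc ⟨_, hm⟩ (by rw [Subtype.ext_iff, vE, ← lie_skew, hye]; simp)
      have h0 : (1 : ℂ) ⊗ₜ[ℝ] y = 0 := congrArg Subtype.val this
      rw [one_tmul_eq_cplx] at h0
      exact hy (cplx_eq_zero.mp h0).1
  rw [hker, ← Submodule.finrank_eq_zero (R := ℂ)]
  omega

end CompactCentralizer

/-! ### Bases of root systems defined by functionals -/

section Base

open RootPairing Module Submodule

variable {ι R M N : Type*} [Finite ι] [Field R] [CharZero R] [AddCommGroup M] [Module R M]
  [AddCommGroup N] [Module R N] {P : RootPairing ι R M N} [P.IsCrystallographic]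

theorem base_isPos_iff_of_support (b : P.Base) (F : M →+ ℝ)
    (hF : ∀ i ∈ b.support, 0 < F (P.root i)) (j : ι) : b.IsPos j ↔ 0 < F (P.root j) := by
  have h1 : ∀ j, b.IsPos j → 0 < F (P.root j) := fun j hj =>
    hj.induction_on_add hF fun i j k hk hi hj => by
      rw [hk, map_add]; exact add_pos hi (hF j hj)
  refine ⟨h1 j, fun h => ?_⟩
  let := P.indexNeg
  rcases Base.IsPos.or_neg b j with hj | hj
  · exact hj
  · have := h1 _ hj
    rw [show P.root (-j) = -P.root j by simp, map_neg] at this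
    linarith

variable (P) [P.IsRootSystem] [P.IsReduced]

/-- A real functional which does not vanish on the roots defines a base. -/
theorem exists_base_isPos_iff (F : M →+ ℝ) (hF : ∀ i, F (P.root i) ≠ 0) :
    ∃ b : P.Base, ∀ i, b.IsPos i ↔ 0 < F (P.root i) := by
  classical
  obtain ⟨b₀⟩ := P.nonempty_base
  obtain ⟨π, hπ⟩ := LinearMap.exists_leftInverse_of_injective (Algebra.linearMap ℚ R)
    (LinearMap.ker_eq_bot.mpr (algebraMap ℚ R).injective)
  have hπn : ∀ n : ℤ, π (n : R) = n := fun n => by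
    have := LinearMap.congr_fun hπ (n : ℚ)
    simpa using this
  have hc : ∀ j, ∃ c : b₀.support → ℤ, P.root j = ∑ i, c i • P.root i := fun j => by
    obtain ⟨c, -, -, h⟩ := b₀.exists_root_eq_sum_int j
    exact ⟨fun i => c i, by rw [h, ← Finset.sum_coe_sort]⟩
  choose c hc using hc
  let f (q : b₀.support → ℚ) : M →+ ℚ :=
    { toFun := fun m => ∑ i, π (b₀.toWeightBasis.repr m i) * q i
      map_zero' := by simp
      map_add' := fun x y => by simp [add_mul, Finset.sum_add_distrib] }
  have hf : ∀ q j, f q (P.root j) = ∑ i, (c j i : ℚ) * q i := by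
    intro q j
    change ∑ i, π (b₀.toWeightBasis.repr (P.root j) i) * q i = _
    refine Finset.sum_congr rfl fun i _ => ?_
    have : b₀.toWeightBasis.repr (P.root j) i = (c j i : R) := by
      have h : P.root j = ∑ i, (c j i : R) • b₀.toWeightBasis i := by
        rw [hc j]; exact Finset.sum_congr rfl fun i _ => by
          rw [Base.toWeightBasis_apply, Int.cast_smul_eq_zsmul]
      rw [h, Basis.repr_sum_self]
    rw [this, hπn]
  have hFc : ∀ j, F (P.root j) = ∑ i, (c j i : ℝ) * F (P.root i) := fun j => by
    conv_lhs => rw [hc j]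
    simp
  have hopen : IsOpen {r : b₀.support → ℝ | ∀ j, 0 < F (P.root j) * ∑ i, (c j i : ℝ) * r i} := by
    rw [Set.ofPred_forall]
    refine isOpen_iInter_of_finite fun j => isOpen_lt continuous_const ?_
    fun_prop
  have hdense : DenseRange (fun (q : b₀.support → ℚ) (i : b₀.support) => (q i : ℝ)) :=
    DenseRange.piMap fun _ => Rat.denseRange_cast
  obtain ⟨q, hq⟩ := hdense.exists_mem_open hopen ⟨fun i => F (P.root i), fun j => by
    rw [← hFc]; exact mul_self_pos.mpr (hF j)⟩
  have hsign : ∀ j, 0 < F (P.root j) * ((f q (P.root j) : ℚ) : ℝ) := fun j => by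
    rw [hf]; push_cast; exact hq j
  have hne : ∀ j, f q (P.root j) ≠ 0 := fun j h0 => by
    have := hsign j
    rw [h0] at this; simp at this
  let := P.indexNeg
  let b : P.Base := Base.mk' P (IsAddIndecomposable.baseOf P.root (f q))
    (P.linearIndepOn_root_baseOf (f q) hne)
    (fun i => IsAddIndecomposable.mem_or_neg_mem_closure_baseOf P.root (f q) i (hne i) (by simp))
  refine ⟨b, base_isPos_iff_of_support b F fun i hi => ?_⟩
  have hi' : i ∈ IsAddIndecomposable.baseOf P.root (f q) := by simpa [b, Base.mk'] using hi
  have hpos : 0 < f q (P.root i) := hi'.1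
  have := hsign i
  exact (pos_iff_pos_of_mul_pos this).mpr (by exact_mod_cast hpos)

/-- A pair of real functionals, ordered lexicographically, defines a base. -/
theorem exists_base_isPos_iff_lex (F G : M →+ ℝ)
    (hFG : ∀ i, F (P.root i) = 0 → G (P.root i) ≠ 0) :
    ∃ b : P.Base, ∀ i, b.IsPos i ↔
      0 < F (P.root i) ∨ F (P.root i) = 0 ∧ 0 < G (P.root i) := by
  have key : ∀ᶠ t : ℝ in Filter.atTop, ∀ i, 0 < F (P.root i) →
      0 < t * F (P.root i) + G (P.root i) := by
    rw [Filter.eventually_all]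
    intro i
    by_cases h : 0 < F (P.root i)
    · have : Filter.Tendsto (fun t : ℝ => t * F (P.root i) + G (P.root i)) Filter.atTop
          Filter.atTop :=
        Filter.tendsto_atTop_add_const_right _ _ (Filter.tendsto_id.atTop_mul_const h)
      filter_upwards [this.eventually_gt_atTop 0] with t ht _ using ht
    · exact Filter.Eventually.of_forall fun t h' => absurd h' h
  obtain ⟨t, ht⟩ := key.exists
  let := P.indexNeg
  have ht' : ∀ i, F (P.root i) < 0 → t * F (P.root i) + G (P.root i) < 0 := fun i hi => by
    have hn : P.root (-i) = -P.root i := by simp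
    have := ht (-i) (by rw [hn, map_neg]; linarith)
    rw [hn, map_neg, map_neg] at this
    linarith
  let T : M →+ ℝ := (AddMonoidHom.mulLeft t).comp F + G
  have hT : ∀ i, T (P.root i) = t * F (P.root i) + G (P.root i) := fun i => rfl
  obtain ⟨b, hb⟩ := exists_base_isPos_iff P T fun i => by
    rw [hT]
    rcases lt_trichotomy (F (P.root i)) 0 with h | h | h
    · exact (ht' i h).ne
    · rw [h, mul_zero, zero_add]; exact hFG i h
    · exact (ht i h).ne'
  refine ⟨b, fun i => ?_⟩
  rw [hb, hT]
  rcases lt_trichotomy (F (P.root i)) 0 with h | h | h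
  · have := ht' i h
    constructor
    · intro; linarith
    · rintro (h1 | h1)
      · linarith
      · linarith [h1.1]
  · simp [h]
  · simp [h, ht i h]

omit [P.IsCrystallographic] [P.IsRootSystem] [P.IsReduced] in
/-- There is a real functional which vanishes on no root. -/
theorem exists_functional_ne_zero : ∃ G : M →+ ℝ, ∀ i, G (P.root i) ≠ 0 := by
  let _i : Module ℚ M := Module.compHom M (algebraMap ℚ R)
  obtain ⟨f, hf⟩ : ∃ f : Dual ℚ M, ∀ i, f (P.root i) ≠ 0 :=
    exists_dual_forall_apply_ne_zero P.root <| by simp [P.ne_zero]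
  exact ⟨(Rat.castHom ℝ).toAddMonoidHom.comp f.toAddMonoidHom, fun i => by simpa using hf i⟩

end Base

/-! ### Diagonalizable endomorphisms -/

section Diagonal

open Module

variable {K V κ : Type*} [Field K] [AddCommGroup V] [Module K V]

/-- The span of the eigenvectors in an eigenbasis whose eigenvalues satisfy `p`. -/
def diagSpan (𝔅 : Basis κ K V) (w : κ → K) (p : K → Prop) : Submodule K V :=
  Submodule.span K (𝔅 '' {k | p (w k)})

variable {𝔅 : Basis κ K V} {w : κ → K} {T : V →ₗ[K] V} {p : K → Prop}

theorem mem_diagSpan_iff {x : V} : x ∈ diagSpan 𝔅 w p ↔ ∀ k, 𝔅.repr x k ≠ 0 → p (w k) := by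
  rw [diagSpan, Basis.mem_span_image]
  exact ⟨fun h k hk => h (by simpa using hk), fun h k hk => h k (by simpa using hk)⟩

theorem basis_mem_diagSpan {k : κ} (h : p (w k)) : 𝔅 k ∈ diagSpan 𝔅 w p :=
  Submodule.subset_span ⟨k, h, rfl⟩

theorem repr_of_eigenbasis (hT : ∀ k, T (𝔅 k) = w k • 𝔅 k) (x : V) (k : κ) :
    𝔅.repr (T x) k = w k * 𝔅.repr x k := by
  classical
  have : (Finsupp.lapply k ∘ₗ 𝔅.repr.toLinearMap) ∘ₗ T =
      w k • (Finsupp.lapply k ∘ₗ 𝔅.repr.toLinearMap) := by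
    refine 𝔅.ext fun j => ?_
    by_cases h : j = k
    · subst h; simp [hT]
    · simp [hT, h]
  exact LinearMap.congr_fun this x

theorem mem_diagSpan_of_eigen (hT : ∀ k, T (𝔅 k) = w k • 𝔅 k) {x : V} {μ : K}
    (hx : T x = μ • x) (hμ : p μ) : x ∈ diagSpan 𝔅 w p := by
  rw [mem_diagSpan_iff]
  intro k hk
  have h1 := repr_of_eigenbasis hT x k
  rw [hx, map_smul, Finsupp.smul_apply, smul_eq_mul] at h1
  rwa [← mul_right_cancel₀ hk h1]

theorem mem_diagSpan_eq_iff (hT : ∀ k, T (𝔅 k) = w k • 𝔅 k) {x : V} {μ : K} :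
    x ∈ diagSpan 𝔅 w (· = μ) ↔ T x = μ • x := by
  refine ⟨fun h => ?_, fun h => mem_diagSpan_of_eigen hT h rfl⟩
  induction h using Submodule.span_induction with
  | mem x hx => obtain ⟨k, hk, rfl⟩ := hx; rw [hT]; congr 1
  | zero => simp
  | add x y _ _ hx hy => rw [map_add, hx, hy, smul_add]
  | smul a x _ hx => rw [map_smul, hx, smul_comm]

theorem map_mem_diagSpan (hT : ∀ k, T (𝔅 k) = w k • 𝔅 k) {S : V →ₗ[K] V}
    (hS : ∀ x, S (T x) = T (S x)) {x : V} (hx : x ∈ diagSpan 𝔅 w p) :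
    S x ∈ diagSpan 𝔅 w p := by
  induction hx using Submodule.span_induction with
  | mem x hx =>
    obtain ⟨k, hk, rfl⟩ := hx
    exact mem_diagSpan_of_eigen hT (by rw [← hS, hT, map_smul]) hk
  | zero => simp
  | add x y _ _ hx hy => rw [map_add]; exact add_mem hx hy
  | smul a x _ hx => rw [map_smul]; exact Submodule.smul_mem _ _ hx

theorem lie_mem_diagSpan {L : Type*} [LieRing L] [LieAlgebra K L] {𝔅 : Basis κ K L} {z : L}
    (hT : ∀ k, ⁅z, 𝔅 k⁆ = w k • 𝔅 k) (hp : ∀ a b, p a → p b → p (a + b)) {x y : L}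
    (hx : x ∈ diagSpan 𝔅 w p) (hy : y ∈ diagSpan 𝔅 w p) : ⁅x, y⁆ ∈ diagSpan 𝔅 w p := by
  induction hx using Submodule.span_induction with
  | mem x hx =>
    obtain ⟨k, hk, rfl⟩ := hx
    induction hy using Submodule.span_induction with
    | mem y hy =>
      obtain ⟨l, hl, rfl⟩ := hy
      refine mem_diagSpan_of_eigen (T := LieAlgebra.ad K L z) (μ := w k + w l) hT ?_ (hp _ _ hk hl)
      rw [LieAlgebra.ad_apply, leibniz_lie, hT, hT, smul_lie, lie_smul, add_smul]
    | zero => simp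
    | add x y _ _ hx hy => rw [lie_add]; exact add_mem hx hy
    | smul a x _ hx => rw [lie_smul]; exact Submodule.smul_mem _ _ hx
  | zero => simp
  | add x y _ _ hx hy => rw [add_lie]; exact add_mem hx hy
  | smul a x _ hx => rw [smul_lie]; exact Submodule.smul_mem _ _ hx

/-- The subalgebra spanned by eigenvectors of `ad z`. -/
def diagSubalgebra {L : Type*} [LieRing L] [LieAlgebra K L] {𝔅 : Basis κ K L} {z : L}
    (hT : ∀ k, ⁅z, 𝔅 k⁆ = w k • 𝔅 k) (hp : ∀ a b, p a → p b → p (a + b)) : LieSubalgebra K L :=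
  { diagSpan 𝔅 w p with lie_mem' := lie_mem_diagSpan hT hp }

/-- The trace of a map stabilizing a subspace spanned by part of a basis. -/
theorem trace_restrict_span [Fintype κ] [DecidableEq κ] (𝔅 : Basis κ K V) (s : Finset κ)
    (T : V →ₗ[K] V) (W : Submodule K V) (hW : W = Submodule.span K (𝔅 '' s))
    (hT : ∀ x ∈ W, T x ∈ W) :
    LinearMap.trace K W (T.restrict hT) = ∑ k ∈ s, 𝔅.repr (T (𝔅 k)) k := by
  let b : Basis s K W := Basis.mk (v := fun k : s => (⟨𝔅 k, by
      rw [hW]; exact Submodule.subset_span ⟨k, k.2, rfl⟩⟩ : W))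
    (by
      apply LinearIndependent.of_comp W.subtype
      exact 𝔅.linearIndependent.comp _ Subtype.val_injective)
    (by
      rintro ⟨x, hx⟩ -
      have h2 : x ∈ (Submodule.span K (Set.range fun k : s => (⟨𝔅 k, by
        rw [hW]; exact Submodule.subset_span ⟨k, k.2, rfl⟩⟩ : W))).map W.subtype := by
        rw [Submodule.map_span, ← Set.range_comp]
        rw [hW] at hx
        convert hx using 2
        ext y; simp
      obtain ⟨y, hy, hyx⟩ := h2
      have : y = ⟨x, hx⟩ := Subtype.ext hyx
      exact this ▸ hy)
  have hb : ∀ k : s, (b k : V) = 𝔅 k := fun k => by simp [b]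
  have hrepr : ∀ (x : W) (k : s), b.repr x k = 𝔅.repr x k := fun x k => by
    have h1 : (x : V) = ∑ j, b.repr x j • 𝔅 j := by
      conv_lhs => rw [← b.sum_repr x]
      simp [hb]
    rw [h1]
    simp [Finsupp.single_apply]
  rw [LinearMap.trace_eq_matrix_trace K b, Matrix.trace, ← Finset.sum_coe_sort s]
  refine Finset.sum_congr rfl fun k _ => ?_
  rw [Matrix.diag_apply, LinearMap.toMatrix_apply, hrepr, LinearMap.coe_restrict_apply, hb]

end Diagonal

/-! ### Root bases -/

section RootBasis

open Module LieAlgebra LieAlgebra.IsKilling LieModule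

variable {L : Type*} [LieRing L] [LieAlgebra ℂ L] [FiniteDimensional ℂ L] [IsKilling ℂ L]
  {H : LieSubalgebra ℂ L} [H.IsCartanSubalgebra]

theorem lie_cartan (x y : L) (hx : x ∈ H) (hy : y ∈ H) : ⁅x, y⁆ = 0 := by
  have := congrArg Subtype.val (trivial_lie_zero H H ⟨x, hx⟩ ⟨y, hy⟩)
  simpa using this

theorem mem_rootSpace_iff {α : H → ℂ} {x : L} :
    x ∈ rootSpace H α ↔ ∀ z : H, ⁅(z : L), x⁆ = α z • x := by
  refine ⟨fun h z => lie_eq_smul_of_mem_rootSpace h z, fun h => ?_⟩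
  exact (mem_genWeightSpace L α x).mpr fun z => ⟨1, by
    rw [pow_one, LinearMap.sub_apply, sub_eq_zero]; exact h z⟩

/-- A nonzero vector in the root space of `α`. -/
def rootVector (α : H.root) : L := ((α : Weight ℂ H L).exists_ne_zero).choose

theorem rootVector_mem (α : H.root) : rootVector α ∈ rootSpace H (α : Weight ℂ H L) :=
  ((α : Weight ℂ H L).exists_ne_zero).choose_spec.1

theorem rootVector_ne_zero (α : H.root) : rootVector α ≠ 0 :=
  ((α : Weight ℂ H L).exists_ne_zero).choose_spec.2

theorem lie_rootVector (α : H.root) (z : L) (hz : z ∈ H) :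
    ⁅z, rootVector α⁆ = (α : Weight ℂ H L) ⟨z, hz⟩ • rootVector α :=
  mem_rootSpace_iff.mp (rootVector_mem α) ⟨z, hz⟩

theorem exists_eq_smul_rootVector (α : H.root) {x : L}
    (hx : x ∈ rootSpace H (α : Weight ℂ H L)) : ∃ c : ℂ, x = c • rootVector α := by
  have h1 := finrank_rootSpace_eq_one (α : Weight ℂ H L) (H.isNonZero_coe_root α)
  have h2 : (⟨rootVector α, rootVector_mem α⟩ : rootSpace H (α : Weight ℂ H L)) ≠ 0 := fun h =>
    rootVector_ne_zero α (congrArg Subtype.val h)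
  obtain ⟨c, hc⟩ := (finrank_eq_one_iff_of_nonzero' _ h2).mp h1 ⟨x, hx⟩
  exact ⟨c, (congrArg Subtype.val hc).symm⟩

/-- The basis consisting of the simple coroots and of root vectors. -/
def rootBasis (b : (rootSystem H).Base) : Basis (b.support ⊕ H.root) ℂ L :=
  Basis.mk (v := Sum.elim (fun i => ((coroot (i : H.root).1 : H) : L)) rootVector)
    (by
      have hind := LieSubmodule.iSupIndep_toSubmodule.mpr (iSupIndep_genWeightSpace ℂ H L)
      refine LinearIndependent.sum_type ?_ ?_ ?_
      · convert b.toCoweightBasis.linearIndependent.map' H.toSubmodule.subtype (Submodule.ker_subtype _)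
        simp [RootPairing.Base.toCoweightBasis_apply]; rfl
      · have : iSupIndep fun α : H.root => (rootSpace H (α : Weight ℂ H L)).toSubmodule :=
          hind.comp (f := fun α : H.root => ((α : Weight ℂ H L) : H → ℂ)) fun α β h =>
            Subtype.ext (DFunLike.coe_injective h)
        exact this.linearIndependent _ rootVector_mem rootVector_ne_zero
      · refine (hind 0).mono ?_ ?_
        · rw [Submodule.span_le]
          rintro _ ⟨i, rfl⟩
          simp
        · rw [Submodule.span_le]
          rintro _ ⟨α, rfl⟩
          refine Submodule.mem_iSup_of_mem ((α : Weight ℂ H L) : H → ℂ)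
            (Submodule.mem_iSup_of_mem (H.isNonZero_coe_root α) (rootVector_mem α)))
    (by
      have h := congrArg LieSubmodule.toSubmodule
        (cartan_sup_iSup_rootSpace_eq_top (K := ℂ) (L := L) (H := H))
      rw [LieSubmodule.top_toSubmodule] at h
      rw [← h, LieSubmodule.sup_toSubmodule, sup_le_iff]
      constructor
      · intro x hx
        have h1 := b.toCoweightBasis.mem_span (⟨x, hx⟩ : H)
        have h2 := Submodule.mem_map_of_mem (f := H.toSubmodule.subtype) h1
        rw [Submodule.map_span] at h2
        refine Submodule.span_mono ?_ h2
        rintro _ ⟨_, ⟨i, rfl⟩, rfl⟩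
        exact ⟨Sum.inl i, by simp⟩
      · simp only [LieSubmodule.iSup_toSubmodule, iSup_le_iff]
        intro α hα x hx
        obtain ⟨c, rfl⟩ := exists_eq_smul_rootVector ⟨α, by simpa using hα⟩ hx
        exact Submodule.smul_mem _ _ (Submodule.subset_span ⟨Sum.inr _, rfl⟩))

variable (b : (rootSystem H).Base)

@[simp] theorem rootBasis_inl (i : b.support) :
    rootBasis b (Sum.inl i) = ((coroot (i : H.root).1 : H) : L) := by simp [rootBasis]

@[simp] theorem rootBasis_inr (α : H.root) : rootBasis b (Sum.inr α) = rootVector α := by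
  simp [rootBasis]

/-- The eigenvalue of `ad z` on the members of a root basis. -/
def rootBasisWeight (z : H) : b.support ⊕ H.root → ℂ :=
  Sum.elim (fun _ => 0) fun α => (α : Weight ℂ H L) z

theorem lie_rootBasis (z : H) (k : b.support ⊕ H.root) :
    ⁅(z : L), rootBasis b k⁆ = rootBasisWeight b z k • rootBasis b k := by
  rcases k with i | α
  · simpa [rootBasisWeight] using lie_cartan _ _ z.2 (coroot (i : H.root).1).2
  · simpa [rootBasisWeight] using lie_rootVector α z z.2

theorem cartan_eq_span : H.toSubmodule = Submodule.span ℂ (rootBasis b '' Set.range Sum.inl) := by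
  apply le_antisymm
  · intro x hx
    have h1 := b.toCoweightBasis.mem_span (⟨x, hx⟩ : H)
    have h2 := Submodule.mem_map_of_mem (f := H.toSubmodule.subtype) h1
    rw [Submodule.map_span] at h2
    refine Submodule.span_mono ?_ h2
    rintro _ ⟨_, ⟨i, rfl⟩, rfl⟩
    exact ⟨Sum.inl i, ⟨i, rfl⟩, by simp⟩
  · rw [Submodule.span_le]
    rintro _ ⟨_, ⟨i, rfl⟩, rfl⟩
    simp

end RootBasis

/-! ### Parabolic subalgebras and their Levi factors -/

section Parabolic

open Module LieAlgebra LieAlgebra.IsKilling LieModule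

variable {L : Type*} [LieRing L] [LieAlgebra ℂ L] [FiniteDimensional ℂ L] [IsKilling ℂ L]
  {H : LieSubalgebra ℂ L} [H.IsCartanSubalgebra]

/-- The negative of a root. -/
def negRoot (α : H.root) : H.root := ⟨-α, by
  simpa only [Finset.mem_filter, Finset.mem_univ, true_and] using (H.isNonZero_coe_root α).neg⟩

@[simp] theorem coe_negRoot (α : H.root) : (negRoot α : Weight ℂ H L) = -(α : Weight ℂ H L) := rfl

@[simp] theorem negRoot_negRoot (α : H.root) : negRoot (negRoot α) = α := by ext; simp

theorem negRoot_ne (α : H.root) : negRoot α ≠ α := fun h => by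
  refine H.isNonZero_coe_root α ?_
  ext z
  have h1 : (-(α : Weight ℂ H L)) z = (α : Weight ℂ H L) z := by rw [← coe_negRoot, h]
  rw [Weight.coe_neg, Pi.neg_apply, neg_eq_iff_add_eq_zero, ← two_mul] at h1
  simpa using h1

@[simp] theorem root_negRoot (α : H.root) :
    (rootSystem H).root (negRoot α) = -(rootSystem H).root α := rfl

theorem indexNeg_root (α : H.root) : (rootSystem H).indexNeg.neg α = negRoot α := by
  let := (rootSystem H).indexNeg
  apply (rootSystem H).root.injective
  rw [root_negRoot]
  change (rootSystem H).root ((rootSystem H).reflectionPerm α α) = _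
  rw [RootPairing.root_reflectionPerm, RootPairing.reflection_apply_self]

theorem isPos_or_isPos_negRoot (b : (rootSystem H).Base) (α : H.root) :
    b.IsPos α ∨ b.IsPos (negRoot α) := by
  let := (rootSystem H).indexNeg
  rw [← indexNeg_root]
  exact RootPairing.Base.IsPos.or_neg b α

theorem not_isPos_negRoot (b : (rootSystem H).Base) {α : H.root} (h : b.IsPos α) :
    ¬ b.IsPos (negRoot α) := by
  let := (rootSystem H).indexNeg
  have : -α = negRoot α := indexNeg_root α
  intro h'
  have h1 : 0 < b.height α := h
  have h2 : 0 < b.height (-α) := this ▸ h'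
  rw [RootPairing.Base.height_reflectionPerm_self] at h2
  omega

theorem rootSpace_le_iff {W : Submodule ℂ L} (α : H.root) :
    (rootSpace H (α : Weight ℂ H L)).toSubmodule ≤ W ↔ rootVector α ∈ W := by
  refine ⟨fun h => h (rootVector_mem α), fun h x hx => ?_⟩
  obtain ⟨c, rfl⟩ := exists_eq_smul_rootVector α hx
  exact W.smul_mem c h

/-- The roots of a subalgebra. -/
def rootsIn (H : LieSubalgebra ℂ L) [H.IsCartanSubalgebra] (q : LieSubalgebra ℂ L) :
    Set H.root := {α | rootVector α ∈ q}

/-- `H` together with the root spaces of those roots which together with their negatives are roots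
of `q`. -/
def leviSubmodule (H q : LieSubalgebra ℂ L) [H.IsCartanSubalgebra] : Submodule ℂ L :=
  H.toSubmodule ⊔
    ⨆ α : {α : H.root //
        (rootSpace H (α : Weight ℂ H L)).toSubmodule ≤ q.toSubmodule ∧
        (rootSpace H (-(α : Weight ℂ H L) : H → ℂ)).toSubmodule ≤ q.toSubmodule},
      (rootSpace H (α.1 : Weight ℂ H L)).toSubmodule

theorem leviSubmodule_le_iff {q : LieSubalgebra ℂ L} {W : Submodule ℂ L} :
    leviSubmodule H q ≤ W ↔ H.toSubmodule ≤ W ∧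
      ∀ α : H.root, rootVector α ∈ q → rootVector (negRoot α) ∈ q → rootVector α ∈ W := by
  rw [leviSubmodule, sup_le_iff, iSup_le_iff]
  refine and_congr_right fun _ => ⟨fun h α h1 h2 => ?_, fun h α => ?_⟩
  · exact h ⟨α, (rootSpace_le_iff α).mpr h1, (rootSpace_le_iff (negRoot α)).mpr h2⟩
      (rootVector_mem α)
  · exact (rootSpace_le_iff α.1).mpr
      (h α.1 ((rootSpace_le_iff α.1).mp α.2.1) ((rootSpace_le_iff (negRoot α.1)).mp α.2.2))

theorem rootVector_mem_leviSubmodule {q : LieSubalgebra ℂ L} {α : H.root}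
    (h1 : rootVector α ∈ q) (h2 : rootVector (negRoot α) ∈ q) :
    rootVector α ∈ leviSubmodule H q :=
  (leviSubmodule_le_iff.mp le_rfl).2 α h1 h2

theorem le_leviSubmodule {q : LieSubalgebra ℂ L} : H.toSubmodule ≤ leviSubmodule H q :=
  (leviSubmodule_le_iff.mp le_rfl).1

/-- The centralizer of a nonzero element of a Cartan subalgebra on which the roots take real values
is the Levi factor of a proper parabolic subalgebra. -/
theorem exists_parabolic_of_real (z : H) (hz : z ≠ 0)
    (hre : ∀ α : H.root, ((α : Weight ℂ H L) z).im = 0) :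
    ∃ q l : LieSubalgebra ℂ L, H ≤ q ∧ (∃ b : (rootSystem H).Base, ∀ α : H.root, b.IsPos α →
        (rootSpace H (α : Weight ℂ H L)).toSubmodule ≤ q.toSubmodule) ∧
      l.toSubmodule = leviSubmodule H q ∧ l ≠ ⊤ ∧ (∀ x, ⁅(z : L), x⁆ = 0 → x ∈ l) ∧
      ∀ S : L →ₗ[ℂ] L, (∀ x, S ⁅(z : L), x⁆ = ⁅(z : L), S x⁆) →
        (∀ x ∈ q, S x ∈ q) ∧ ∀ x ∈ l, S x ∈ l := by
  let F : Dual ℂ H →+ ℝ :=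
    Complex.reLm.toAddMonoidHom.comp (LinearMap.toAddMonoidHom (Dual.eval ℂ H z))
  have hF : ∀ α : H.root, F ((rootSystem H).root α) = ((α : Weight ℂ H L) z).re := fun _ => rfl
  obtain ⟨G, hG⟩ := exists_functional_ne_zero (rootSystem H)
  obtain ⟨b, hb⟩ := exists_base_isPos_iff_lex (rootSystem H) F G fun i _ => hG i
  have hT := lie_rootBasis b z
  let q := diagSubalgebra (p := fun a : ℂ => 0 ≤ a.re) hT fun a b ha hb => by
    rw [Complex.add_re]; positivity
  let l := diagSubalgebra (p := fun a : ℂ => a = 0) hT fun a b ha hb => by simp [ha, hb]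
  have hq : ∀ x, x ∈ q ↔ x ∈ diagSpan (rootBasis b) (rootBasisWeight b z) (0 ≤ ·.re) :=
    fun _ => Iff.rfl
  have hl' : ∀ x, x ∈ l ↔ x ∈ diagSpan (rootBasis b) (rootBasisWeight b z) (· = 0) :=
    fun _ => Iff.rfl
  clear_value q l
  have hl : ∀ x, x ∈ l ↔ ⁅(z : L), x⁆ = 0 := fun x => by
    have := mem_diagSpan_eq_iff (T := ad ℂ L z) (μ := 0) (x := x) hT
    rw [zero_smul] at this
    rw [hl', this, ad_apply]
  have hHl : ∀ x ∈ H, x ∈ l := fun x hx => (hl x).mpr (lie_cartan _ _ z.2 hx)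
  have hql : ∀ x, x ∈ l → x ∈ q := fun x hx =>
    (hq x).mpr <| mem_diagSpan_of_eigen (T := ad ℂ L z) (μ := 0) hT
      (by simpa using (hl x).mp hx) (by simp)
  have hqα : ∀ α : H.root, rootVector α ∈ q ↔ 0 ≤ ((α : Weight ℂ H L) z).re := fun α => by
    rw [hq, ← rootBasis_inr b]
    refine ⟨fun h => mem_diagSpan_iff.mp h (Sum.inr α) (by rw [Basis.repr_self]; simp),
      fun h => ?_⟩
    exact basis_mem_diagSpan (p := fun a : ℂ => 0 ≤ a.re) (w := rootBasisWeight b z)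
      (k := Sum.inr α) h
  refine ⟨q, l, fun x hx => hql x (hHl x hx), ⟨b, fun α hα => ?_⟩, ?_, ?_,
    fun x hx => (hl x).mpr hx, fun S hS => ⟨fun x hx => ?_, fun x hx => ?_⟩⟩
  · rw [rootSpace_le_iff]
    refine (hqα α).mpr ?_
    rw [← hF]
    rcases (hb α).mp hα with h | h
    · exact h.le
    · exact h.1.ge
  · apply le_antisymm
    · have hl2 : l.toSubmodule = diagSpan (rootBasis b) (rootBasisWeight b z) (· = 0) := by
        ext x; exact hl' x
      rw [hl2]
      refine Submodule.span_le.mpr ?_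
      rintro _ ⟨k, hk, rfl⟩
      rcases k with i | α
      · rw [rootBasis_inl]; exact le_leviSubmodule (coroot (i : H.root).1).2
      · have hk : (α : Weight ℂ H L) z = 0 := hk
        rw [rootBasis_inr]
        exact rootVector_mem_leviSubmodule ((hqα α).mpr (by simp [hk]))
          ((hqα _).mpr (by simp [hk]))
    · refine leviSubmodule_le_iff.mpr ⟨hHl, fun α h1 h2 => (hl _).mpr ?_⟩
      rw [hqα] at h1 h2
      rw [coe_negRoot, Weight.coe_neg, Pi.neg_apply, Complex.neg_re] at h2
      have : (α : Weight ℂ H L) z = 0 := Complex.ext (by simpa using le_antisymm (by linarith) h1)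
        (by simpa using hre α)
      rw [lie_rootVector α z z.2, this, zero_smul]
  · intro h
    apply hz
    have : (z : L) ∈ LieAlgebra.center ℂ L := by
      rw [LieModule.mem_maxTrivSubmodule]
      intro x
      rw [← lie_skew, (hl x).mp (h ▸ LieSubalgebra.mem_top x), neg_zero]
    rw [LieAlgebra.center_eq_bot] at this
    simpa using this
  · rw [hq] at hx ⊢
    exact map_mem_diagSpan (T := ad ℂ L z) hT hS hx
  · rw [hl'] at hx ⊢
    exact map_mem_diagSpan (T := ad ℂ L z) hT hS hx

theorem killingForm_cartanEquivDual_symm (α : Weight ℂ H L) (x : H) :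
    killingForm ℂ L ((cartanEquivDual H).symm α : H) x = α x :=
  LinearMap.BilinForm.apply_toDual_symm_apply (hB := traceForm_cartan_nondegenerate ℂ L H) _ _

theorem killingForm_cartan (x y : H) : killingForm ℂ L x y =
    ∑ α : H.root, (α : Weight ℂ H L) x * (α : Weight ℂ H L) y := by
  have := LinearMap.congr_fun₂ (restrict_killingForm_eq_sum (K := ℂ) (L := L) (H := H)) x y
  rw [← Finset.sum_coe_sort H.root] at this
  simp only [LinearMap.sum_apply, LinearMap.smulRight_apply, LinearMap.smul_apply,
    smul_eq_mul] at this
  exact this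

/-- The values of roots at the elements representing roots are real. -/
theorem root_cartanEquivDual_symm_im (α β : H.root) :
    ((β : Weight ℂ H L) ((cartanEquivDual H).symm (α : Weight ℂ H L))).im = 0 := by
  set t := (cartanEquivDual H).symm (α : Weight ℂ H L)
  set c := (α : Weight ℂ H L) t with hc
  have hc0 : c ≠ 0 := root_apply_cartanEquivDual_symm_ne_zero (H.isNonZero_coe_root α)
  have hcor : ∀ γ : Weight ℂ H L, γ (coroot (α : Weight ℂ H L)) = 2 * c⁻¹ * γ t := fun γ => by
    have h1 : Weight.toLinear ℂ H L γ (coroot (α : Weight ℂ H L)) = 2 * c⁻¹ * Weight.toLinear ℂ H L γ t := by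
      rw [coroot, map_nsmul, map_smul]; simp [t, hc, mul_assoc]
    exact h1
  have hint : ∀ γ : Weight ℂ H L, ∃ n : ℤ, γ (coroot (α : Weight ℂ H L)) = n := fun γ =>
    ⟨_, apply_coroot_eq_cast _ _⟩
  choose n hn using hint
  have h1 : killingForm ℂ L (coroot (α : Weight ℂ H L) : H) (coroot (α : Weight ℂ H L) : H) =
      4 * c⁻¹ := by
    have h2 : (coroot (α : Weight ℂ H L) : H) = (2 * c⁻¹) • t := by
      rw [coroot, two_nsmul, ← two_smul ℂ, smul_smul]
    have h3 := root_apply_coroot (H.isNonZero_coe_root α)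
    rw [← killingForm_cartanEquivDual_symm] at h3
    conv_lhs => enter [1]; rw [h2]
    rw [show (((2 * c⁻¹) • t : H) : L) = (2 * c⁻¹) • (t : L) from rfl, map_smul, LinearMap.smul_apply, h3, smul_eq_mul]
    ring
  rw [killingForm_cartan] at h1
  simp_rw [hn] at h1
  have h4 : c⁻¹.im = 0 := by
    have h5 : c⁻¹ = ((∑ γ : H.root, n (γ : Weight ℂ H L) * n (γ : Weight ℂ H L) : ℤ) : ℂ) / 4 := by
      push_cast; rw [h1]; ring
    rw [h5]
    exact_mod_cast Complex.ofReal_im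
      (((∑ γ : H.root, n (γ : Weight ℂ H L) * n (γ : Weight ℂ H L) : ℤ) : ℝ) / 4)
  have h5 := hcor β
  rw [hn] at h5
  have h6 : (β : Weight ℂ H L) t = (n β : ℂ) * c / 2 := by
    rw [h5]; field_simp
  have h7 : c.im = 0 := by
    rw [Complex.inv_im] at h4
    have := Complex.normSq_pos.mpr hc0
    field_simp at h4
    linarith
  rw [h6, ← Complex.ofReal_intCast]
  simp [h7, Complex.mul_im, Complex.div_im]

end Parabolic

/-! ### Central elements of Levi factors -/

section LeviCenter

open Module LieAlgebra LieAlgebra.IsKilling LieModule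

variable {L : Type*} [LieRing L] [LieAlgebra ℂ L] [FiniteDimensional ℂ L] [IsKilling ℂ L]
  {H : LieSubalgebra ℂ L} [H.IsCartanSubalgebra]

theorem trace_ad_lie {q : Type*} [LieRing q] [LieAlgebra ℂ q] [FiniteDimensional ℂ q] (x y : q) :
    LinearMap.trace ℂ q (ad ℂ q ⁅x, y⁆) = 0 := by
  have : ad ℂ q ⁅x, y⁆ = ad ℂ q x * ad ℂ q y - ad ℂ q y * ad ℂ q x := by
    ext z; simp
  rw [this, map_sub, LinearMap.trace_mul_comm, sub_self]

/-- A subalgebra containing the Cartan subalgebra is spanned by the members of a root basis which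
it contains. -/
theorem subalgebra_eq_span (b : (rootSystem H).Base) {q : LieSubalgebra ℂ L} (hq : H ≤ q) :
    q.toSubmodule = Submodule.span ℂ (rootBasis b '' {k | rootBasis b k ∈ q}) := by
  apply le_antisymm
  · let N : LieSubmodule ℂ H L := { q.toSubmodule with
      lie_mem := fun {x m} hm => q.lie_mem (hq x.2) hm }
    have h1 := LieModule.eq_iSup_inf_genWeightSpace (N := N)
    have h2 : q.toSubmodule = N.toSubmodule := rfl
    rw [h2, h1, LieSubmodule.iSup_toSubmodule, iSup_le_iff]
    intro χ x hx
    obtain ⟨hxq, hxχ⟩ : x ∈ q ∧ x ∈ genWeightSpace L χ := hx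
    by_cases hχ : χ.IsZero
    · have h3 : x ∈ H.toSubmodule := by
        rw [show (χ : H → ℂ) = 0 from hχ] at hxχ
        simpa using hxχ
      rw [cartan_eq_span b] at h3
      refine Submodule.span_mono (Set.image_mono ?_) h3
      rintro _ ⟨i, rfl⟩
      change rootBasis b (Sum.inl i) ∈ q
      rw [rootBasis_inl]
      exact hq (coroot (i : H.root).1).2
    · obtain ⟨c, rfl⟩ := exists_eq_smul_rootVector ⟨χ, by simpa using hχ⟩ hxχ
      by_cases hc : c = 0
      · simp [hc]
      refine Submodule.smul_mem _ _ (Submodule.subset_span ⟨Sum.inr ⟨χ, by simpa using hχ⟩, ?_, by simp⟩)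
      change rootBasis b (Sum.inr _) ∈ q
      rw [rootBasis_inr]
      simpa [hc] using q.smul_mem c⁻¹ hxq
  · rw [Submodule.span_le]
    rintro _ ⟨k, hk, rfl⟩
    exact hk

theorem trace_ad_of_mem_cartan {q : LieSubalgebra ℂ L} (hq : H ≤ q) (x : H) [DecidablePred (· ∈ rootsIn H q)] :
    LinearMap.trace ℂ q (ad ℂ q ⟨x, hq x.2⟩) =
      ∑ α : H.root with α ∈ rootsIn H q, (α : Weight ℂ H L) x := by
  classical
  obtain ⟨b⟩ := (rootSystem H).nonempty_base
  let s : Finset (b.support ⊕ H.root) := Finset.univ.filter fun k => rootBasis b k ∈ q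
  have hW : q.toSubmodule = Submodule.span ℂ (rootBasis b '' s) := by
    rw [subalgebra_eq_span b hq]; simp [s]
  have h1 := trace_restrict_span (rootBasis b) s (ad ℂ L x) q.toSubmodule hW
    fun y hy => q.lie_mem (hq x.2) hy
  have h2 : ∀ k, (rootBasis b).repr (ad ℂ L x (rootBasis b k)) k = rootBasisWeight b x k := by
    intro k
    rw [ad_apply, lie_rootBasis]; simp
  rw [show ad ℂ q ⟨x, hq x.2⟩ = (ad ℂ L x).restrict fun y hy => q.lie_mem (hq x.2) hy from rfl]
  refine h1.trans ?_
  rw [Finset.sum_congr rfl fun k _ => h2 k, Finset.sum_filter, Fintype.sum_sum_type,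
    Finset.sum_filter]
  simp only [rootBasisWeight, rootsIn, Sum.elim_inl, ite_self, Finset.sum_const_zero, zero_add,
    Sum.elim_inr, rootBasis_inr, Set.mem_ofPred_eq]
  exact Finset.sum_congr rfl fun a _ => by congr

/-- The sum of the elements of the Cartan subalgebra dual to the roots of a subalgebra. -/
def rootSum (H q : LieSubalgebra ℂ L) [H.IsCartanSubalgebra] : H :=
  open Classical in
  ∑ α : H.root with α ∈ rootsIn H q, (cartanEquivDual H).symm (α : Weight ℂ H L)

theorem trace_ad_eq_killingForm {q : LieSubalgebra ℂ L} (hq : H ≤ q) {x : L} (hxq : x ∈ q)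
    (hx : x ∈ leviSubmodule H q) :
    LinearMap.trace ℂ q (ad ℂ q ⟨x, hxq⟩) = killingForm ℂ L (rootSum H q) x := by
  classical
  let D : q →ₗ[ℂ] ℂ := LinearMap.trace ℂ q ∘ₗ (ad ℂ q : q →ₗ[ℂ] Module.End ℂ q) -
    killingForm ℂ L (rootSum H q) ∘ₗ q.toSubmodule.subtype
  have hD : ∀ y : q, D y = LinearMap.trace ℂ q (ad ℂ q y) - killingForm ℂ L (rootSum H q) y :=
    fun y => rfl
  have key : leviSubmodule H q ≤ (LinearMap.ker D).map q.toSubmodule.subtype := by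
    rw [leviSubmodule_le_iff]
    constructor
    · intro y hy
      refine ⟨⟨y, hq hy⟩, ?_, rfl⟩
      rw [SetLike.mem_coe, LinearMap.mem_ker, hD, trace_ad_of_mem_cartan hq ⟨y, hy⟩, rootSum,
        sub_eq_zero]
      simp_rw [← killingForm_cartanEquivDual_symm]
      rw [show ((∑ α : H.root with α ∈ rootsIn H q, (cartanEquivDual H).symm
        (α : Weight ℂ H L) : H) : L) = ∑ α : H.root with α ∈ rootsIn H q,
          (((cartanEquivDual H).symm (α : Weight ℂ H L) : H) : L) from
          map_sum H.toSubmodule.subtype _ _]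
      rw [map_sum, LinearMap.sum_apply]
    · intro α hα _
      refine ⟨⟨_, hα⟩, ?_, rfl⟩
      rw [SetLike.mem_coe, LinearMap.mem_ker, hD]
      have h1 : killingForm ℂ L (rootSum H q) (rootVector α) = 0 := by
        refine killingForm_apply_eq_zero_of_mem_rootSpace_of_add_ne_zero ℂ L H (α := 0)
          (β := (α : Weight ℂ H L)) (by simp) (rootVector_mem α) ?_
        rw [zero_add]
        exact H.isNonZero_coe_root α
      have h2 := trace_ad_lie (⟨_, hq (coroot (α : Weight ℂ H L)).2⟩ : q) ⟨_, hα⟩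
      have h3 : ⁅(⟨_, hq (coroot (α : Weight ℂ H L)).2⟩ : q), (⟨_, hα⟩ : q)⁆ =
          (2 : ℂ) • (⟨_, hα⟩ : q) := by
        apply Subtype.ext
        change ⁅((coroot (α : Weight ℂ H L) : H) : L), rootVector α⁆ = (2 : ℂ) • rootVector α
        rw [lie_rootVector α _ (coroot (α : Weight ℂ H L)).2]
        congr 1
        exact root_apply_coroot (H.isNonZero_coe_root α)
      rw [h3, map_smul, map_smul] at h2
      rw [h1, sub_zero]
      simpa using h2
  obtain ⟨y, hy, rfl⟩ := key hx
  rw [SetLike.mem_coe, LinearMap.mem_ker, hD, sub_eq_zero] at hy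
  exact hy

theorem eq_zero_of_killingForm_leviSubmodule {q : LieSubalgebra ℂ L} {x : L}
    (hx : x ∈ leviSubmodule H q) (h : ∀ y ∈ leviSubmodule H q, killingForm ℂ L x y = 0) :
    x = 0 := by
  obtain ⟨b⟩ := (rootSystem H).nonempty_base
  have h1 : killingForm ℂ L x = 0 := by
    refine (rootBasis b).ext fun k => ?_
    rw [LinearMap.zero_apply]
    rcases k with i | β
    · rw [rootBasis_inl]
      exact h _ (le_leviSubmodule (coroot (i : H.root).1).2)
    · rw [rootBasis_inr]
      by_cases hβ : rootVector β ∈ q ∧ rootVector (negRoot β) ∈ q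
      · exact h _ (rootVector_mem_leviSubmodule hβ.1 hβ.2)
      · have : leviSubmodule H q ≤ LinearMap.ker ((killingForm ℂ L).flip (rootVector β)) := by
          rw [leviSubmodule_le_iff]
          constructor
          · intro y hy
            refine killingForm_apply_eq_zero_of_mem_rootSpace_of_add_ne_zero ℂ L H (α := 0)
              (β := (β : Weight ℂ H L)) (by simpa using hy) (rootVector_mem β) ?_
            rw [zero_add]
            exact H.isNonZero_coe_root β
          · intro α hα hα'
            refine killingForm_apply_eq_zero_of_mem_rootSpace_of_add_ne_zero ℂ L H
              (rootVector_mem α) (rootVector_mem β) fun h0 => hβ ?_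
            have : α = negRoot β := by
              apply Subtype.ext
              apply DFunLike.coe_injective
              exact eq_neg_of_add_eq_zero_left h0
            subst this
            exact ⟨by simpa using hα', hα⟩
        exact this hx
  have := LinearMap.mem_ker.mpr h1
  rwa [ker_killingForm_eq_bot, Submodule.mem_bot] at this

/-- A proper Levi factor of a parabolic subalgebra has a nonzero sum of dual roots. -/
theorem rootSum_ne_zero {q : LieSubalgebra ℂ L}
    (b : (rootSystem H).Base) (hb : ∀ α : H.root, b.IsPos α → rootVector α ∈ q)
    (hl : leviSubmodule H q ≠ ⊤) : rootSum H q ≠ 0 := by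
  classical
  obtain ⟨w, hw⟩ : ∃ w : H, ∀ i ∈ b.support, (rootSystem H).root i w = 1 := by
    refine ⟨(evalEquiv ℂ H).symm (b.toWeightBasis.constr ℂ fun _ => (1 : ℂ)), fun i hi => ?_⟩
    have := b.toWeightBasis.constr_basis ℂ (fun _ => (1 : ℂ)) ⟨i, hi⟩
    rw [RootPairing.Base.toWeightBasis_apply] at this
    exact (apply_evalEquiv_symm_apply ℂ H _ _).trans this
  let F : Dual ℂ H →+ ℝ :=
    Complex.reLm.toAddMonoidHom.comp (LinearMap.toAddMonoidHom (Dual.eval ℂ H w))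
  have hF : ∀ α : H.root, F ((rootSystem H).root α) = ((α : Weight ℂ H L) w).re := fun _ => rfl
  have hpos := base_isPos_iff_of_support b F fun i hi => by
    change 0 < ((rootSystem H).root i w).re
    rw [hw i hi]; simp
  intro h0
  have h1 : ∑ α : H.root with α ∈ rootsIn H q, ((α : Weight ℂ H L) w).re = 0 := by
    have : killingForm ℂ L (rootSum H q) w = 0 := by simp [h0]
    rw [rootSum, show ((∑ α : H.root with α ∈ rootsIn H q, (cartanEquivDual H).symm
        (α : Weight ℂ H L) : H) : L) = ∑ α : H.root with α ∈ rootsIn H q,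
          (((cartanEquivDual H).symm (α : Weight ℂ H L) : H) : L) from
          map_sum H.toSubmodule.subtype _ _, map_sum, LinearMap.sum_apply] at this
    simp_rw [killingForm_cartanEquivDual_symm] at this
    rw [← Complex.re_sum, this, Complex.zero_re]
  rw [← Finset.sum_filter_add_sum_filter_not _ (fun α => negRoot α ∈ rootsIn H q)] at h1
  have h2 : ∑ α ∈ (Finset.univ.filter (· ∈ rootsIn H q)).filter
      (fun α : H.root => negRoot α ∈ rootsIn H q), ((α : Weight ℂ H L) w).re = 0 := by
    refine Finset.sum_involution (fun α _ => negRoot α) ?_ ?_ ?_ ?_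
    · intro α _; simp
    · intro α _ _; exact negRoot_ne α
    · intro α hα
      simp only [Finset.mem_filter, Finset.mem_univ, true_and, negRoot_negRoot] at hα ⊢
      exact hα.symm
    · intro α _; simp
  rw [h2, zero_add] at h1
  have h3 : ∀ α ∈ (Finset.univ.filter (· ∈ rootsIn H q)).filter
      (fun α : H.root => negRoot α ∉ rootsIn H q), 0 < ((α : Weight ℂ H L) w).re := by
    intro α hα
    simp only [Finset.mem_filter, Finset.mem_univ, true_and] at hα
    rw [← hF, ← hpos]
    exact (isPos_or_isPos_negRoot b α).resolve_right fun h => hα.2 (hb _ h)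
  have h4 : ((Finset.univ.filter (· ∈ rootsIn H q)).filter
      (fun α : H.root => negRoot α ∉ rootsIn H q)) = ∅ := by
    by_contra hne
    exact (Finset.sum_pos h3 (Finset.nonempty_iff_ne_empty.mpr hne)).ne' h1
  have h5 : ∀ α : H.root, α ∈ rootsIn H q → negRoot α ∈ rootsIn H q := fun α hα => by
    by_contra hn
    have : α ∈ (∅ : Finset H.root) := h4 ▸ by simp [hα, hn]
    simp at this
  have h6 : ∀ α : H.root, rootVector α ∈ q ∧ rootVector (negRoot α) ∈ q := fun α => by
    rcases isPos_or_isPos_negRoot b α with h | h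
    · exact ⟨hb _ h, h5 _ (hb _ h)⟩
    · exact ⟨by have := h5 _ (hb _ h); rwa [negRoot_negRoot] at this, hb _ h⟩
  refine hl (eq_top_iff.mpr ?_)
  rw [← (rootBasis b).span_eq, Submodule.span_le]
  rintro _ ⟨i | α, rfl⟩
  · rw [rootBasis_inl]; exact le_leviSubmodule (coroot (i : H.root).1).2
  · rw [rootBasis_inr]; exact rootVector_mem_leviSubmodule (h6 α).1 (h6 α).2

/-- A proper Levi factor stable under an involution of the parabolic subalgebra is centralized by
a fixed point of the involution with nonzero norm. -/
theorem exists_central_of_levi {q l : LieSubalgebra ℂ L} (hq : H ≤ q)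
    (b : (rootSystem H).Base) (hb : ∀ α : H.root, b.IsPos α → rootVector α ∈ q)
    (hlq : l.toSubmodule = leviSubmodule H q) (hl : l ≠ ⊤) (S : L ≃ₗ⁅ℂ⁆ L)
    (hS : ∀ x, S (S x) = x) (hSq : ∀ x ∈ q, S x ∈ q) (hSl : ∀ x ∈ l, S x ∈ l) :
    ∃ z : L, S z = z ∧ (∀ x ∈ l, ⁅z, x⁆ = 0) ∧ killingForm ℂ L z z ≠ 0 := by
  classical
  have hlq' : ∀ x, x ∈ l ↔ x ∈ leviSubmodule H q := fun x => by rw [← hlq]; rfl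
  have hle : ∀ x ∈ l, x ∈ q := fun x hx => by
    have : leviSubmodule H q ≤ q.toSubmodule :=
      leviSubmodule_le_iff.mpr ⟨fun y hy => hq hy, fun α h _ => h⟩
    exact this ((hlq' x).mp hx)
  set z := rootSum H q with hz
  have hzl : (z : L) ∈ l := (hlq' _).mpr (le_leviSubmodule z.2)
  have hD : ∀ x (hx : x ∈ l), LinearMap.trace ℂ q (ad ℂ q ⟨x, hle x hx⟩) = killingForm ℂ L z x :=
    fun x hx => trace_ad_eq_killingForm hq (hle x hx) ((hlq' x).mp hx)
  have hnd : ∀ x ∈ l, (∀ y ∈ l, killingForm ℂ L x y = 0) → x = 0 := fun x hx h =>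
    eq_zero_of_killingForm_leviSubmodule ((hlq' x).mp hx) fun y hy => h y ((hlq' y).mpr hy)
  have hDS : ∀ x (hx : x ∈ q), LinearMap.trace ℂ q (ad ℂ q ⟨S x, hSq x hx⟩) =
      LinearMap.trace ℂ q (ad ℂ q ⟨x, hx⟩) := by
    intro x hx
    let R : Module.End ℂ q := (S : L →ₗ[ℂ] L).restrict hSq
    have hR : R * R = 1 := by
      ext y; exact hS y
    have h1 : ad ℂ q ⟨S x, hSq x hx⟩ = R * ad ℂ q ⟨x, hx⟩ * R := by
      ext y
      change ⁅S x, (y : L)⁆ = S ⁅x, S (y : L)⁆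
      rw [LieEquiv.map_lie, hS]
    rw [h1, LinearMap.trace_mul_cycle, hR, one_mul]
  refine ⟨z, ?_, ?_, ?_⟩
  · rw [← sub_eq_zero]
    refine hnd _ (sub_mem (hSl _ hzl) hzl) fun y hy => ?_
    have h1 : killingForm ℂ L (S z) y = killingForm ℂ L z (S y) := by
      rw [← killingForm_of_equiv_apply S, hS]
    rw [map_sub, LinearMap.sub_apply, h1, ← hD _ (hSl y hy), ← hD y hy, hDS y (hle y hy), sub_self]
  · intro x hx
    refine hnd _ (l.lie_mem hzl hx) fun y hy => ?_
    rw [LieModule.traceForm_apply_lie_apply, ← hD _ (l.lie_mem hx hy)]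
    exact trace_ad_lie (⟨x, hle x hx⟩ : q) ⟨y, hle y hy⟩
  · have hre : ∀ γ : H.root, ((γ : Weight ℂ H L) z).im = 0 := fun γ => by
      have : (γ : Weight ℂ H L) z = ∑ α : H.root with α ∈ rootsIn H q,
          (γ : Weight ℂ H L) ((cartanEquivDual H).symm (α : Weight ℂ H L)) :=
        map_sum (Weight.toLinear ℂ H L γ) _ _
      rw [this, Complex.im_sum]
      exact Finset.sum_eq_zero fun α _ => root_cartanEquivDual_symm_im α γ
    have hz0 : z ≠ 0 := rootSum_ne_zero b hb fun h => hl (by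
      rw [← LieSubalgebra.toSubmodule_inj, hlq, h]; rfl)
    intro h0
    rw [killingForm_cartan] at h0
    have h1 : ∑ γ : H.root, ((γ : Weight ℂ H L) z).re ^ 2 = 0 := by
      have := congrArg Complex.re h0
      rw [Complex.re_sum] at this
      rw [← Complex.zero_re, ← this]
      refine Finset.sum_congr rfl fun γ _ => ?_
      rw [Complex.mul_re, hre]; ring
    rw [Finset.sum_eq_zero_iff_of_nonneg fun _ _ => sq_nonneg _] at h1
    apply hz0
    have h2 : ∀ γ : H.root, (γ : Weight ℂ H L) z = 0 := fun γ =>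
      Complex.ext (by simpa using h1 γ (Finset.mem_univ _)) (by simpa using hre γ)
    have h3 : ∀ f : Dual ℂ H, f z = 0 := fun f => by
      have hf : f ∈ Submodule.span ℂ (Set.range (rootSystem H).root) := by
        rw [RootPairing.IsRootSystem.span_root_eq_top]; trivial
      induction hf using Submodule.span_induction with
      | mem f hf => obtain ⟨γ, rfl⟩ := hf; exact h2 γ
      | zero => rfl
      | add f g _ _ hf hg => rw [LinearMap.add_apply, hf, hg, add_zero]
      | smul a f _ hf => rw [LinearMap.smul_apply, hf, smul_zero]
    exact (forall_dual_apply_eq_zero_iff ℂ z).mp h3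

end LeviCenter

/-! ### Cartan subalgebras of the complexification -/

section FundamentalCartan

open Module LieAlgebra LieAlgebra.IsKilling LieModule

theorem isCartanSubalgebra_of_abelian {K L : Type*} [CommRing K] [LieRing L] [LieAlgebra K L]
    (H : LieSubalgebra K L) (hab : ∀ x ∈ H, ∀ y ∈ H, ⁅x, y⁆ = 0)
    (hn : ∀ x, (∀ y ∈ H, ⁅x, y⁆ ∈ H) → x ∈ H) : H.IsCartanSubalgebra where
  nilpotent := by
    have : IsLieAbelian H := ⟨fun x y => Subtype.ext (hab x x.2 y y.2)⟩
    infer_instance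
  self_normalizing := le_antisymm
    (fun x hx => hn x fun y hy => (H.mem_normalizer_iff x).mp hx y hy) H.le_normalizer

variable {L₀ : Type*} [LieRing L₀] [LieAlgebra ℝ L₀] [FiniteDimensional ℝ L₀]

/-- The centralizer of a set in a Lie algebra. -/
def setCentralizer (K : Type*) {L : Type*} [CommRing K] [LieRing L] [LieAlgebra K L] (S : Set L) :
    LieSubalgebra K L where
  carrier := {x | ∀ a ∈ S, ⁅a, x⁆ = 0}
  add_mem' {x y} hx hy a ha := by rw [lie_add, hx a ha, hy a ha, add_zero]
  zero_mem' a _ := lie_zero _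
  smul_mem' c x hx a ha := by rw [lie_smul, hx a ha, smul_zero]
  lie_mem' {x y} hx hy a ha := by
    rw [leibniz_lie, hx a ha, hy a ha, lie_zero, zero_lie, add_zero]

/-- The centralizer in the complexification of a subspace of the real form. -/
def complexCentralizer (t : Submodule ℝ L₀) : LieSubalgebra ℂ (ℂ ⊗[ℝ] L₀) :=
  setCentralizer ℂ ((fun a => (1 : ℂ) ⊗ₜ[ℝ] a) '' (t : Set L₀))

theorem mem_complexCentralizer {t : Submodule ℝ L₀} {x : ℂ ⊗[ℝ] L₀} :
    x ∈ complexCentralizer t ↔ ∀ a ∈ t, ⁅(1 : ℂ) ⊗ₜ[ℝ] a, x⁆ = 0 :=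
  Set.forall_mem_image

theorem cplx_mem_complexCentralizer {t : Submodule ℝ L₀} {u v : L₀} :
    cplx u v ∈ complexCentralizer t ↔ (∀ a ∈ t, ⁅a, u⁆ = 0) ∧ ∀ a ∈ t, ⁅a, v⁆ = 0 := by
  simp only [mem_complexCentralizer, one_tmul_eq_cplx, lie_cplx, cplx_eq_zero, zero_lie, sub_zero,
    add_zero, forall_and]

/-- A maximal abelian subspace of `𝔨₀` containing a given element. -/
theorem exists_maximal_abelian (θ : L₀ ≃ₗ⁅ℝ⁆ L₀) {y : L₀} (hy : θ y = y) :
    ∃ t : Submodule ℝ L₀, y ∈ t ∧ (∀ x ∈ t, θ x = x) ∧ (∀ x ∈ t, ∀ x' ∈ t, ⁅x, x'⁆ = 0) ∧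
      ∀ x, θ x = x → (∀ a ∈ t, ⁅a, x⁆ = 0) → x ∈ t := by
  let P : Set (Submodule ℝ L₀) := {t | y ∈ t ∧ (∀ x ∈ t, θ x = x) ∧
    ∀ x ∈ t, ∀ x' ∈ t, ⁅x, x'⁆ = 0}
  have extend : ∀ t : Submodule ℝ L₀, (∀ x ∈ t, θ x = x) → (∀ x ∈ t, ∀ x' ∈ t, ⁅x, x'⁆ = 0) →
      ∀ x, θ x = x → (∀ a ∈ t, ⁅a, x⁆ = 0) → (∀ w ∈ t ⊔ ℝ ∙ x, θ w = w) ∧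
        ∀ w ∈ t ⊔ ℝ ∙ x, ∀ w' ∈ t ⊔ ℝ ∙ x, ⁅w, w'⁆ = 0 := by
    intro t h1 h2 x hx hx'
    have hx'' : ∀ a ∈ t, ⁅x, a⁆ = 0 := fun a ha => by rw [← lie_skew, hx' a ha, neg_zero]
    constructor
    · intro w hw
      obtain ⟨a, ha, _, hc, rfl⟩ := Submodule.mem_sup.mp hw
      obtain ⟨c, rfl⟩ := Submodule.mem_span_singleton.mp hc
      rw [map_add, map_smul, h1 a ha, hx]
    · intro w hw w' hw'
      obtain ⟨a, ha, _, hc, rfl⟩ := Submodule.mem_sup.mp hw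
      obtain ⟨c, rfl⟩ := Submodule.mem_span_singleton.mp hc
      obtain ⟨a', ha', _, hc', rfl⟩ := Submodule.mem_sup.mp hw'
      obtain ⟨c', rfl⟩ := Submodule.mem_span_singleton.mp hc'
      simp [h2 a ha a' ha', hx' a ha, hx'' a' ha']
  have hP : P.Nonempty := by
    obtain ⟨h1, h2⟩ := extend ⊥ (by simp) (by simp) y hy (by simp)
    exact ⟨⊥ ⊔ ℝ ∙ y, by simp [Submodule.mem_span_singleton_self], h1, h2⟩
  obtain ⟨t, ⟨h1, h2, h3⟩, ht⟩ := set_has_maximal_iff_noetherian.mpr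
    (inferInstance : IsNoetherian ℝ L₀) P hP
  refine ⟨t, h1, h2, h3, fun x hx hx' => ?_⟩
  obtain ⟨h4, h5⟩ := extend t h2 h3 x hx hx'
  by_contra hxt
  refine ht (t ⊔ ℝ ∙ x) ⟨Submodule.mem_sup_left h1, h4, h5⟩ ?_
  exact lt_of_le_of_ne le_sup_left fun h => hxt (by
    rw [h]; exact Submodule.mem_sup_right (Submodule.mem_span_singleton_self x))

variable {θ : L₀ ≃ₗ⁅ℝ⁆ L₀} (hθ : IsCartanInvolution θ)
include hθ

/-- The centralizer of a maximal abelian subspace of `𝔨₀` is abelian. -/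
theorem IsCartanInvolution.lie_eq_zero_of_centralizer {t : Submodule ℝ L₀} (h1 : ∀ x ∈ t, θ x = x)
    (h3 : ∀ x, θ x = x → (∀ a ∈ t, ⁅a, x⁆ = 0) → x ∈ t)
    {u v : L₀} (hu : ∀ a ∈ t, ⁅a, u⁆ = 0) (hv : ∀ a ∈ t, ⁅a, v⁆ = 0) : ⁅u, v⁆ = 0 := by
  have hθc : ∀ w, (∀ a ∈ t, ⁅a, w⁆ = 0) → ∀ a ∈ t, ⁅a, θ w⁆ = 0 := fun w hw a ha => by
    conv_lhs => rw [← h1 a ha, ← LieEquiv.map_lie, hw a ha, map_zero]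
  have hadd : ∀ w w' : L₀, (∀ a ∈ t, ⁅a, w⁆ = 0) → (∀ a ∈ t, ⁅a, w'⁆ = 0) →
      ∀ a ∈ t, ⁅a, w + w'⁆ = 0 := fun w w' h h' a ha => by rw [lie_add, h a ha, h' a ha, add_zero]
  have hsub : ∀ w w' : L₀, (∀ a ∈ t, ⁅a, w⁆ = 0) → (∀ a ∈ t, ⁅a, w'⁆ = 0) →
      ∀ a ∈ t, ⁅a, w - w'⁆ = 0 := fun w w' h h' a ha => by rw [lie_sub, h a ha, h' a ha, sub_zero]
  have hk : ∀ w, (∀ a ∈ t, ⁅a, w⁆ = 0) → w + θ w ∈ t := fun w hw =>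
    h3 _ (by rw [map_add, hθ.involutive, add_comm]) (hadd _ _ hw (hθc w hw))
  have hp : ∀ p q, θ p = -p → θ q = -q → (∀ a ∈ t, ⁅a, p⁆ = 0) → (∀ a ∈ t, ⁅a, q⁆ = 0) →
      ⁅p, q⁆ = 0 := by
    intro p q hp hq hpt hqt
    have hpq : θ ⁅p, q⁆ = ⁅p, q⁆ := by rw [LieEquiv.map_lie, hp, hq, neg_lie, lie_neg, neg_neg]
    have hc : ⁅p, q⁆ ∈ t := h3 _ hpq fun a ha => by
      rw [leibniz_lie, hpt a ha, hqt a ha, zero_lie, lie_zero, add_zero]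
    apply hθ.eq_zero_of_killing_theta
    rw [hpq, LieModule.traceForm_apply_lie_apply, ← lie_skew, hqt _ hc, neg_zero, map_zero]
  have h4 : ⁅u + θ u, v + θ v⁆ = 0 := hadd _ _ hv (hθc v hv) _ (hk u hu)
  have h5 : ⁅u + θ u, v - θ v⁆ = 0 := hsub _ _ hv (hθc v hv) _ (hk u hu)
  have h6 : ⁅u - θ u, v + θ v⁆ = 0 := by
    rw [← lie_skew, hsub _ _ hu (hθc u hu) _ (hk v hv), neg_zero]
  have h7 : ⁅u - θ u, v - θ v⁆ = 0 := hp _ _ (by rw [map_sub, hθ.involutive]; abel)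
    (by rw [map_sub, hθ.involutive]; abel) (hsub _ _ hu (hθc u hu)) (hsub _ _ hv (hθc v hv))
  have h8 : (4 : ℝ) • ⁅u, v⁆ = 0 := by
    calc (4 : ℝ) • ⁅u, v⁆ = ⁅u + θ u, v + θ v⁆ + ⁅u + θ u, v - θ v⁆ + ⁅u - θ u, v + θ v⁆ +
          ⁅u - θ u, v - θ v⁆ := by
            simp only [lie_add, add_lie, lie_sub, sub_lie]
            module
      _ = 0 := by rw [h4, h5, h6, h7]; simp
  exact (smul_eq_zero.mp h8).resolve_left (by norm_num)

theorem IsCartanInvolution.isCartanSubalgebra_complexCentralizer {t : Submodule ℝ L₀}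
    (h1 : ∀ x ∈ t, θ x = x) (h2 : ∀ x ∈ t, ∀ x' ∈ t, ⁅x, x'⁆ = 0)
    (h3 : ∀ x, θ x = x → (∀ a ∈ t, ⁅a, x⁆ = 0) → x ∈ t) :
    (complexCentralizer t).IsCartanSubalgebra := by
  apply isCartanSubalgebra_of_abelian
  · intro x hx y hy
    obtain ⟨a, b, rfl⟩ := exists_cplx x
    obtain ⟨c, d, rfl⟩ := exists_cplx y
    rw [cplx_mem_complexCentralizer] at hx hy
    rw [lie_cplx, hθ.lie_eq_zero_of_centralizer h1 h3 hx.1 hy.1,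
      hθ.lie_eq_zero_of_centralizer h1 h3 hx.2 hy.2, hθ.lie_eq_zero_of_centralizer h1 h3 hx.1 hy.2,
      hθ.lie_eq_zero_of_centralizer h1 h3 hx.2 hy.1]
    simp [cplx]
  · intro x hx
    refine mem_complexCentralizer.mpr fun a ha => ?_
    have hI : ∀ w : ℂ ⊗[ℝ] L₀, ⁅Complex.I ⊗ₜ[ℝ] a, w⁆ = Complex.I • ⁅(1 : ℂ) ⊗ₜ[ℝ] a, w⁆ :=
      fun w => by rw [← cplx_smul_lie, TensorProduct.smul_tmul', smul_eq_mul, mul_one]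
    have h4 := hx ((1 : ℂ) ⊗ₜ[ℝ] a) <| mem_complexCentralizer.mpr fun b hb => by
      rw [one_tmul_eq_cplx, one_tmul_eq_cplx, lie_cplx, h2 b hb a ha]; simp [cplx]
    have h5 : ⁅(1 : ℂ) ⊗ₜ[ℝ] a, ⁅(1 : ℂ) ⊗ₜ[ℝ] a, x⁆⁆ = 0 := by
      have h6 : ⁅(1 : ℂ) ⊗ₜ[ℝ] a, x⁆ = -⁅x, (1 : ℂ) ⊗ₜ[ℝ] a⁆ := (lie_skew _ _).symm
      rw [h6]; exact mem_complexCentralizer.mp (neg_mem h4) a ha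
    have h6 := hθ.lie_I_lie_I_eq_zero (h1 a ha) (w := x) (by
      rw [hI x, cplx_lie_smul, hI, h5, smul_zero, smul_zero])
    rw [hI] at h6
    exact (smul_eq_zero.mp h6).resolve_left Complex.I_ne_zero

variable [LieAlgebra.IsSemisimple ℝ L₀]

/-- Roots take real values at the elements `i y`, `y ∈ 𝔨₀`. -/
theorem IsCartanInvolution.root_im_eq_zero {H : LieSubalgebra ℂ (ℂ ⊗[ℝ] L₀)} [H.IsCartanSubalgebra]
    (y : L₀) (hy : θ y = y) (hyH : Complex.I ⊗ₜ[ℝ] y ∈ H) (α : H.root) :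
    ((α : Weight ℂ H (ℂ ⊗[ℝ] L₀)) ⟨_, hyH⟩).im = 0 :=
  hθ.im_eq_zero_of_lie_I_eq_smul hy (rootVector_ne_zero α) (lie_rootVector α _ hyH)

/-- Every element of `𝔨₀` lies in a fundamental Cartan subalgebra. -/
theorem IsCartanInvolution.exists_cartan {y : L₀} (hy : θ y = y) :
    ∃ (H : LieSubalgebra ℂ (ℂ ⊗[ℝ] L₀)) (_ : H.IsCartanSubalgebra), Complex.I ⊗ₜ[ℝ] y ∈ H ∧
      (∀ x ∈ H, complexTheta θ x ∈ H) ∧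
      (∀ x ∈ kSpace θ, (∀ y ∈ H, y ∈ kSpace θ → ⁅x, y⁆ = 0) → x ∈ H) ∧
      ∃ (y' : L₀) (hy' : Complex.I ⊗ₜ[ℝ] y' ∈ H), θ y' = y' ∧
        ∀ α : H.root, (α : Weight ℂ H (ℂ ⊗[ℝ] L₀)) ⟨_, hy'⟩ ≠ 0 := by
  obtain ⟨t, hyt, h1, h2, h3⟩ := exists_maximal_abelian θ hy
  have hC := hθ.isCartanSubalgebra_complexCentralizer h1 h2 h3
  have ht1 : ∀ a ∈ t, (1 : ℂ) ⊗ₜ[ℝ] a ∈ complexCentralizer t := fun a ha =>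
    mem_complexCentralizer.mpr fun b hb => by
    rw [one_tmul_eq_cplx, one_tmul_eq_cplx, lie_cplx, h2 b hb a ha]; simp [cplx]
  have htI : ∀ a ∈ t, Complex.I ⊗ₜ[ℝ] a ∈ complexCentralizer t := fun a ha =>
    mem_complexCentralizer.mpr fun b hb => by
    rw [one_tmul_eq_cplx, I_tmul_eq_cplx, lie_cplx, h2 b hb a ha]; simp [cplx]
  refine ⟨complexCentralizer t, hC, htI y hyt, ?_, ?_, ?_⟩
  · intro x hx
    refine mem_complexCentralizer.mpr fun a ha => ?_
    have : (1 : ℂ) ⊗ₜ[ℝ] a = complexTheta θ ((1 : ℂ) ⊗ₜ[ℝ] a) := by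
      rw [one_tmul_eq_cplx, complexTheta_cplx, h1 a ha, map_zero]
    rw [this, ← complexTheta_lie, mem_complexCentralizer.mp hx a ha, map_zero]
  · intro x _ hx
    refine mem_complexCentralizer.mpr fun a ha => ?_
    have := hx _ (ht1 a ha) (by
      rw [mem_kSpace, one_tmul_eq_cplx, complexTheta_cplx, h1 a ha, map_zero])
    rw [← lie_skew, this, neg_zero]
  · have hext : ∀ α : (complexCentralizer t).root, ∃ f : Module.Dual ℝ L₀,
        ∀ a (ha : a ∈ t),
          f a = ((α : Weight ℂ (complexCentralizer t) (ℂ ⊗[ℝ] L₀)) ⟨_, htI a ha⟩).re := by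
      intro α
      obtain ⟨g, hg⟩ := LinearMap.exists_extend
        (Weight.toLinear ℂ (complexCentralizer t) (ℂ ⊗[ℝ] L₀)
          (α : Weight ℂ (complexCentralizer t) (ℂ ⊗[ℝ] L₀)) :
          (complexCentralizer t).toSubmodule →ₗ[ℂ] ℂ)
      refine ⟨Complex.reLm ∘ₗ (g.restrictScalars ℝ) ∘ₗ
        (TensorProduct.mk ℝ ℂ L₀ Complex.I), fun a ha => ?_⟩
      have := LinearMap.congr_fun hg ⟨_, htI a ha⟩
      exact congrArg Complex.re this
    choose f hf using hext
    obtain ⟨y', hy't, hy'⟩ := Module.Dual.exists_forall_mem_ne_zero_of_forall_exists t f (by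
      intro α
      by_contra! hcon
      have h4 : rootVector α ∈ complexCentralizer t := mem_complexCentralizer.mpr fun a ha => by
        have h5 := lie_rootVector α _ (htI a ha)
        have h6 : (α : Weight ℂ (complexCentralizer t) (ℂ ⊗[ℝ] L₀)) ⟨_, htI a ha⟩ = 0 :=
          Complex.ext (by rw [← hf α a ha, hcon a ha]; rfl)
            (hθ.root_im_eq_zero a (h1 a ha) (htI a ha) α)
        rw [h6, zero_smul] at h5
        have hI : ⁅Complex.I ⊗ₜ[ℝ] a, rootVector α⁆ =
            Complex.I • ⁅(1 : ℂ) ⊗ₜ[ℝ] a, rootVector α⁆ := by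
          rw [← cplx_smul_lie, TensorProduct.smul_tmul', smul_eq_mul, mul_one]
        rw [hI] at h5
        exact (smul_eq_zero.mp h5).resolve_left Complex.I_ne_zero
      have h7 := root_apply_coroot ((complexCentralizer t).isNonZero_coe_root α)
      have h8 := lie_rootVector α _ (coroot (α : Weight ℂ (complexCentralizer t) (ℂ ⊗[ℝ] L₀))).2
      rw [lie_cartan _ _ (coroot (α : Weight ℂ (complexCentralizer t) (ℂ ⊗[ℝ] L₀))).2 h4] at h8
      have h9 := (smul_eq_zero.mp h8.symm).resolve_right (rootVector_ne_zero α)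
      rw [Subtype.coe_eta, h7] at h9
      norm_num at h9)
    exact ⟨y', htI y' hy't, h1 y' hy't, fun α h => hy' α (by rw [hf α y' hy't, h]; rfl)⟩

/-- An element centralized by a conjugate of a nonzero element of `𝔨₀` lies in a proper `θ`-stable
Levi subalgebra. -/
theorem IsCartanInvolution.exists_thetaStableLevi {y : L₀} (hy : θ y = y) (hy0 : y ≠ 0)
    (φ : (ℂ ⊗[ℝ] L₀) ≃ₗ⁅ℂ⁆ (ℂ ⊗[ℝ] L₀)) (hφ : ∀ x, φ (complexTheta θ x) = complexTheta θ (φ x))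
    {x : ℂ ⊗[ℝ] L₀} (hx : ⁅φ ((1 : ℂ) ⊗ₜ[ℝ] y), x⁆ = 0) :
    ∃ l : LieSubalgebra ℂ (ℂ ⊗[ℝ] L₀), IsThetaStableLevi θ l ∧ x ∈ l ∧ l ≠ ⊤ := by
  obtain ⟨H₀, hH₀, hyH, -⟩ := hθ.exists_cartan hy
  let H : LieSubalgebra ℂ (ℂ ⊗[ℝ] L₀) :=
    H₀.comap ((φ.symm : (ℂ ⊗[ℝ] L₀) ≃ₗ⁅ℂ⁆ (ℂ ⊗[ℝ] L₀)) : (ℂ ⊗[ℝ] L₀) →ₗ⁅ℂ⁆ (ℂ ⊗[ℝ] L₀))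
  have hH : ∀ w, w ∈ H ↔ φ.symm w ∈ H₀ := fun w => Iff.rfl
  have hC : H.IsCartanSubalgebra := by
    apply isCartanSubalgebra_of_abelian
    · intro u hu v hv
      exact φ.symm.injective (((LieEquiv.map_lie φ.symm u v).trans
        (lie_cartan _ _ hu hv)).trans (map_zero φ.symm).symm)
    · intro u hu
      have h1 : φ.symm u ∈ H₀.normalizer := by
        rw [LieSubalgebra.mem_normalizer_iff]
        intro v hv
        have := hu (φ v) (by rw [hH, φ.symm_apply_apply]; exact hv)
        rwa [hH, LieEquiv.map_lie, φ.symm_apply_apply] at this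
      rwa [LieSubalgebra.IsCartanSubalgebra.self_normalizing] at h1
  clear_value H
  have hz : φ (Complex.I ⊗ₜ[ℝ] y) ∈ H := by rw [hH, φ.symm_apply_apply]; exact hyH
  have hzθ : complexTheta θ (φ (Complex.I ⊗ₜ[ℝ] y)) = φ (Complex.I ⊗ₜ[ℝ] y) := by
    rw [← hφ, I_tmul_eq_cplx, complexTheta_cplx, hy, map_zero]
  have hIy : Complex.I ⊗ₜ[ℝ] y = Complex.I • ((1 : ℂ) ⊗ₜ[ℝ] y) := by
    rw [TensorProduct.smul_tmul', smul_eq_mul, mul_one]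
  obtain ⟨q, l, h1, h2, h3, h4, h5, h6⟩ := exists_parabolic_of_real (H := H) ⟨_, hz⟩
    (fun h => hy0 (by
      have h0 := congrArg Subtype.val h
      have h0 := (map_eq_zero_iff φ φ.injective).mp h0
      rw [I_tmul_eq_cplx, cplx_eq_zero] at h0
      exact h0.2))
    (fun α => by
      have h1 := lie_rootVector α _ hz
      have h2 := congrArg φ.symm h1
      rw [LieEquiv.map_lie, φ.symm_apply_apply, map_smul] at h2
      exact hθ.im_eq_zero_of_lie_I_eq_smul hy
        (fun h => rootVector_ne_zero α ((map_eq_zero_iff φ.symm φ.symm.injective).mp h)) h2)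
  obtain ⟨h7, h8⟩ := h6 (complexTheta θ) fun x => by
    rw [complexTheta_lie, hzθ]
  refine ⟨l, ⟨H, q, hC, ⟨h1, h2⟩, h3, h7, h8⟩, h5 x ?_, h4⟩
  change ⁅φ (Complex.I ⊗ₜ[ℝ] y), x⁆ = 0
  rw [hIy, map_smul, cplx_smul_lie, hx, smul_zero]

/-- A proper `θ`-stable Levi subalgebra is centralized by an element of `𝔨` of nonzero norm. -/
theorem IsThetaStableLevi.exists_central {l : LieSubalgebra ℂ (ℂ ⊗[ℝ] L₀)}
    (h : IsThetaStableLevi θ l) (hl : l ≠ ⊤) :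
    ∃ z ∈ kSpace θ, (∀ x ∈ l, ⁅z, x⁆ = 0) ∧ killingForm ℂ (ℂ ⊗[ℝ] L₀) z z ≠ 0 := by
  obtain ⟨H, q, hC, ⟨h1, b, hb⟩, h3, h4, h5⟩ := h
  obtain ⟨z, hz, hzl, hzz⟩ := exists_central_of_levi h1 b
    (fun α hα => (rootSpace_le_iff α).mp (hb α hα)) h3 hl (thetaEquiv θ hθ.involutive)
    (complexTheta_complexTheta hθ.involutive) h4 h5
  exact ⟨z, mem_kSpace.mpr hz, hzl, hzz⟩

/-- The nilpositive element of a KS-triple is noticed if and only if its centralizer in `𝔨₀` is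
trivial. -/
theorem IsKSTriple.isNoticed_iff {h e f : ℂ ⊗[ℝ] L₀} (t : IsKSTriple θ h e f) :
    IsNoticed θ e ↔ ¬ HasCompactCentralizer θ e := by
  constructor
  · rintro hn ⟨y, hy0, hy, hye⟩
    obtain ⟨l, hl, hel, hlt⟩ := hθ.exists_thetaStableLevi hy hy0 LieEquiv.refl (fun _ => rfl) hye
    exact hlt (hn.minimal l hl hel)
  · intro hc
    refine ⟨t.e_mem, isNilpotent_ad_of_isSl2Triple ℂ t.sl2, fun l hl hel => ?_⟩
    by_contra hlt
    obtain ⟨z, hz, hzl, hzz⟩ := hl.exists_central hθ hlt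
    exact hzz (t.killingForm_self_eq_zero hθ hc hz (by
      have := hzl e hel
      have h2 : ⁅e, z⁆ = -⁅z, e⁆ := (lie_skew _ _).symm
      rw [h2, this, neg_zero]))

/-- If an element of the `K`-orbit of the nilpositive element of a KS-triple is noticed, then so is
the nilpositive element. -/
theorem IsKSTriple.isNoticed_of_orbit {h e f x : ℂ ⊗[ℝ] L₀} (t : IsKSTriple θ h e f)
    (hx : IsNoticed θ x) (hO : kOrbit θ e = kOrbit θ x) : IsNoticed θ e := by
  rw [t.isNoticed_iff hθ]
  rintro ⟨y, hy0, hy, hye⟩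
  have hxe : x ∈ kOrbit θ e := hO ▸ MulAction.mem_orbit_self x
  obtain ⟨⟨φ, hφ⟩, rfl⟩ := hxe
  obtain ⟨l, hl, hel, hlt⟩ := hθ.exists_thetaStableLevi hy hy0 (lieEquivOfAdGroup hφ)
    (x := φ e) (fun w => by
      simp only [lieEquivOfAdGroup_apply]
      refine adGroup_apply_comm (complexTheta θ) (fun s hs w => ?_) hφ w
      rw [complexTheta_lie, mem_kSpace.mp hs])
    (by
      rw [lieEquivOfAdGroup_apply, ← adGroup_apply_lie hφ, hye, map_zero])
  exact hlt (hx.minimal l hl hel)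

end FundamentalCartan

/-! ### Diagram involutions of root systems -/

section DiagramInvolution

open RootPairing

variable {ι R M N : Type*} [Finite ι] [Field R] [CharZero R] [AddCommGroup M] [Module R M]
  [AddCommGroup N] [Module R N] {P : RootPairing ι R M N} [P.IsCrystallographic] [P.IsReduced]

/-- An involution of a root system preserving a base. -/
structure IsDiagramInvolution (b : P.Base) (τ : ι → ι) : Prop where
  involutive : ∀ i, τ (τ i) = i
  root_add : ∀ i j k, P.root k = P.root i + P.root j →
    P.root (τ k) = P.root (τ i) + P.root (τ j)
  pairingIn_eq : ∀ i j, P.pairingIn ℤ (τ i) (τ j) = P.pairingIn ℤ i j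
  mem_support : ∀ i ∈ b.support, τ i ∈ b.support

/-- A root is folded if it is the sum of a positive root and of the image of that root. -/
def IsFolded (b : P.Base) (τ : ι → ι) (k : ι) : Prop :=
  ∃ i, b.IsPos i ∧ P.root k = P.root i + P.root (τ i)

theorem pairingIn_of_root_eq_add {i j k : ι} (h : P.root k = P.root i + P.root j) (l : ι) :
    P.pairingIn ℤ k l = P.pairingIn ℤ i l + P.pairingIn ℤ j l := by
  have := P.pairing_eq_add_of_root_eq_add (l := l) h
  simp only [← P.algebraMap_pairingIn ℤ] at this
  exact_mod_cast this

theorem pairingIn_of_coroot_eq_add {i j k : ι} (h : P.coroot k = P.coroot i + P.coroot j) (l : ι) :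
    P.pairingIn ℤ l k = P.pairingIn ℤ l i + P.pairingIn ℤ l j := by
  have : P.pairing l k = P.pairing l i + P.pairing l j := by
    simp only [← root_coroot_eq_pairing, h, map_add]
  simp only [← P.algebraMap_pairingIn ℤ] at this
  exact_mod_cast this

theorem root_ne_neg_of_isPos {b : P.Base} {i j : ι} (hi : b.IsPos i) (hj : b.IsPos j) :
    P.root i ≠ -P.root j := by
  let := P.indexNeg
  intro h
  have h1 : i = -j := P.root.injective (by simpa using h)
  rw [h1, Base.IsPos.neg_iff_not] at hi
  exact hi hj

namespace IsDiagramInvolution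

variable {b : P.Base} {τ : ι → ι} (hτ : IsDiagramInvolution b τ)
include hτ

theorem height_eq {i : ι} (hi : b.IsPos i) : b.height (τ i) = b.height i := by
  refine hi.induction_on_add (p := fun i => b.height (τ i) = b.height i) (fun j hj => ?_)
    fun j k l h h1 hk => ?_
  · rw [b.height_one_of_mem_support hj, b.height_one_of_mem_support (hτ.mem_support j hj)]
  · rw [b.height_add (hτ.root_add _ _ _ h), b.height_add h, h1,
      b.height_one_of_mem_support hk, b.height_one_of_mem_support (hτ.mem_support k hk)]

theorem isPos {i : ι} (hi : b.IsPos i) : b.IsPos (τ i) := by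
  rw [Base.isPos_iff, hτ.height_eq hi]; exact hi

theorem pairingIn_comm {i : ι} : P.pairingIn ℤ (τ i) i = P.pairingIn ℤ i (τ i) := by
  rw [← hτ.pairingIn_eq (τ i) i, hτ.involutive]

theorem isFixed_of_root_eq {i k : ι} (h : P.root k = P.root i + P.root (τ i)) : τ k = k := by
  apply P.root.injective
  rw [hτ.root_add _ _ _ h, h, hτ.involutive, add_comm]

theorem root_sub_notMem {i : ι} (hi : b.IsPos i) (k : ι) : P.root k ≠ P.root i - P.root (τ i) := by
  intro h
  have := b.height_sub h
  rw [hτ.height_eq hi, sub_self] at this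
  exact b.height_ne_zero k this

theorem pairingIn_eq_neg_one {i k : ι} (hi : b.IsPos i) (h : P.root k = P.root i + P.root (τ i)) :
    P.pairingIn ℤ i (τ i) = -1 := by
  have : IsAddTorsionFree M := .of_isTorsionFree R M
  have hne : i ≠ τ i := fun h0 => by
    rw [← h0, ← two_smul R] at h
    exact P.nsmul_notMem_range_root (n := 2) (i := i) ⟨k, by rw [h, two_smul, two_smul]⟩
  have h1 := P.pairingIn_pairingIn_mem_set_of_isCrystal_of_isRed' i (τ i)
    (fun h0 => hne (P.root.injective h0)) (root_ne_neg_of_isPos hi (hτ.isPos hi))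
  have h2 := hτ.pairingIn_comm (i := i)
  have h3 : ¬ 0 < P.pairingIn ℤ i (τ i) := fun h3 => by
    obtain ⟨l, hl⟩ := P.root_sub_root_mem_of_pairingIn_pos h3 hne
    exact hτ.root_sub_notMem hi l hl
  have h4 : P.pairingIn ℤ i (τ i) ≠ 0 := fun h4 => by
    have h5 := P.root_reflectionPerm (τ i) k
    rw [P.reflection_apply_root' ℤ, pairingIn_of_root_eq_add h, h4, P.pairingIn_same, h] at h5
    refine hτ.root_sub_notMem hi _ (h5.trans ?_)
    rw [zero_add, two_smul]; abel
  rw [h2] at h1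
  simp only [Set.mem_insert_iff, Set.mem_singleton_iff, Prod.mk.injEq] at h1
  omega

theorem coroot_eq_add {i k : ι} (hi : b.IsPos i) (h : P.root k = P.root i + P.root (τ i)) :
    P.coroot k = P.coroot i + P.coroot (τ i) := by
  have h1 := hτ.pairingIn_eq_neg_one hi h
  have h2 : k = P.reflectionPerm i (τ i) := by
    apply P.root.injective
    rw [P.root_reflectionPerm, P.reflection_apply_root' ℤ, hτ.pairingIn_comm, h1, h]
    simp [add_comm]
  have h3 : P.pairing i (τ i) = -1 := by rw [← P.algebraMap_pairingIn ℤ, h1]; simp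
  rw [h2, P.coroot_reflectionPerm, P.coreflection_apply_coroot, h3]
  simp [add_comm]

/-- A fixed root is orthogonal to every folded root which is not proportional to it. -/
theorem pairingIn_eq_zero {i j k : ι} (hi : b.IsPos i) (h : P.root k = P.root i + P.root (τ i))
    (hj : τ j = j) (h1 : P.root j ≠ P.root k) (h2 : P.root j ≠ -P.root k) :
    P.pairingIn ℤ j k = 0 := by
  have h3 := pairingIn_of_coroot_eq_add (hτ.coroot_eq_add hi h) j
  have h4 := pairingIn_of_root_eq_add h j
  have h5 : P.pairingIn ℤ j (τ i) = P.pairingIn ℤ j i := by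
    rw [← hτ.pairingIn_eq j (τ i), hτ.involutive, hj]
  have h6 : P.pairingIn ℤ (τ i) j = P.pairingIn ℤ i j := by
    rw [← hτ.pairingIn_eq (τ i) j, hτ.involutive, hj]
  have h7 := P.pairingIn_pairingIn_mem_set_of_isCrystal_of_isRed' j k h1 h2
  simp only [Set.mem_insert_iff, Set.mem_singleton_iff, Prod.mk.injEq] at h7
  omega

/-- Induction over the fixed positive roots which are not folded. -/
theorem fixed_induction {p : ι → Prop} (h_simple : ∀ i ∈ b.support, τ i = i → p i)
    (h_fixed : ∀ i j k, P.root k = P.root j + P.root i → i ∈ b.support → τ i = i → b.IsPos j →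
      τ j = j → p j → p k)
    (h_pair : ∀ i j k l, P.root l = P.root j + P.root (τ i) → P.root k = P.root l + P.root i →
      i ∈ b.support → τ i ≠ i → (∀ m, P.root m ≠ P.root i + P.root (τ i)) →
      b.IsPos j → τ j = j → p j → p k)
    {k : ι} (hk : b.IsPos k) (hkτ : τ k = k) (hkf : ¬ IsFolded b τ k) : p k := by
  have : IsAddTorsionFree M := .of_isTorsionFree R M
  obtain ⟨n, hn⟩ : ∃ n : ℕ, b.height k ≤ n := ⟨(b.height k).toNat, Int.self_le_toNat _⟩
  induction n generalizing k with
  | zero => exact absurd hk (by rw [Base.isPos_iff]; omega)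
  | succ n ih =>
    obtain ⟨i, hi, hik⟩ := hk.exists_mem_support_pos_pairingIn
    have hki : 0 < P.pairingIn ℤ k i := (P.zero_lt_pairingIn_iff' ℤ).mp hik
    have hipos := b.isPos_of_mem_support hi
    by_cases hki0 : k = i
    · subst hki0; exact h_simple k hi hkτ
    obtain ⟨j, hj⟩ := P.root_sub_root_mem_of_pairingIn_pos hki hki0
    have hjpos : b.IsPos j := hk.sub hi hj
    have hjh := b.height_sub hj
    rw [b.height_one_of_mem_support hi] at hjh
    have hkj : P.root k = P.root j + P.root i := by rw [hj]; abel
    by_cases hτi : τ i = i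
    · have hτj : τ j = j := by
        apply P.root.injective
        have := hτ.root_add _ _ _ hkj
        rw [hkτ, hτi, hkj] at this
        exact (add_right_cancel this).symm
      refine h_fixed i j k hkj hi hτi hjpos hτj (ih hjpos hτj ?_ (by omega))
      rintro ⟨γ, hγ, hγj⟩
      have h1 : P.pairingIn ℤ k j = 0 := hτ.pairingIn_eq_zero hγ hγj hkτ
        (fun h => P.ne_zero i (by rw [hkj] at h; simpa using h)) (root_ne_neg_of_isPos hk hjpos)
      have h2 : P.pairingIn ℤ i j = 0 := hτ.pairingIn_eq_zero hγ hγj hτi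
        (fun h => P.nsmul_notMem_range_root (n := 2) (i := i) ⟨k, by rw [hkj, ← h, two_smul]⟩)
        (root_ne_neg_of_isPos hipos hjpos)
      rw [pairingIn_of_root_eq_add hkj, h2, P.pairingIn_same] at h1
      omega
    · have hτis := hτ.mem_support i hi
      have hkτi : P.pairingIn ℤ k (τ i) = P.pairingIn ℤ k i := by
        rw [← hτ.pairingIn_eq k (τ i), hτ.involutive, hkτ]
      by_cases hsum : ∃ m, P.root m = P.root i + P.root (τ i)
      · exfalso
        obtain ⟨m, hm⟩ := hsum
        have hmpos : b.IsPos m := hipos.add (hτ.isPos hipos) hm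
        by_cases hkm : P.root k = P.root m
        · exact hkf ⟨i, hipos, hkm.trans hm⟩
        have h1 := hτ.pairingIn_eq_zero hipos hm hkτ hkm (root_ne_neg_of_isPos hk hmpos)
        rw [pairingIn_of_coroot_eq_add (hτ.coroot_eq_add hipos hm), hkτi] at h1
        omega
      · push Not at hsum
        have h0 : P.pairingIn ℤ i (τ i) = 0 := by
          refine le_antisymm (b.pairingIn_le_zero_of_ne (Ne.symm hτi) hi hτis) ?_
          by_contra! hlt
          obtain ⟨m, hm⟩ := P.root_add_root_mem_of_pairingIn_neg hlt
            (root_ne_neg_of_isPos hipos (hτ.isPos hipos))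
          exact hsum m hm
        have hjτi : 0 < P.pairingIn ℤ j (τ i) := by
          have := pairingIn_of_root_eq_add hkj (τ i)
          omega
        have hjne : j ≠ τ i := fun h => hsum k (by rw [hkj, h, add_comm])
        obtain ⟨d, hd⟩ := P.root_sub_root_mem_of_pairingIn_pos hjτi hjne
        have hdpos : b.IsPos d := hjpos.sub hτis hd
        have hdh := b.height_sub hd
        rw [b.height_one_of_mem_support hτis] at hdh
        have hjd : P.root j = P.root d + P.root (τ i) := by rw [hd]; abel
        have hτd : τ d = d := by
          apply P.root.injective
          have h1 := hτ.root_add _ _ _ hkj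
          rw [hτ.root_add _ _ _ hjd, hτ.involutive, hkτ, hkj, hjd] at h1
          have h2 : P.root d + (P.root (τ i) + P.root i) =
            P.root (τ d) + (P.root (τ i) + P.root i) := by rw [← add_assoc, h1]; abel
          exact (add_right_cancel h2).symm
        refine h_pair i d k j hjd hkj hi hτi hsum hdpos hτd (ih hdpos hτd ?_ (by omega))
        rintro ⟨γ, hγ, hγd⟩
        have hkd : P.root k = P.root d + P.root (τ i) + P.root i := by rw [hkj, hjd]
        have h1 : P.pairingIn ℤ k d = 0 := hτ.pairingIn_eq_zero hγ hγd hkτ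
          (fun h => root_ne_neg_of_isPos hipos (hτ.isPos hipos) (by
            rw [hkd, add_assoc] at h
            have := add_eq_left.mp h
            exact eq_neg_of_add_eq_zero_right this)) (root_ne_neg_of_isPos hk hdpos)
        have h2 : P.pairingIn ℤ (τ i) d = P.pairingIn ℤ i d := by
          rw [← hτ.pairingIn_eq (τ i) d, hτ.involutive, hτd]
        rw [pairingIn_of_root_eq_add hkj, pairingIn_of_root_eq_add hjd, P.pairingIn_same, h2] at h1
        have h3 := pairingIn_of_coroot_eq_add (hτ.coroot_eq_add hγ hγd) i
        have h4 : ∃ γ', b.IsPos γ' ∧ P.root d = P.root γ' + P.root (τ γ') ∧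
            P.pairingIn ℤ i γ' < 0 := by
          by_cases h5 : P.pairingIn ℤ i γ < 0
          · exact ⟨γ, hγ, hγd, h5⟩
          · exact ⟨τ γ, hτ.isPos hγ, by rw [hγd, hτ.involutive, add_comm], by omega⟩
        obtain ⟨γ', hγ', hγd', hneg⟩ := h4
        obtain ⟨m, hm⟩ := P.root_add_root_mem_of_pairingIn_neg hneg
          (root_ne_neg_of_isPos hipos hγ')
        refine hkf ⟨m, hipos.add hγ' hm, ?_⟩
        rw [hτ.root_add _ _ _ hm, hm, hkd, hγd']
        abel

end IsDiagramInvolution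

end DiagramInvolution

/-! ### The action of an involution on roots and root vectors -/

section Twist

open Module LieAlgebra LieAlgebra.IsKilling LieModule

variable {L : Type*} [LieRing L] [LieAlgebra ℂ L] [FiniteDimensional ℂ L] [IsKilling ℂ L]
  {H : LieSubalgebra ℂ L} [H.IsCartanSubalgebra]

/-- The bracket of two root spaces is nonzero if the sum of the roots is a root. -/
theorem lie_rootVector_ne_zero {α β γ : H.root}
    (h : (rootSystem H).root γ = (rootSystem H).root α + (rootSystem H).root β) :
    ⁅rootVector α, rootVector β⁆ ≠ 0 := by
  have hα := H.isNonZero_coe_root α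
  have hsum : ((γ : Weight ℂ H L) : H → ℂ) = (α : Weight ℂ H L) + (β : Weight ℂ H L) := by
    ext z; exact LinearMap.congr_fun h z
  set q := chainTopCoeff (α : Weight ℂ H L) (β : Weight ℂ H L) with hq
  have hq1 : 1 ≤ q := by
    by_contra! h0
    have h1 := genWeightSpace_chainTopCoeff_add_one_nsmul_add
      (α : Weight ℂ H L) (β : Weight ℂ H L) hα
    rw [← hq, show q = 0 by omega, zero_add, one_smul, ← hsum] at h1
    exact (γ : Weight ℂ H L).2 h1
  obtain ⟨hh, e, f, t, he, hf⟩ := exists_isSl2Triple_of_weight_isNonZero hα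
  obtain rfl := t.h_eq_coroot hα he hf
  obtain ⟨x, hx, hx0⟩ := (chainTop (α : Weight ℂ H L) (β : Weight ℂ H L)).exists_ne_zero
  have prim : t.HasPrimitiveVectorWith x
      (chainLength (α : Weight ℂ H L) (β : Weight ℂ H L) : ℂ) :=
    have := lie_mem_genWeightSpace_of_mem_genWeightSpace he hx
    ⟨hx0, (chainLength_smul _ _ hx).symm, by rwa [genWeightSpace_add_chainTop _ _ hα] at this⟩
  have hle := chainTopCoeff_le_chainLength (α : Weight ℂ H L) (β : Weight ℂ H L)
  rw [← hq] at hle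
  have hne := fun n hn => prim.pow_toEnd_f_ne_zero_of_eq_nat rfl (i := n) hn
  have hmem : ((toEnd ℂ L L f) ^ q) x ∈ rootSpace H (β : Weight ℂ H L) := by
    have := toEnd_pow_apply_mem hf hx q
    rwa [coe_chainTop, ← hq, smul_neg, natCast_zsmul, neg_add_cancel_left] at this
  obtain ⟨c, hc⟩ := exists_eq_smul_rootVector β hmem
  obtain ⟨d, hd⟩ := exists_eq_smul_rootVector α he
  have h3 := prim.lie_e_pow_succ_toEnd_f (q - 1)
  rw [Nat.sub_add_cancel hq1, hc, hd] at h3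
  intro h0
  rw [lie_smul, smul_lie, h0, smul_zero, smul_zero] at h3
  refine (smul_ne_zero (mul_ne_zero ?_ ?_) (hne (q - 1) (by omega))) h3.symm
  · exact_mod_cast (by omega : q - 1 + 1 ≠ 0)
  · rw [sub_ne_zero]
    exact_mod_cast (by omega : chainLength (α : Weight ℂ H L) (β : Weight ℂ H L) ≠ q - 1)

theorem lie_mem_rootSpace {α β γ : H.root}
    (h : (rootSystem H).root γ = (rootSystem H).root α + (rootSystem H).root β) {x y : L}
    (hx : x ∈ rootSpace H (α : Weight ℂ H L)) (hy : y ∈ rootSpace H (β : Weight ℂ H L)) :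
    ⁅x, y⁆ ∈ rootSpace H (γ : Weight ℂ H L) := by
  have hsum : ((γ : Weight ℂ H L) : H → ℂ) = (α : Weight ℂ H L) + (β : Weight ℂ H L) := by
    ext z; exact LinearMap.congr_fun h z
  rw [hsum]
  exact lie_mem_genWeightSpace_of_mem_genWeightSpace hx hy

theorem lie_ne_zero_of_root_add {α β γ : H.root}
    (h : (rootSystem H).root γ = (rootSystem H).root α + (rootSystem H).root β) {x y : L}
    (hx : x ∈ rootSpace H (α : Weight ℂ H L)) (hy : y ∈ rootSpace H (β : Weight ℂ H L))
    (hx0 : x ≠ 0) (hy0 : y ≠ 0) : ⁅x, y⁆ ≠ 0 := by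
  obtain ⟨c, rfl⟩ := exists_eq_smul_rootVector α hx
  obtain ⟨d, rfl⟩ := exists_eq_smul_rootVector β hy
  rw [lie_smul, smul_lie]
  exact smul_ne_zero (left_ne_zero_of_smul hy0)
    (smul_ne_zero (left_ne_zero_of_smul hx0) (lie_rootVector_ne_zero h))

/-- If the sum of two roots is neither zero nor a root then the root vectors commute. -/
theorem lie_rootVector_eq_zero {α β : H.root}
    (h : ∀ γ, (rootSystem H).root γ ≠ (rootSystem H).root α + (rootSystem H).root β)
    (h0 : (rootSystem H).root α + (rootSystem H).root β ≠ 0) :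
    ⁅rootVector α, rootVector β⁆ = 0 := by
  have hmem := lie_mem_genWeightSpace_of_mem_genWeightSpace (rootVector_mem α) (rootVector_mem β)
  by_contra hne
  have hbot : genWeightSpace L ((α : Weight ℂ H L) + (β : Weight ℂ H L) : H → ℂ) ≠ ⊥ := fun hb => by
    rw [hb] at hmem; exact hne (by simpa using hmem)
  let χ : Weight ℂ H L := ⟨_, hbot⟩
  have hχ : χ.toLinear = (rootSystem H).root α + (rootSystem H).root β := by
    ext z; rfl
  have hχ0 : χ.IsNonZero := fun hz => h0 (by
    rw [← hχ]; ext z; exact congrFun hz z)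
  exact h ⟨χ, by simpa using hχ0⟩ hχ

variable (S : L ≃ₗ⁅ℂ⁆ L) (hS : ∀ x, S (S x) = x) (hSH : ∀ x ∈ H, S x ∈ H)

include hS in
theorem map_mem_rootSpace {χ : H → ℂ} {x : L} (hx : x ∈ rootSpace H χ) :
    S x ∈ rootSpace H (fun z => χ ⟨S z, hSH z z.2⟩) := by
  rw [mem_rootSpace_iff] at hx ⊢
  intro z
  have := hx ⟨S z, hSH z z.2⟩
  rw [← map_smul, ← this, LieEquiv.map_lie, hS]

/-- The action of an involution on the roots. -/
def twist (α : H.root) : H.root :=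
  ⟨⟨fun z => (α : Weight ℂ H L) ⟨S z, hSH z z.2⟩, fun h => by
    have h1 := map_mem_rootSpace S hS hSH (rootVector_mem α)
    rw [rootSpace, h, LieSubmodule.mem_bot] at h1
    exact rootVector_ne_zero α ((map_eq_zero_iff S S.injective).mp h1)⟩, by
    simp only [Finset.mem_filter, Finset.mem_univ, true_and]
    intro h
    refine H.isNonZero_coe_root α ?_
    ext z
    have := congrFun h ⟨S z, hSH z z.2⟩
    simpa [hS] using this⟩

@[simp] theorem twist_apply (α : H.root) (z : H) :
    (twist S hS hSH α : Weight ℂ H L) z = (α : Weight ℂ H L) ⟨S z, hSH z z.2⟩ := rfl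

@[simp] theorem twist_twist (α : H.root) : twist S hS hSH (twist S hS hSH α) = α := by
  ext z; simp [hS]

theorem eq_twist_of_forall {α β : H.root}
    (h : ∀ z : H, (β : Weight ℂ H L) z = (α : Weight ℂ H L) ⟨S z, hSH z z.2⟩) :
    β = twist S hS hSH α := by
  ext z; exact h z

theorem root_twist_add {α β γ : H.root}
    (h : (rootSystem H).root γ = (rootSystem H).root α + (rootSystem H).root β) :
    (rootSystem H).root (twist S hS hSH γ) =
      (rootSystem H).root (twist S hS hSH α) + (rootSystem H).root (twist S hS hSH β) := by
  ext z
  exact LinearMap.congr_fun h ⟨S z, hSH z z.2⟩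

theorem coroot_twist (α : H.root) :
    ((coroot (twist S hS hSH α : Weight ℂ H L) : H) : L) = S (coroot (α : Weight ℂ H L) : H) := by
  have ht : (cartanEquivDual H).symm (twist S hS hSH α : Weight ℂ H L) =
      ⟨S ((cartanEquivDual H).symm (α : Weight ℂ H L) : H), hSH _ (SetLike.coe_mem _)⟩ := by
    rw [LinearEquiv.symm_apply_eq]
    ext z
    have h1 : (twist S hS hSH α : Weight ℂ H L) z = killingForm ℂ L
        (S ((cartanEquivDual H).symm (α : Weight ℂ H L) : H)) z := by
      rw [twist_apply, ← killingForm_cartanEquivDual_symm, ← killingForm_of_equiv_apply S, hS]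
    exact h1
  rw [coroot, coroot, ht, twist_apply]
  simp only [hS, Subtype.coe_eta]
  have h2 : ∀ (c : ℂ) (t : H), ((2 • c • (⟨S t, hSH t t.2⟩ : H) : H) : L) =
      S ((2 • c • t : H) : L) := fun c t => by
    change 2 • c • S (t : L) = S (2 • c • (t : L))
    rw [map_nsmul, map_smul]
  exact h2 _ _

theorem pairingIn_twist (α β : H.root) :
    (rootSystem H).pairingIn ℤ (twist S hS hSH α) (twist S hS hSH β) =
      (rootSystem H).pairingIn ℤ α β := by
  have : (rootSystem H).pairing (twist S hS hSH α) (twist S hS hSH β) =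
      (rootSystem H).pairing α β := by
    rw [rootSystem_pairing_apply, rootSystem_pairing_apply, twist_apply]
    congr 1
    apply Subtype.ext
    change S (coroot (twist S hS hSH β : Weight ℂ H L) : H) = _
    rw [coroot_twist, hS]
  simp only [← (rootSystem H).algebraMap_pairingIn ℤ] at this
  exact_mod_cast this

theorem isDiagramInvolution_twist {b : (rootSystem H).Base}
    (hb : ∀ α ∈ b.support, twist S hS hSH α ∈ b.support) :
    IsDiagramInvolution b (twist S hS hSH) where
  involutive := twist_twist S hS hSH
  root_add _ _ _ h := root_twist_add S hS hSH h
  pairingIn_eq := pairingIn_twist S hS hSH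
  mem_support := hb

theorem exists_twistCoeff (α : H.root) :
    ∃ c : ℂ, S (rootVector α) = c • rootVector (twist S hS hSH α) :=
  exists_eq_smul_rootVector _ (map_mem_rootSpace S hS hSH (rootVector_mem α))

/-- The coefficient of the action of an involution on a root vector. -/
def twistCoeff (α : H.root) : ℂ := (exists_twistCoeff S hS hSH α).choose

theorem map_rootVector (α : H.root) :
    S (rootVector α) = twistCoeff S hS hSH α • rootVector (twist S hS hSH α) :=
  (exists_twistCoeff S hS hSH α).choose_spec

theorem twistCoeff_eq_of_map {α : H.root} (hα : twist S hS hSH α = α) {x : L} (hx0 : x ≠ 0)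
    (hx : x ∈ rootSpace H (α : Weight ℂ H L)) {c : ℂ} (h : S x = c • x) :
    twistCoeff S hS hSH α = c := by
  obtain ⟨d, rfl⟩ := exists_eq_smul_rootVector α hx
  rw [map_smul, map_rootVector S hS hSH, hα, smul_smul, smul_smul, mul_comm] at h
  have := smul_left_injective ℂ (rootVector_ne_zero α) h
  exact mul_right_cancel₀ (left_ne_zero_of_smul hx0) this

theorem map_of_twist_eq {α : H.root} (hα : twist S hS hSH α = α) {x : L}
    (hx : x ∈ rootSpace H (α : Weight ℂ H L)) : S x = twistCoeff S hS hSH α • x := by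
  obtain ⟨d, rfl⟩ := exists_eq_smul_rootVector α hx
  rw [map_smul, map_rootVector S hS hSH, hα, smul_comm]

theorem twistCoeff_mul (α : H.root) :
    twistCoeff S hS hSH α * twistCoeff S hS hSH (twist S hS hSH α) = 1 := by
  have h1 := hS (rootVector α)
  rw [map_rootVector S hS hSH, map_smul, map_rootVector S hS hSH, twist_twist, smul_smul] at h1
  have : (twistCoeff S hS hSH α * twistCoeff S hS hSH (twist S hS hSH α)) • rootVector α =
    (1 : ℂ) • rootVector α := by rw [h1, one_smul]
  exact smul_left_injective ℂ (rootVector_ne_zero α) this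

theorem twistCoeff_eq_or {α : H.root} (hα : twist S hS hSH α = α) :
    twistCoeff S hS hSH α = 1 ∨ twistCoeff S hS hSH α = -1 := by
  have := twistCoeff_mul S hS hSH α
  rw [hα] at this
  exact mul_self_eq_one_iff.mp this

variable {b : (rootSystem H).Base}
  (hb : ∀ α ∈ b.support, twist S hS hSH α ∈ b.support)

/-- The involution acts by `-1` on the root spaces of folded roots. -/
theorem twistCoeff_of_isFolded {α : H.root} (hα : twist S hS hSH α = α)
    (h : IsFolded b (twist S hS hSH) α) : twistCoeff S hS hSH α = -1 := by
  obtain ⟨γ, -, hγ⟩ := h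
  refine twistCoeff_eq_of_map S hS hSH hα (lie_rootVector_ne_zero hγ)
    (lie_mem_rootSpace hγ (rootVector_mem _) (rootVector_mem _)) ?_
  rw [LieEquiv.map_lie, map_rootVector S hS hSH, map_rootVector S hS hSH (twist S hS hSH γ),
    twist_twist, lie_smul, smul_lie, smul_smul, mul_comm, twistCoeff_mul, ← lie_skew, neg_one_smul,
    one_smul]

include hb in
/-- The action of the involution on the root spaces of fixed roots which are not folded. -/
theorem twistCoeff_of_not_isFolded (p : H.root → ℤ)
    (hp : ∀ α β γ, (rootSystem H).root γ = (rootSystem H).root α + (rootSystem H).root β →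
      p γ = p α + p β)
    (hp_fixed : ∀ α ∈ b.support, twist S hS hSH α = α →
      twistCoeff S hS hSH α = (-1) ^ p α)
    (hp_pair : ∀ α ∈ b.support, twist S hS hSH α ≠ α → p α = 0) {α : H.root} (hα : b.IsPos α)
    (hατ : twist S hS hSH α = α) (hf : ¬ IsFolded b (twist S hS hSH) α) :
    twistCoeff S hS hSH α = (-1) ^ p α := by
  have hτ := isDiagramInvolution_twist S hS hSH hb
  have h1 : (-1 : ℂ) ≠ 0 := by norm_num
  have key := hτ.fixed_induction
    (p := fun α => twist S hS hSH α = α → twistCoeff S hS hSH α = (-1) ^ p α)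
    (fun i hi hiτ _ => hp_fixed i hi hiτ) ?_ ?_ hα hατ hf
  · exact key hατ
  · intro i j k hk hi hiτ hj hjτ h hkτ
    rw [hp _ _ _ hk, zpow_add₀ h1, ← h hjτ, ← hp_fixed i hi hiτ]
    refine twistCoeff_eq_of_map S hS hSH hkτ (lie_rootVector_ne_zero hk)
      (lie_mem_rootSpace hk (rootVector_mem _) (rootVector_mem _)) ?_
    rw [LieEquiv.map_lie, map_of_twist_eq S hS hSH hjτ (rootVector_mem j),
      map_of_twist_eq S hS hSH hiτ (rootVector_mem i), lie_smul, smul_lie, smul_smul, mul_comm]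
  · intro i j k l hl hk hi hiτ hsum hj hjτ h hkτ
    have hτi := hb i hi
    have hiτ' : twist S hS hSH (twist S hS hSH i) ≠ twist S hS hSH i := fun h0 => hiτ (by
      rw [twist_twist] at h0; exact h0.symm)
    rw [hp _ _ _ hk, hp _ _ _ hl, hp_pair i hi hiτ, hp_pair _ hτi hiτ', add_zero, add_zero,
      ← h hjτ]
    have hl' := lie_mem_rootSpace hl (rootVector_mem j) (rootVector_mem _)
    have hl0 := lie_rootVector_ne_zero hl
    have hcomm : ⁅rootVector (twist S hS hSH i), rootVector i⁆ = 0 := by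
      refine lie_rootVector_eq_zero (fun m hm => hsum m (by rw [hm, add_comm])) fun h0 => ?_
      exact root_ne_neg_of_isPos (b.isPos_of_mem_support hτi) (b.isPos_of_mem_support hi)
        (eq_neg_of_add_eq_zero_left h0)
    refine twistCoeff_eq_of_map S hS hSH hkτ
      (lie_ne_zero_of_root_add hk hl' (rootVector_mem i) hl0 (rootVector_ne_zero i))
      (lie_mem_rootSpace hk hl' (rootVector_mem i)) ?_
    rw [LieEquiv.map_lie, LieEquiv.map_lie, map_of_twist_eq S hS hSH hjτ (rootVector_mem j),
      map_rootVector S hS hSH i, map_rootVector S hS hSH (twist S hS hSH i), twist_twist]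
    have h2 := twistCoeff_mul S hS hSH i
    have h3 : ⁅⁅rootVector j, rootVector i⁆, rootVector (twist S hS hSH i)⁆ =
        ⁅⁅rootVector j, rootVector (twist S hS hSH i)⁆, rootVector i⁆ := by
      rw [lie_lie, ← lie_skew (rootVector i), hcomm, neg_zero, lie_zero, zero_sub, lie_skew]
    simp only [lie_smul, smul_lie, smul_smul]
    rw [h3]
    congr 1
    linear_combination (twistCoeff S hS hSH j) * h2

end Twist

/-! ### Dimensions of eigenspaces of an involution -/

section Dimension

open Module

variable {K V : Type*} [Field K] [CharZero K] [AddCommGroup V] [Module K V] [FiniteDimensional K V]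

theorem two_mul_finrank_involution (T : V →ₗ[K] V) (hT : ∀ x, T (T x) = x) {ε : K}
    (hε : ε * ε = 1) (W : Submodule K V) (hW : ∀ x, x ∈ W ↔ T x = ε • x) :
    (2 : K) * finrank K W = finrank K V + ε * LinearMap.trace K V T := by
  have hproj : LinearMap.IsProj W ((2⁻¹ : K) • (LinearMap.id + ε • T)) := by
    constructor
    · intro x
      rw [hW]
      simp only [LinearMap.smul_apply, LinearMap.add_apply, LinearMap.id_apply, map_smul, map_add,
        hT, smul_add]
      simp only [smul_smul]
      rw [show ε * (2⁻¹ * ε) = 2⁻¹ by linear_combination 2⁻¹ * hε, mul_comm, add_comm]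
    · intro x hx
      rw [hW] at hx
      simp only [LinearMap.smul_apply, LinearMap.add_apply, LinearMap.id_apply, hx]
      rw [smul_smul, hε, one_smul, ← two_smul K, smul_smul, inv_mul_cancel₀ two_ne_zero, one_smul]
  have h1 := hproj.trace
  rw [map_smul, map_add, map_smul, LinearMap.trace_id, smul_eq_mul, smul_eq_mul] at h1
  rw [← h1]
  ring

theorem two_mul_finrank_eigenspace {κ : Type*} [Fintype κ] [DecidableEq κ] [DecidableEq K]
    (𝔅 : Basis κ K V) (w : κ → K) {A T : V →ₗ[K] V} (hA : ∀ k, A (𝔅 k) = w k • 𝔅 k)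
    (hT : ∀ x, T (T x) = x) (hTA : ∀ x, T (A x) = A (T x)) {ε : K} (hε : ε * ε = 1) (μ : K)
    (W : Submodule K V) (hW : ∀ x, x ∈ W ↔ T x = ε • x ∧ A x = μ • x) :
    (2 : K) * finrank K W = ∑ k with w k = μ, (1 + ε * 𝔅.repr (T (𝔅 k)) k) := by
  set E := diagSpan 𝔅 w (· = μ) with hE
  have hEm : ∀ x, x ∈ E ↔ A x = μ • x := fun x => mem_diagSpan_eq_iff hA
  have hTE : ∀ x ∈ E, T x ∈ E := fun x hx => map_mem_diagSpan hA hTA hx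
  let s : Finset κ := Finset.univ.filter fun k => w k = μ
  have hEs : E = Submodule.span K (𝔅 '' s) := by rw [hE, diagSpan]; simp [s]
  have h1 := two_mul_finrank_involution (T.restrict hTE) (fun x => Subtype.ext (hT x)) hε
    (W.comap E.subtype) fun x => by
      rw [Submodule.mem_comap, hW, Subtype.ext_iff]
      exact and_iff_left ((hEm x).mp x.2)
  have hWE : W ≤ E := fun x hx => (hEm x).mpr ((hW x).mp hx).2
  rw [(Submodule.comapSubtypeEquivOfLe hWE).finrank_eq, trace_restrict_span 𝔅 s T E hEs hTE] at h1
  have h2 : finrank K E = s.card := by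
    have : LinearIndependent K fun k : s => 𝔅 k :=
      𝔅.linearIndependent.comp _ Subtype.val_injective
    have h3 := finrank_span_eq_card this
    rw [hEs, ← Fintype.card_coe, ← h3]
    rw [Set.image_eq_range]
    rfl
  rw [h1, h2, Finset.sum_add_distrib, ← Finset.mul_sum]
  simp [s]

end Dimension

section EigenDimension

open Module LieAlgebra LieAlgebra.IsKilling LieModule

variable {L : Type*} [LieRing L] [LieAlgebra ℂ L] [FiniteDimensional ℂ L] [IsKilling ℂ L]
  {H : LieSubalgebra ℂ L} [H.IsCartanSubalgebra]
  (S : L ≃ₗ⁅ℂ⁆ L) (hS : ∀ x, S (S x) = x) (hSH : ∀ x ∈ H, S x ∈ H)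

theorem twist_negRoot (α : H.root) :
    twist S hS hSH (negRoot α) = negRoot (twist S hS hSH α) := rfl

theorem twistCoeff_negRoot {α : H.root} (hα : twist S hS hSH α = α) :
    twistCoeff S hS hSH (negRoot α) = twistCoeff S hS hSH α := by
  have hα' : twist S hS hSH (negRoot α) = negRoot α := by rw [twist_negRoot, hα]
  have h0 : killingForm ℂ L (rootVector α) (rootVector (negRoot α)) ≠ 0 := fun h0 => by
    have h1 := mem_ker_killingForm_of_mem_rootSpace_of_forall_rootSpace_neg ℂ L H
      (rootVector_mem α) fun y hy => by
        obtain ⟨c, rfl⟩ := exists_eq_smul_rootVector (negRoot α) hy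
        rw [map_smul, h0, smul_zero]
    rw [ker_killingForm_eq_bot, Submodule.mem_bot] at h1
    exact rootVector_ne_zero α h1
  have h2 := killingForm_of_equiv_apply S (rootVector α) (rootVector (negRoot α))
  rw [map_rootVector S hS hSH, map_rootVector S hS hSH, hα, hα', map_smul, map_smul,
    LinearMap.smul_apply, smul_eq_mul, smul_eq_mul] at h2
  have h3 : twistCoeff S hS hSH (negRoot α) * twistCoeff S hS hSH α = 1 := by
    refine mul_right_cancel₀ h0 ?_
    linear_combination h2
  rcases twistCoeff_eq_or S hS hSH hα with h | h <;> rw [h] at h3 ⊢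
  · linear_combination h3
  · linear_combination -h3

variable {b : (rootSystem H).Base}

open Classical in
theorem repr_rootBasis_inl (hb : ∀ α ∈ b.support, twist S hS hSH α ∈ b.support) (i : b.support) :
    (rootBasis b).repr (S (rootBasis b (Sum.inl i))) (Sum.inl i) =
      if twist S hS hSH i = i then 1 else 0 := by
  have h1 : S (rootBasis b (Sum.inl i)) = rootBasis b (Sum.inl ⟨twist S hS hSH i, hb i i.2⟩) := by
    rw [rootBasis_inl, rootBasis_inl, coroot_twist]
  rw [h1, Basis.repr_self, Finsupp.single_apply]
  refine if_congr ?_ rfl rfl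
  rw [Sum.inl.injEq]
  exact Subtype.ext_iff

open Classical in
theorem repr_rootBasis_inr (α : H.root) :
    (rootBasis b).repr (S (rootBasis b (Sum.inr α))) (Sum.inr α) =
      if twist S hS hSH α = α then twistCoeff S hS hSH α else 0 := by
  rw [rootBasis_inr, map_rootVector S hS hSH, ← rootBasis_inr b, map_smul, Basis.repr_self,
    Finsupp.smul_apply, Finsupp.single_apply]
  by_cases h : twist S hS hSH α = α <;> simp [h]

/-- The fixed positive roots of given value at `z` on whose root spaces the involution acts by
`ε`. -/
def fixedRoots (b : (rootSystem H).Base) (z : H) (μ ε : ℂ) : Set H.root :=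
  {α | b.IsPos α ∧ (α : Weight ℂ H L) z = μ ∧ twist S hS hSH α = α ∧ twistCoeff S hS hSH α = ε}

/-- The positive roots of given value at `z` which are not fixed. -/
def movedRoots (b : (rootSystem H).Base) (z : H) (μ : ℂ) : Set H.root :=
  {α | b.IsPos α ∧ (α : Weight ℂ H L) z = μ ∧ twist S hS hSH α ≠ α}

open Classical in
theorem sum_pos_eq (b : (rootSystem H).Base) (z : H) (μ : ℂ) {ε : ℂ} (hε : ε = 1 ∨ ε = -1) :
    ∑ α ∈ Finset.univ.filter (fun α : H.root => (α : Weight ℂ H L) z = μ ∧ b.IsPos α),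
      (1 + ε * if twist S hS hSH α = α then twistCoeff S hS hSH α else 0) =
    2 * (fixedRoots S hS hSH b z μ ε).ncard + (movedRoots S hS hSH b z μ).ncard := by
  have h1 : ∀ α : H.root, (1 + ε * if twist S hS hSH α = α then twistCoeff S hS hSH α else 0) =
      2 * (if twist S hS hSH α = α ∧ twistCoeff S hS hSH α = ε then 1 else 0) +
        (if twist S hS hSH α ≠ α then 1 else 0) := by
    intro α
    by_cases h : twist S hS hSH α = α
    · rcases twistCoeff_eq_or S hS hSH h with h2 | h2 <;> rcases hε with rfl | rfl <;>
        simp [h, h2] <;> norm_num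
    · simp [h]
  rw [Finset.sum_congr rfl fun α _ => h1 α, Finset.sum_add_distrib, ← Finset.mul_sum,
    Finset.sum_boole, Finset.sum_boole, Finset.filter_filter, Finset.filter_filter]
  congr 2
  · rw [← Set.ncard_coe_finset]
    congr 2
    ext α
    simp [fixedRoots]; tauto
  · rw [← Set.ncard_coe_finset]
    congr 1
    ext α
    simp [movedRoots]; tauto

theorem two_mul_finrank_zero (hb : ∀ α ∈ b.support, twist S hS hSH α ∈ b.support) (z : H)
    (hz : S z = z) (W : Submodule ℂ L) (hW : ∀ x, x ∈ W ↔ S x = x ∧ ⁅(z : L), x⁆ = 0) :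
    2 * finrank ℂ W = b.support.card + {i : b.support | twist S hS hSH i = i}.ncard +
      4 * (fixedRoots S hS hSH b z 0 1).ncard + 2 * (movedRoots S hS hSH b z 0).ncard := by
  classical
  have h1 := two_mul_finrank_eigenspace (rootBasis b) (rootBasisWeight b z) (A := ad ℂ L z)
    (T := (S : L →ₗ[ℂ] L)) (lie_rootBasis b z) hS (fun x => by
      change S ⁅(z : L), x⁆ = ⁅(z : L), S x⁆
      rw [LieEquiv.map_lie, hz]) (mul_one (1 : ℂ)) 0 W (fun x => by
        rw [hW, one_smul, zero_smul]; rfl)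
  have h2 : ∑ α ∈ Finset.univ.filter (fun α : H.root => (α : Weight ℂ H L) z = 0),
      (1 + 1 * if twist S hS hSH α = α then twistCoeff S hS hSH α else 0) =
      2 * (2 * (fixedRoots S hS hSH b z 0 1).ncard + (movedRoots S hS hSH b z 0).ncard : ℂ) := by
    rw [← Finset.sum_filter_add_sum_filter_not _ (fun α => b.IsPos α), Finset.filter_filter,
      Finset.filter_filter, sum_pos_eq S hS hSH b z 0 (Or.inl rfl), two_mul (_ + _), add_right_inj]
    rw [← sum_pos_eq S hS hSH b z 0 (Or.inl rfl)]
    refine Finset.sum_bij' (fun α _ => negRoot α) (fun α _ => negRoot α) ?_ ?_ ?_ ?_ ?_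
    · intro α hα
      simp only [Finset.mem_filter, Finset.mem_univ, true_and, coe_negRoot, Weight.coe_neg,
        Pi.neg_apply, neg_eq_zero] at hα ⊢
      exact ⟨hα.1, (isPos_or_isPos_negRoot b α).resolve_left hα.2⟩
    · intro α hα
      simp only [Finset.mem_filter, Finset.mem_univ, true_and, coe_negRoot, Weight.coe_neg,
        Pi.neg_apply, neg_eq_zero] at hα ⊢
      exact ⟨hα.1, not_isPos_negRoot b hα.2⟩
    · intro α _; simp
    · intro α _; simp
    · intro α _
      by_cases h : twist S hS hSH α = α
      · simp [h, twist_negRoot, twistCoeff_negRoot]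
      · have h' : twist S hS hSH (negRoot α) ≠ negRoot α := fun h0 => h (by
          rw [twist_negRoot] at h0
          have := congrArg negRoot h0
          simpa using this)
        simp [h, h']
  rw [Finset.sum_filter, Fintype.sum_sum_type] at h1
  simp only [rootBasisWeight, Sum.elim_inl, Sum.elim_inr, if_true] at h1
  have h3 : ∀ α : H.root, (rootBasis b).repr ((S : L →ₗ[ℂ] L) (rootBasis b (Sum.inr α)))
      (Sum.inr α) = if twist S hS hSH α = α then twistCoeff S hS hSH α else 0 :=
    fun α => repr_rootBasis_inr S hS hSH α
  have h4 : ∀ i : b.support, (rootBasis b).repr ((S : L →ₗ[ℂ] L) (rootBasis b (Sum.inl i)))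
      (Sum.inl i) = if twist S hS hSH i = i then 1 else 0 :=
    fun i => repr_rootBasis_inl S hS hSH hb i
  simp only [h3, h4] at h1
  replace h1 := h1.trans (congrArg _ (Finset.sum_filter (s := Finset.univ)
    (fun α : H.root => (α : Weight ℂ H L) z = 0)
    (fun α => 1 + 1 * if twist S hS hSH α = α then twistCoeff S hS hSH α else 0)).symm)
  rw [h2, Finset.sum_add_distrib, ← Finset.mul_sum, Finset.sum_boole, Finset.sum_const,
    Finset.card_univ, Fintype.card_coe] at h1
  have h5 : (Finset.univ.filter fun i : b.support => twist S hS hSH i = i).card =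
      {i : b.support | twist S hS hSH i = i}.ncard := by
    rw [← Set.ncard_coe_finset]; simp
  rw [h5] at h1
  have h6 : ((2 * finrank ℂ W : ℕ) : ℂ) = ((b.support.card +
      {i : b.support | twist S hS hSH i = i}.ncard + 4 * (fixedRoots S hS hSH b z 0 1).ncard +
      2 * (movedRoots S hS hSH b z 0).ncard : ℕ) : ℂ) := by
    push_cast
    rw [h1]
    simp only [nsmul_eq_mul]
    ring
  exact_mod_cast h6

theorem two_mul_finrank_two (z : H) (hz : S z = z)
    (hpos : ∀ α : H.root, (α : Weight ℂ H L) z = 2 → b.IsPos α)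
    (W : Submodule ℂ L) (hW : ∀ x, x ∈ W ↔ S x = -x ∧ ⁅(z : L), x⁆ = (2 : ℂ) • x) :
    2 * finrank ℂ W = 2 * (fixedRoots S hS hSH b z 2 (-1)).ncard +
      (movedRoots S hS hSH b z 2).ncard := by
  classical
  have h1 := two_mul_finrank_eigenspace (rootBasis b) (rootBasisWeight b z) (A := ad ℂ L z)
    (T := (S : L →ₗ[ℂ] L)) (lie_rootBasis b z) hS (fun x => by
      change S ⁅(z : L), x⁆ = ⁅(z : L), S x⁆
      rw [LieEquiv.map_lie, hz]) (ε := -1) (by norm_num) 2 W (fun x => by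
        rw [hW, neg_one_smul]; rfl)
  rw [Finset.sum_filter, Fintype.sum_sum_type] at h1
  simp only [rootBasisWeight, Sum.elim_inl, Sum.elim_inr, (two_ne_zero (α := ℂ)).symm, if_false,
    Finset.sum_const_zero, zero_add] at h1
  have h3 : ∀ α : H.root, (rootBasis b).repr ((S : L →ₗ[ℂ] L) (rootBasis b (Sum.inr α)))
      (Sum.inr α) = if twist S hS hSH α = α then twistCoeff S hS hSH α else 0 :=
    fun α => repr_rootBasis_inr S hS hSH α
  simp only [h3] at h1
  replace h1 := h1.trans (Finset.sum_filter (s := Finset.univ)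
    (fun α : H.root => (α : Weight ℂ H L) z = 2)
    (fun α => 1 + -1 * if twist S hS hSH α = α then twistCoeff S hS hSH α else 0)).symm
  have h4 : (Finset.univ.filter fun α : H.root => (α : Weight ℂ H L) z = 2) =
      Finset.univ.filter fun α : H.root => (α : Weight ℂ H L) z = 2 ∧ b.IsPos α := by
    ext α
    simp only [Finset.mem_filter, Finset.mem_univ, true_and]
    exact ⟨fun h => ⟨h, hpos α h⟩, fun h => h.1⟩
  rw [h4, sum_pos_eq S hS hSH b z 2 (Or.inr rfl)] at h1
  exact_mod_cast h1

end EigenDimension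

/-! ### Coordinates of roots with respect to a base -/

section Coordinates

open RootPairing

variable {ι R M N : Type*} [Finite ι] [Field R] [CharZero R] [AddCommGroup M] [Module R M]
  [AddCommGroup N] [Module R N] {P : RootPairing ι R M N} [P.IsCrystallographic] [P.IsReduced]
  {b : P.Base} {n : ℕ} (α : Fin n ≃ b.support)

theorem exists_coord (j : ι) : ∃ c : Fin n → ℤ, P.root j = ∑ i, c i • P.root (α i) := by
  obtain ⟨c, -, -, h⟩ := b.exists_root_eq_sum_int j
  refine ⟨fun i => c (α i), ?_⟩
  rw [h, ← Finset.sum_coe_sort, ← α.sum_comp]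

/-- The coordinates of a root with respect to a numbered base. -/
def coord (j : ι) : Fin n → ℤ := (exists_coord α j).choose

theorem root_eq_sum_coord (j : ι) : P.root j = ∑ i, coord α j i • P.root (α i) :=
  (exists_coord α j).choose_spec

theorem sum_smul_root_injective {c d : Fin n → ℤ}
    (h : ∑ i, c i • P.root (α i) = ∑ i, d i • P.root (α i)) : c = d := by
  have h1 : LinearIndependent ℤ fun i => P.root (α i) :=
    (b.linearIndepOn_root.restrict_scalars' ℤ).comp α α.injective
  exact funext (Fintype.linearIndependent_iffₛ.mp h1 c d h)

theorem coord_eq_of_root_eq {j : ι} {c : Fin n → ℤ} (h : P.root j = ∑ i, c i • P.root (α i)) :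
    coord α j = c :=
  sum_smul_root_injective α ((root_eq_sum_coord α j).symm.trans h)

theorem coord_injective : Function.Injective (coord α) := fun j k h => by
  apply P.root.injective
  rw [root_eq_sum_coord α j, h, ← root_eq_sum_coord]

theorem coord_simple (i : Fin n) : coord α (α i : ι) = Pi.single i 1 := by
  apply coord_eq_of_root_eq
  simp [Pi.single_apply, ite_smul]

theorem coord_add {j k l : ι} (h : P.root l = P.root j + P.root k) :
    coord α l = coord α j + coord α k := by
  apply coord_eq_of_root_eq
  rw [h, root_eq_sum_coord α j, root_eq_sum_coord α k]
  simp [add_smul, Finset.sum_add_distrib]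

theorem root_eq_add_of_coord {j k l : ι} (h : coord α l = coord α j + coord α k) :
    P.root l = P.root j + P.root k := by
  rw [root_eq_sum_coord α j, root_eq_sum_coord α k, root_eq_sum_coord α l, h]
  simp [add_smul, Finset.sum_add_distrib]

theorem coord_neg {j k : ι} (h : P.root k = -P.root j) : coord α k = -coord α j := by
  apply coord_eq_of_root_eq
  rw [h, root_eq_sum_coord α j]
  simp

theorem coord_nonneg_iff (j : ι) : (∀ i, 0 ≤ coord α j i) ↔ b.IsPos j := by
  have h1 : ∀ j, b.IsPos j → ∀ i, 0 ≤ coord α j i := fun j hj =>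
    hj.induction_on_add (p := fun j => ∀ i, 0 ≤ coord α j i)
      (fun k hk i => by
        obtain ⟨m, hm⟩ := α.surjective ⟨k, hk⟩
        rw [show k = (α m : ι) by rw [hm], coord_simple, Pi.single_apply]
        split_ifs <;> simp)
      fun j k l h hj hk i => by
        obtain ⟨m, hm⟩ := α.surjective ⟨k, hk⟩
        rw [coord_add α h, show k = (α m : ι) by rw [hm], coord_simple, Pi.add_apply,
          Pi.single_apply]
        have := hj i
        split_ifs <;> linarith
  refine ⟨fun h => ?_, h1 j⟩
  let := P.indexNeg
  rcases Base.IsPos.or_neg b j with hj | hj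
  · exact hj
  · have h2 := h1 _ hj
    rw [coord_neg α (show P.root (-j) = -P.root j by simp)] at h2
    have h3 : coord α j = 0 := funext fun i => le_antisymm (by simpa using h2 i) (h i)
    refine absurd (root_eq_sum_coord α j) ?_
    rw [h3]
    simpa using P.ne_zero j

theorem pairingIn_eq_sum_coord (j k : ι) :
    P.pairingIn ℤ j k = ∑ i, coord α j i * P.pairingIn ℤ (α i) k := by
  have : P.pairing j k = ∑ i, coord α j i * P.pairing (α i) k := by
    simp only [← root_coroot_eq_pairing]
    rw [root_eq_sum_coord α j]
    simp
  simp only [← P.algebraMap_pairingIn ℤ, eq_intCast] at this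
  exact_mod_cast this

theorem coord_reflectionPerm (i : Fin n) (j : ι) :
    coord α (P.reflectionPerm (α i) j) =
      coord α j - Pi.single i (P.pairingIn ℤ j (α i)) := by
  apply coord_eq_of_root_eq
  rw [P.root_reflectionPerm, P.reflection_apply_root' ℤ, root_eq_sum_coord α j]
  simp [sub_smul, Finset.sum_sub_distrib, Pi.single_apply, ite_smul]

theorem isRoot_iff (Γ : WeightedVoganDiagram n)
    (hΓ : ∀ i j, Γ.cartan i j = b.cartanMatrix (α i) (α j)) (v : Fin n → ℤ) :
    Γ.IsRoot v ↔ ∃ j, v = coord α j := by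
  have h2 : ∀ i j, ∑ k, coord α j k * Γ.cartan k i = P.pairingIn ℤ j (α i) := fun i j => by
    rw [pairingIn_eq_sum_coord α]
    exact Finset.sum_congr rfl fun k _ => by rw [hΓ]; rfl
  constructor
  · intro hv
    induction hv with
    | simple i => exact ⟨α i, (coord_simple α i).symm⟩
    | reflect i v _ ih =>
      obtain ⟨j, rfl⟩ := ih
      exact ⟨P.reflectionPerm (α i) j, by rw [coord_reflectionPerm, h2]⟩
  · rintro ⟨j, rfl⟩
    have hneg : ∀ v, Γ.IsRoot v → Γ.IsRoot (-v) := fun v hv => by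
      induction hv with
      | simple i =>
        have := WeightedVoganDiagram.IsRoot.reflect i _ (.simple (Γ := Γ) i)
        convert this using 1
        ext k
        simp [Pi.single_apply, Γ.cartan_diag]
        split_ifs <;> simp
      | reflect i v _ ih =>
        have := WeightedVoganDiagram.IsRoot.reflect i _ ih
        convert this using 1
        ext k
        simp [Pi.single_apply]
        split_ifs
        · ring
        · simp
    refine b.induction_reflect j (p := fun j => Γ.IsRoot (coord α j)) (fun k hk => ?_)
      (fun k hk => ?_) fun k l hk hl => ?_
    · rw [coord_neg α (show P.root (P.reflectionPerm k k) = -P.root k by simp)]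
      exact hneg _ hk
    · obtain ⟨m, hm⟩ := α.surjective ⟨k, hk⟩
      rw [show k = (α m : ι) by rw [hm], coord_simple]
      exact .simple m
    · obtain ⟨m, hm⟩ := α.surjective ⟨l, hl⟩
      rw [show l = (α m : ι) by rw [hm], coord_reflectionPerm, ← h2]
      exact .reflect m _ hk

theorem mem_posRoots_iff (Γ : WeightedVoganDiagram n)
    (hΓ : ∀ i j, Γ.cartan i j = b.cartanMatrix (α i) (α j)) (v : Fin n → ℤ) :
    v ∈ Γ.posRoots ↔ ∃ j, b.IsPos j ∧ v = coord α j := by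
  constructor
  · rintro ⟨h1, h2⟩
    obtain ⟨j, rfl⟩ := (isRoot_iff α Γ hΓ v).mp h1
    exact ⟨j, (coord_nonneg_iff α j).mp h2, rfl⟩
  · rintro ⟨j, hj, rfl⟩
    exact ⟨(isRoot_iff α Γ hΓ _).mpr ⟨j, rfl⟩, (coord_nonneg_iff α j).mpr hj⟩

theorem thetaRoot_coord (Γ : WeightedVoganDiagram n) {τ : ι → ι}
    (hτ : IsDiagramInvolution b τ) (hα : ∀ i, τ (α i) = α (Γ.theta i)) {j : ι}
    (hj : b.IsPos j) : Γ.thetaRoot (coord α j) = coord α (τ j) := by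
  have h1 : ∀ k ∈ b.support, Γ.thetaRoot (coord α k) = coord α (τ k) := fun k hk => by
    obtain ⟨m, hm⟩ := α.surjective ⟨k, hk⟩
    rw [show k = (α m : ι) by rw [hm], hα, coord_simple, coord_simple]
    ext i
    simp only [WeightedVoganDiagram.thetaRoot, Pi.single_apply, Equiv.symm_apply_eq]
  refine hj.induction_on_add (p := fun j => Γ.thetaRoot (coord α j) = coord α (τ j)) h1
    fun i k l h hi hk => ?_
  rw [coord_add α h, coord_add α (hτ.root_add _ _ _ h), ← hi, ← h1 k hk]
  rfl

end Coordinates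

section Pairs

/-- The set of unordered pairs swapped by an involution without fixed points has half the size. -/
theorem two_mul_ncard_image_pair {ι κ : Type*} {s : Set ι} (hs : s.Finite) (g : ι → κ)
    (hg : Function.Injective g) (τ : ι → ι) (hτs : ∀ i ∈ s, τ i ∈ s) (hττ : ∀ i, τ (τ i) = i)
    (hne : ∀ i ∈ s, τ i ≠ i) :
    2 * ((fun i => ({g i, g (τ i)} : Set κ)) '' s).ncard = s.ncard := by
  classical
  have := hs.fintype
  have h1 : ∀ i j, ({g j, g (τ j)} : Set κ) = {g i, g (τ i)} ↔ j = i ∨ j = τ i := fun i j => by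
    rw [Set.pair_eq_pair_iff, hg.eq_iff, hg.eq_iff, hg.eq_iff, hg.eq_iff]
    constructor
    · rintro (h | h) <;> tauto
    · rintro (rfl | rfl)
      · exact Or.inl ⟨rfl, rfl⟩
      · exact Or.inr ⟨rfl, hττ i⟩
  have h2 := Finset.card_eq_sum_card_image (fun i => ({g i, g (τ i)} : Set κ)) s.toFinset
  rw [Set.ncard_eq_toFinset_card' s, h2, Finset.sum_const_nat (m := 2), mul_comm,
    ← Set.ncard_coe_finset, Finset.coe_image, Set.coe_toFinset]
  intro x hx
  obtain ⟨i, hi, rfl⟩ := Finset.mem_image.mp hx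
  rw [Set.mem_toFinset] at hi
  rw [← Finset.card_pair (hne i hi).symm]
  congr 1
  ext j
  simp only [Finset.mem_filter, Set.mem_toFinset, Finset.mem_insert, Finset.mem_singleton, h1]
  refine ⟨fun h => h.2, fun h => ⟨?_, h⟩⟩
  rcases h with rfl | rfl
  · exact hi
  · exact hτs i hi

end Pairs

/-! ### Counting roots of a diagram -/

section Counting

open Module LieAlgebra LieAlgebra.IsKilling LieModule

variable {L : Type*} [LieRing L] [LieAlgebra ℂ L] [FiniteDimensional ℂ L] [IsKilling ℂ L]
  {H : LieSubalgebra ℂ L} [H.IsCartanSubalgebra]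
  (S : L ≃ₗ⁅ℂ⁆ L) (hS : ∀ x, S (S x) = x) (hSH : ∀ x ∈ H, S x ∈ H)
  {b : (rootSystem H).Base} {n : ℕ} (α : Fin n ≃ b.support) (Γ : WeightedVoganDiagram n)
  (z : H)

/-- The diagram `Γ` describes the base `b`, the action of the involution and the values at `z`. -/
structure IsDiagramOf : Prop where
  cartan_eq : ∀ i j, Γ.cartan i j = b.cartanMatrix (α i) (α j)
  twist_eq : ∀ i, twist S hS hSH (α i) = α (Γ.theta i)
  mem_painted : ∀ i, i ∈ Γ.painted ↔ Γ.theta i = i ∧ twistCoeff S hS hSH (α i) = -1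
  weight_eq : ∀ i, ((α i : H.root) : Weight ℂ H L) z = Γ.weight i

theorem paintedLength_add (v w : Fin n → ℤ) :
    Γ.paintedLength (v + w) = Γ.paintedLength v + Γ.paintedLength w := by
  simp [WeightedVoganDiagram.paintedLength, Finset.sum_add_distrib]

theorem paintedLength_thetaRoot (v : Fin n → ℤ) :
    Γ.paintedLength (Γ.thetaRoot v) = Γ.paintedLength v := by
  classical
  refine Finset.sum_congr rfl fun i hi => ?_
  have := Γ.theta_of_painted i (Finset.mem_filter.mp hi).2
  rw [WeightedVoganDiagram.thetaRoot, (Equiv.symm_apply_eq _).mpr this.symm]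

theorem rootWeight_add (v w : Fin n → ℤ) :
    Γ.rootWeight (v + w) = Γ.rootWeight v + Γ.rootWeight w := by
  simp [WeightedVoganDiagram.rootWeight, Finset.sum_add_distrib, add_mul]

theorem rootWeight_thetaRoot (v : Fin n → ℤ) :
    Γ.rootWeight (Γ.thetaRoot v) = Γ.rootWeight v := by
  simp only [WeightedVoganDiagram.rootWeight, WeightedVoganDiagram.thetaRoot]
  rw [← Equiv.sum_comp Γ.theta fun i => v (Γ.theta.symm i) * (Γ.weight i : ℤ)]
  simp [Γ.weight_theta]

namespace IsDiagramOf

variable {S hS hSH α Γ z} (hD : IsDiagramOf S hS hSH α Γ z)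
include hD

theorem twist_mem_support : ∀ β ∈ b.support, twist S hS hSH β ∈ b.support := fun β hβ => by
  obtain ⟨i, hi⟩ := α.surjective ⟨β, hβ⟩
  rw [show β = (α i : H.root) by rw [hi], hD.twist_eq]
  exact (α _).2

theorem isDiagramInvolution : IsDiagramInvolution b (twist S hS hSH) :=
  isDiagramInvolution_twist S hS hSH hD.twist_mem_support

theorem mem_posRoots_iff (v : Fin n → ℤ) : v ∈ Γ.posRoots ↔ ∃ β, b.IsPos β ∧ v = coord α β :=
  NoticedOrbits.mem_posRoots_iff α Γ hD.cartan_eq v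

theorem thetaRoot_coord {β : H.root} (hβ : b.IsPos β) :
    Γ.thetaRoot (coord α β) = coord α (twist S hS hSH β) :=
  NoticedOrbits.thetaRoot_coord α Γ hD.isDiagramInvolution hD.twist_eq hβ

theorem thetaRoot_coord_eq_iff {β : H.root} (hβ : b.IsPos β) :
    Γ.thetaRoot (coord α β) = coord α β ↔ twist S hS hSH β = β := by
  rw [hD.thetaRoot_coord hβ, (coord_injective α).eq_iff]

theorem rootWeight_coord (β : H.root) :
    ((Γ.rootWeight (coord α β) : ℤ) : ℂ) = (β : Weight ℂ H L) z := by
  have h1 : (β : Weight ℂ H L) z = (rootSystem H).root β z := rfl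
  rw [h1, root_eq_sum_coord α β, WeightedVoganDiagram.rootWeight]
  rw [LinearMap.sum_apply]
  push_cast
  refine Finset.sum_congr rfl fun i _ => ?_
  rw [LinearMap.smul_apply, zsmul_eq_mul]
  congr 1
  exact (hD.weight_eq i).symm

theorem rootWeight_coord_eq_iff (β : H.root) (j : ℤ) :
    Γ.rootWeight (coord α β) = j ↔ (β : Weight ℂ H L) z = j := by
  rw [← hD.rootWeight_coord, Int.cast_inj]

theorem isFolded_iff (β : H.root) : IsFolded b (twist S hS hSH) β ↔
    ∃ γ ∈ Γ.posRoots, coord α β = γ + Γ.thetaRoot γ := by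
  constructor
  · rintro ⟨γ, hγ, h⟩
    refine ⟨coord α γ, (hD.mem_posRoots_iff _).mpr ⟨γ, hγ, rfl⟩, ?_⟩
    rw [hD.thetaRoot_coord hγ, coord_add α h]
  · rintro ⟨v, hv, h⟩
    obtain ⟨γ, hγ, rfl⟩ := (hD.mem_posRoots_iff _).mp hv
    rw [hD.thetaRoot_coord hγ] at h
    exact ⟨γ, hγ, root_eq_add_of_coord α h⟩

theorem even_paintedLength {β : H.root} (h : IsFolded b (twist S hS hSH) β) :
    Even (Γ.paintedLength (coord α β)) := by
  obtain ⟨γ, -, h⟩ := (hD.isFolded_iff β).mp h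
  rw [h, paintedLength_add, paintedLength_thetaRoot]
  exact ⟨_, rfl⟩

theorem twistCoeff_eq {β : H.root} (hβ : b.IsPos β) (hβτ : twist S hS hSH β = β)
    (hf : ¬ IsFolded b (twist S hS hSH) β) :
    twistCoeff S hS hSH β = (-1) ^ Γ.paintedLength (coord α β) := by
  classical
  have h1 : ∀ i, Γ.paintedLength (coord α (α i : H.root)) = if i ∈ Γ.painted then 1 else 0 :=
    fun i => by
      rw [coord_simple, WeightedVoganDiagram.paintedLength]
      simp [Pi.single_apply]
  refine twistCoeff_of_not_isFolded S hS hSH hD.twist_mem_support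
    (fun β => Γ.paintedLength (coord α β)) (fun β γ δ h => ?_) (fun γ hγ hγτ => ?_)
    (fun γ hγ hγτ => ?_) hβ hβτ hf
  · rw [coord_add α h, paintedLength_add]
  · obtain ⟨i, hi⟩ := α.surjective ⟨γ, hγ⟩
    obtain rfl : γ = (α i : H.root) := by rw [hi]
    have hθ : Γ.theta i = i := by
      rw [hD.twist_eq] at hγτ
      exact α.injective (Subtype.ext hγτ)
    simp only [h1]
    by_cases hp : i ∈ Γ.painted
    · rw [if_pos hp, zpow_one, ((hD.mem_painted i).mp hp).2]
    · rw [if_neg hp, zpow_zero]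
      exact (twistCoeff_eq_or S hS hSH hγτ).resolve_right fun h =>
        hp ((hD.mem_painted i).mpr ⟨hθ, h⟩)
  · obtain ⟨i, hi⟩ := α.surjective ⟨γ, hγ⟩
    obtain rfl : γ = (α i : H.root) := by rw [hi]
    simp only [h1]
    rw [if_neg]
    intro hp
    apply hγτ
    rw [hD.twist_eq, Γ.theta_of_painted i hp]

theorem pNonpainted_eq (j : ℤ) :
    Γ.pNonpainted j = coord α '' fixedRoots S hS hSH b z j 1 := by
  ext v
  constructor
  · rintro ⟨hv, hj, hθ, hp, hf⟩
    obtain ⟨β, hβ, rfl⟩ := (hD.mem_posRoots_iff _).mp hv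
    have hβτ := (hD.thetaRoot_coord_eq_iff hβ).mp hθ
    rw [← hD.isFolded_iff] at hf
    exact ⟨β, ⟨hβ, (hD.rootWeight_coord_eq_iff β j).mp hj, hβτ, by
      rw [hD.twistCoeff_eq hβ hβτ hf, hp.neg_one_zpow]⟩, rfl⟩
  · rintro ⟨β, ⟨hβ, hj, hβτ, hc⟩, rfl⟩
    have h1 : ¬ IsFolded b (twist S hS hSH) β := fun h => by
      rw [twistCoeff_of_isFolded S hS hSH hβτ h] at hc
      norm_num at hc
    refine ⟨(hD.mem_posRoots_iff _).mpr ⟨β, hβ, rfl⟩, (hD.rootWeight_coord_eq_iff β j).mpr hj,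
      (hD.thetaRoot_coord_eq_iff hβ).mpr hβτ, ?_, by rwa [← hD.isFolded_iff]⟩
    by_contra h2
    rw [hD.twistCoeff_eq hβ hβτ h1, (Int.not_even_iff_odd.mp h2).neg_one_zpow] at hc
    norm_num at hc

theorem pPainted_eq (j : ℤ) :
    Γ.pPainted j = coord α '' fixedRoots S hS hSH b z j (-1) := by
  ext v
  constructor
  · rintro (⟨hv, hj, hθ, hp⟩ | ⟨hv, γ, hγ, rfl, hj⟩)
    · obtain ⟨β, hβ, rfl⟩ := (hD.mem_posRoots_iff _).mp hv
      have hβτ := (hD.thetaRoot_coord_eq_iff hβ).mp hθ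
      refine ⟨β, ⟨hβ, (hD.rootWeight_coord_eq_iff β j).mp hj, hβτ, ?_⟩, rfl⟩
      rw [hD.twistCoeff_eq hβ hβτ fun h => Int.not_even_iff_odd.mpr hp (hD.even_paintedLength h),
        hp.neg_one_zpow]
    · obtain ⟨β, hβ, h⟩ := (hD.mem_posRoots_iff _).mp hv
      have hf := (hD.isFolded_iff β).mpr ⟨γ, hγ, h.symm⟩
      obtain ⟨δ, hδ, hδβ⟩ := id hf
      have hβτ := hD.isDiagramInvolution.isFixed_of_root_eq hδβ
      refine ⟨β, ⟨hβ, (hD.rootWeight_coord_eq_iff β j).mp ?_, hβτ,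
        twistCoeff_of_isFolded S hS hSH hβτ hf⟩, h.symm⟩
      rw [← h, rootWeight_add, rootWeight_thetaRoot, ← two_mul, hj]
  · rintro ⟨β, ⟨hβ, hj, hβτ, hc⟩, rfl⟩
    have hv := (hD.mem_posRoots_iff _).mpr ⟨β, hβ, rfl⟩
    have hj' := (hD.rootWeight_coord_eq_iff β j).mpr hj
    by_cases hf : IsFolded b (twist S hS hSH) β
    · obtain ⟨γ, hγ, h⟩ := (hD.isFolded_iff β).mp hf
      refine Or.inr ⟨hv, γ, hγ, h, ?_⟩
      rw [← hj', h, rootWeight_add, rootWeight_thetaRoot, ← two_mul]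
    · refine Or.inl ⟨hv, hj', (hD.thetaRoot_coord_eq_iff hβ).mpr hβτ, ?_⟩
      rw [← Int.not_even_iff_odd]
      intro h2
      rw [hD.twistCoeff_eq hβ hβτ hf, h2.neg_one_zpow] at hc
      norm_num at hc

theorem two_mul_ncard_kPairs (hz : S z = z) (j : ℤ) :
    2 * (Γ.kPairs j).ncard = (movedRoots S hS hSH b z j).ncard := by
  rw [← two_mul_ncard_image_pair (Set.toFinite _) (coord α) (coord_injective α) (twist S hS hSH)
    (fun β hβ => ?_) (twist_twist S hS hSH) fun β hβ => hβ.2.2]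
  · congr 2
    ext s
    constructor
    · rintro ⟨v, ⟨hv, hθ, hj⟩, rfl⟩
      obtain ⟨β, hβ, rfl⟩ := (hD.mem_posRoots_iff _).mp hv
      refine ⟨β, ⟨hβ, (hD.rootWeight_coord_eq_iff β j).mp hj, fun h =>
        hθ ((hD.thetaRoot_coord_eq_iff hβ).mpr h)⟩, ?_⟩
      simp only [hD.thetaRoot_coord hβ]
    · rintro ⟨β, ⟨hβ, hj, hθ⟩, rfl⟩
      refine ⟨coord α β, ⟨(hD.mem_posRoots_iff _).mpr ⟨β, hβ, rfl⟩, fun h =>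
        hθ ((hD.thetaRoot_coord_eq_iff hβ).mp h), (hD.rootWeight_coord_eq_iff β j).mpr hj⟩, ?_⟩
      simp only [hD.thetaRoot_coord hβ]
  · refine ⟨hD.isDiagramInvolution.isPos hβ.1, ?_, fun h => hβ.2.2 ?_⟩
    · rw [twist_apply, ← hβ.2.1]
      congr 1
      exact Subtype.ext hz
    · rw [twist_twist] at h
      exact h.symm

theorem numFixed_eq : Γ.numFixed = {i : b.support | twist S hS hSH i = i}.ncard := by
  rw [WeightedVoganDiagram.numFixed, ← Set.ncard_image_of_injective _ α.injective]
  congr 1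
  ext i
  obtain ⟨m, rfl⟩ := α.surjective i
  rw [α.injective.mem_set_image, Set.mem_ofPred_eq, Set.mem_ofPred_eq, hD.twist_eq,
    ← Subtype.ext_iff, α.injective.eq_iff]

omit hD in
theorem numFixed_add (Γ : WeightedVoganDiagram n) : Γ.numFixed + 2 * Γ.numPairs = n := by
  rw [WeightedVoganDiagram.numFixed, WeightedVoganDiagram.numPairs]
  rw [show (fun i => ({i, Γ.theta i} : Set (Fin n))) = fun i => {id i, id (Γ.theta i)} from rfl,
    two_mul_ncard_image_pair (s := {i | Γ.theta i ≠ i}) (Set.toFinite _) id Function.injective_id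
      Γ.theta (fun i hi h => hi (Γ.theta.injective h)) Γ.theta_theta fun i hi => hi]
  have := Set.ncard_add_ncard_compl {i | Γ.theta i = i}
  rwa [Nat.card_eq_fintype_card, Fintype.card_fin] at this

/-- The numerical criterion for a diagram to be noticed, in terms of dimensions. -/
theorem isNoticed_iff (hz : S z = z) (W₀ W₂ : Submodule ℂ L)
    (hW₀ : ∀ x, x ∈ W₀ ↔ S x = x ∧ ⁅(z : L), x⁆ = 0)
    (hW₂ : ∀ x, x ∈ W₂ ↔ S x = -x ∧ ⁅(z : L), x⁆ = (2 : ℂ) • x) :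
    Γ.IsNoticed ↔ finrank ℂ W₀ = finrank ℂ W₂ := by
  have hpos : ∀ β : H.root, (β : Weight ℂ H L) z = 2 → b.IsPos β := fun β hβ => by
    by_contra hn
    have h1 := (hD.rootWeight_coord_eq_iff β 2).mpr (by rw [hβ]; norm_num)
    have h2 : ∀ i, coord α β i ≤ 0 := fun i => by
      have := (coord_nonneg_iff α (negRoot β)).mpr ((isPos_or_isPos_negRoot b β).resolve_left hn) i
      rw [coord_neg α (root_negRoot β)] at this
      simpa using this
    have h3 : Γ.rootWeight (coord α β) ≤ 0 := Finset.sum_nonpos fun i _ =>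
      mul_nonpos_of_nonpos_of_nonneg (h2 i) (Int.natCast_nonneg _)
    omega
  have h0 := two_mul_finrank_zero S hS hSH hD.twist_mem_support z hz W₀ hW₀
  have h2 := two_mul_finrank_two S hS hSH z hz hpos W₂ hW₂
  have k0 := hD.two_mul_ncard_kPairs hz 0
  have k2 := hD.two_mul_ncard_kPairs hz 2
  have c0 : (Γ.pNonpainted 0).ncard = (fixedRoots S hS hSH b z 0 1).ncard := by
    rw [hD.pNonpainted_eq, Set.ncard_image_of_injective _ (coord_injective α), Int.cast_zero]
  have c2 : (Γ.pPainted 2).ncard = (fixedRoots S hS hSH b z 2 (-1)).ncard := by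
    rw [hD.pPainted_eq, Set.ncard_image_of_injective _ (coord_injective α), Int.cast_ofNat]
  have hn : b.support.card = n := by
    rw [← Fintype.card_coe, ← Fintype.card_congr α, Fintype.card_fin]
  have hf := numFixed_add Γ
  rw [← hD.numFixed_eq, hn, ← c0] at h0
  rw [← c2] at h2
  rw [Int.cast_zero] at k0
  rw [Int.cast_ofNat] at k2
  rw [WeightedVoganDiagram.IsNoticed]
  omega

end IsDiagramOf

end Counting

/-! ### Existence of diagrams -/

section FiniteType

open RootPairing

variable {ι M N : Type*} [Finite ι] [AddCommGroup M] [Module ℂ M] [AddCommGroup N] [Module ℂ N]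
  {P : RootPairing ι ℂ M N} [P.IsCrystallographic] [P.IsReduced] {b : P.Base}

omit [P.IsReduced] in
/-- The Cartan matrix of a root system is symmetrizable with positive definite symmetrization. -/
theorem exists_cartanMatrix_posDef [P.IsRootSystem] {n : ℕ} (α : Fin n ≃ b.support) :
    ∃ d : Fin n → ℝ, (∀ i, 0 < d i) ∧
      ((Matrix.of fun i j => (b.cartanMatrix (α i) (α j) : ℝ)) * Matrix.diagonal d).PosDef := by
  have := Fintype.ofFinite ι
  let A : Matrix ι (Fin n) ℝ := Matrix.of fun k i => (P.pairingIn ℤ (α i) k : ℝ)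
  have hAc : ∀ k i, ((A k i : ℝ) : ℂ) = P.pairing (α i) k := fun k i => by
    simp [A, ← P.algebraMap_pairingIn ℤ]
  have hA : Function.Injective A.mulVec := by
    rw [← Matrix.coe_mulVecLin, ← LinearMap.ker_eq_bot, LinearMap.ker_eq_bot']
    intro x hx
    have h1 : ∑ i, (x i : ℂ) • P.root (α i) = 0 := by
      have hk : ∀ k, P.toLinearMap (∑ i, (x i : ℂ) • P.root (α i)) (P.coroot k) = 0 := fun k => by
        have h2 : ∑ i, A k i * x i = 0 := congrFun hx k
        rw [map_sum, LinearMap.sum_apply]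
        simp only [map_smul, LinearMap.smul_apply, P.root_coroot_eq_pairing, ← hAc, smul_eq_mul]
        rw [← Complex.ofReal_zero, ← h2]
        push_cast
        exact Finset.sum_congr rfl fun i _ => mul_comm _ _
      apply (LinearMap.IsPerfPair.bijective_left P.toLinearMap).injective
      rw [map_zero]
      exact LinearMap.ext_on_range (RootPairing.IsRootSystem.span_coroot_eq_top (P := P)) hk
    have h2 : LinearIndependent ℂ fun i => P.root (α i) := b.linearIndepOn_root.comp α α.injective
    have h3 := Fintype.linearIndependent_iff.mp h2 _ h1
    exact funext fun i => by exact_mod_cast h3 i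
  have hform : ∀ i j, ((∑ k, A k i * A k j : ℝ) : ℂ) =
      P.toInvariantForm.form (P.root (α i)) (P.root (α j)) := fun i j => by
    push_cast
    simp only [hAc]
    exact (P.rootForm_apply_apply _ _).symm
  refine ⟨fun j => ∑ k, A k j * A k j, fun j => ?_, ?_⟩
  · refine Finset.sum_pos' (fun k _ => mul_self_nonneg _) ⟨α j, Finset.mem_univ _, ?_⟩
    simp [A]
  · have h := (Matrix.PosDef.conjTranspose_mul_self A hA).smul (two_pos (α := ℝ))
    convert h using 1
    ext i j
    rw [Matrix.mul_diagonal]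
    apply Complex.ofReal_injective
    have h1 := P.toInvariantForm.two_mul_apply_root_root (α i) (α j)
    rw [← hform, ← hform] at h1
    rw [Complex.ofReal_mul, Matrix.smul_apply, Matrix.mul_apply]
    simp only [Matrix.conjTranspose_apply, star_trivial, smul_eq_mul, Complex.ofReal_mul]
    have h2 : ((Matrix.of (fun i j => (b.cartanMatrix (α i) (α j) : ℝ)) i j : ℝ) : ℂ) =
        P.pairing (α i) (α j) := hAc (α j) i
    rw [h2, ← h1]
    rfl

omit [P.IsReduced] in
theorem mem_support_or_exists_root_eq_add {k : ι} (hk : b.IsPos k) :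
    k ∈ b.support ∨ ∃ i j, b.IsPos i ∧ b.IsPos j ∧ P.root k = P.root i + P.root j := by
  obtain ⟨i, hi, hik⟩ := hk.exists_mem_support_pos_pairingIn
  have hki : 0 < P.pairingIn ℤ k i := (P.zero_lt_pairingIn_iff' ℤ).mp hik
  by_cases hki0 : k = i
  · exact Or.inl (hki0 ▸ hi)
  obtain ⟨j, hj⟩ := P.root_sub_root_mem_of_pairingIn_pos hki hki0
  exact Or.inr ⟨j, i, hk.sub hi hj, b.isPos_of_mem_support hi, by rw [hj]; abel⟩

omit [Finite ι] [P.IsCrystallographic] [P.IsReduced] in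
theorem root_ne_add_of_mem_support {i j k : ι} (hk : k ∈ b.support) (hi : b.IsPos i)
    (hj : b.IsPos j) : P.root k ≠ P.root i + P.root j := fun h => by
  have h1 := b.height_add h
  rw [b.height_one_of_mem_support hk] at h1
  rw [Base.isPos_iff] at hi hj
  omega

omit [P.IsReduced] in
/-- A map of the roots which is additive and preserves positivity preserves the simple roots. -/
theorem map_mem_support {τ : ι → ι} (hττ : ∀ i, τ (τ i) = i)
    (hτ : ∀ i j k, P.root k = P.root i + P.root j → P.root (τ k) = P.root (τ i) + P.root (τ j))
    (hpos : ∀ i, b.IsPos i → b.IsPos (τ i)) {k : ι} (hk : k ∈ b.support) : τ k ∈ b.support := by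
  rcases mem_support_or_exists_root_eq_add (hpos k (b.isPos_of_mem_support hk)) with
    h | ⟨i, j, hi, hj, h⟩
  · exact h
  · have := hτ _ _ _ h
    rw [hττ] at this
    exact absurd this (root_ne_add_of_mem_support hk (hpos i hi) (hpos j hj))

end FiniteType

section DiagramExists

open Module LieAlgebra LieAlgebra.IsKilling LieModule

variable {L : Type*} [LieRing L] [LieAlgebra ℂ L] [FiniteDimensional ℂ L] [IsKilling ℂ L]

omit [IsKilling ℂ L] in
/-- The eigenvalues of the neutral element of an `𝔰𝔩₂`-triple are integers. -/
theorem exists_int_of_lie_h {h e f : L} (t : IsSl2Triple h e f) {x : L} (hx0 : x ≠ 0) {c : ℂ}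
    (hx : ⁅h, x⁆ = c • x) : ∃ k : ℤ, c = k := by
  by_contra! hc
  have hw : ∀ k : ℕ, ⁅h, ((ad ℂ L f) ^ k) x⁆ = (c - 2 * k) • ((ad ℂ L f) ^ k) x := fun k => by
    induction k with
    | zero => simpa using hx
    | succ k ih =>
      rw [pow_succ', Module.End.mul_apply, ad_apply, leibniz_lie, ih, t.lie_h_f_nsmul, neg_lie,
        nsmul_lie, lie_smul]
      push_cast
      module
  have hne : ∀ k : ℕ, ((ad ℂ L f) ^ k) x ≠ 0 := fun k => by
    induction k with
    | zero => simpa using hx0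
    | succ k ih =>
      intro h0
      rw [pow_succ', Module.End.mul_apply, ad_apply] at h0
      refine ih (eq_zero_of_lie_f_of_lie_h t h0 (hw k) fun n hn => hc (2 * k - n) ?_)
      push_cast
      linear_combination hn
  obtain ⟨k, hk⟩ := isNilpotent_ad_of_isSl2Triple ℂ t.symm
  exact hne k (by rw [hk]; rfl)

variable {H : LieSubalgebra ℂ L} [H.IsCartanSubalgebra] {b : (rootSystem H).Base}

/-- The weights of the simple roots lie in `{0, 1, 2}`. -/
theorem exists_weight_le_two {z : H} {e f : L} (t : IsSl2Triple (z : L) e f)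
    (hpos : ∀ β : H.root, 0 < ((β : Weight ℂ H L) z).re → b.IsPos β) {β : H.root}
    (hβ : β ∈ b.support) (hβz : 0 ≤ ((β : Weight ℂ H L) z).re) :
    ∃ k : ℕ, k ≤ 2 ∧ (β : Weight ℂ H L) z = k := by
  have hx := lie_rootVector β z z.2
  obtain ⟨k, hk⟩ := exists_int_of_lie_h t (rootVector_ne_zero β) hx
  have hk0 : 0 ≤ k := by
    have : (((k : ℂ)).re : ℝ) = (k : ℝ) := Complex.intCast_re k
    rw [show (β : Weight ℂ H L) z = k from hk, this] at hβz
    exact_mod_cast hβz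
  lift k to ℕ using hk0
  refine ⟨k, ?_, by simpa using hk⟩
  by_contra! hk2
  have hβk : (β : Weight ℂ H L) z = k := by simpa using hk
  have hf : f ∈ diagSpan (rootBasis b) (rootBasisWeight b z) (· = -2) := by
    rw [mem_diagSpan_eq_iff (T := ad ℂ L z) (lie_rootBasis b z), ad_apply, t.lie_h_f_nsmul,
      neg_smul, ofNat_smul_eq_nsmul ℂ 2 f]
  have hne : ⁅f, rootVector β⁆ ≠ 0 := fun h0 =>
    rootVector_ne_zero β (eq_zero_of_lie_f_of_lie_h t h0 hx fun n hn => by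
      have : (k : ℂ) + n = 0 := by rw [← hβk]; linear_combination hn
      have : k + n = 0 := by exact_mod_cast this
      omega)
  apply hne
  rw [diagSpan] at hf
  clear hne t
  induction hf using Submodule.span_induction with
  | zero => rw [zero_lie]
  | add x y _ _ hx hy => rw [add_lie, hx, hy, add_zero]
  | smul c x _ hx => rw [smul_lie, hx, smul_zero]
  | mem x hx' =>
    obtain ⟨i | γ, hγ, rfl⟩ := hx'
    · simp [rootBasisWeight] at hγ
    · have hγz : (γ : Weight ℂ H L) z = -2 := hγ
      rw [rootBasis_inr]
      have hn : b.IsPos (negRoot γ) := hpos _ (by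
        rw [coe_negRoot, Weight.coe_neg, Pi.neg_apply, hγz]; norm_num)
      refine lie_rootVector_eq_zero (fun δ hδ => ?_) fun h0 => ?_
      · have hδz : (δ : Weight ℂ H L) z = k - 2 := by
          have := LinearMap.congr_fun hδ z
          change (δ : Weight ℂ H L) z = (γ : Weight ℂ H L) z + (β : Weight ℂ H L) z at this
          rw [this, hγz, hβk]; ring
        refine root_ne_add_of_mem_support hβ (hpos δ ?_) hn (i := δ) ?_
        · rw [hδz]
          simp only [Complex.sub_re, Complex.natCast_re, Complex.re_ofNat, sub_pos]
          exact_mod_cast hk2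
        · rw [hδ, root_negRoot]; abel
      · have := LinearMap.congr_fun h0 z
        change (γ : Weight ℂ H L) z + (β : Weight ℂ H L) z = 0 at this
        rw [hγz, hβk] at this
        have h2 : (k : ℂ) = 2 := by linear_combination this
        have h2 : k = 2 := by exact_mod_cast h2
        omega

variable (S : L ≃ₗ⁅ℂ⁆ L) (hS : ∀ x, S (S x) = x) (hSH : ∀ x ∈ H, S x ∈ H)

/-- Fixed elements of the Cartan subalgebra on which the roots are real, the second one regular,
define a base stable under the involution. -/
theorem exists_stable_base (z z' : H) (hz : S z = z) (hz' : S z' = z')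
    (him : ∀ β : H.root, ((β : Weight ℂ H L) z').im = 0)
    (hreg : ∀ β : H.root, (β : Weight ℂ H L) z' ≠ 0) :
    ∃ b : (rootSystem H).Base, (∀ β ∈ b.support, twist S hS hSH β ∈ b.support) ∧
      (∀ β, b.IsPos β → 0 ≤ ((β : Weight ℂ H L) z).re) ∧
      ∀ β : H.root, 0 < ((β : Weight ℂ H L) z).re → b.IsPos β := by
  let F (w : H) : Dual ℂ H →+ ℝ :=
    Complex.reAddGroupHom.comp (LinearMap.applyₗ w : Dual ℂ H →ₗ[ℂ] ℂ).toAddMonoidHom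
  have hF : ∀ w (β : H.root), F w ((rootSystem H).root β) = ((β : Weight ℂ H L) w).re :=
    fun w β => rfl
  obtain ⟨b, hb⟩ := exists_base_isPos_iff_lex (rootSystem H) (F z) (F z') fun β _ h => hreg β
    (Complex.ext h (him β))
  simp only [hF] at hb
  refine ⟨b, fun β hβ => map_mem_support (twist_twist S hS hSH)
    (fun _ _ _ h => root_twist_add S hS hSH h) (fun γ hγ => ?_) hβ, fun β hβ => ?_, fun β hβ =>
    (hb β).mpr (Or.inl hβ)⟩
  · have e1 : (twist S hS hSH γ : Weight ℂ H L) z = (γ : Weight ℂ H L) z := by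
      rw [twist_apply]; congr 1; exact Subtype.ext hz
    have e2 : (twist S hS hSH γ : Weight ℂ H L) z' = (γ : Weight ℂ H L) z' := by
      rw [twist_apply]; congr 1; exact Subtype.ext hz'
    rw [hb, e1, e2, ← hb]
    exact hγ
  · rcases (hb β).mp hβ with h | h
    · exact h.le
    · exact h.1.ge

/-- A stable base whose simple roots have weights in `{0, 1, 2}` has a diagram. -/
theorem exists_isDiagramOf (z : H) (hz : S z = z)
    (hb : ∀ β ∈ b.support, twist S hS hSH β ∈ b.support)
    (hw : ∀ β ∈ b.support, ∃ k : ℕ, k ≤ 2 ∧ (β : Weight ℂ H L) z = k) :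
    ∃ (n : ℕ) (α : Fin n ≃ b.support) (Γ : WeightedVoganDiagram n),
      IsDiagramOf S hS hSH α Γ z := by
  let α := b.support.equivFin.symm
  let τ : b.support → b.support := fun i => ⟨twist S hS hSH i, hb i i.2⟩
  have hτ : Function.Involutive τ := fun i => Subtype.ext (twist_twist S hS hSH i)
  choose w hw2 hwz using fun i : b.support => hw i i.2
  obtain ⟨d, hd, hpd⟩ := exists_cartanMatrix_posDef α
  let Γ : WeightedVoganDiagram b.support.card :=
    { cartan := Matrix.of fun i j => b.cartanMatrix (α i) (α j)
      cartan_diag := fun i => b.cartanMatrix_apply_same _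
      cartan_nonpos := fun i j hij => b.cartanMatrix_le_zero_of_ne _ _ (α.injective.ne hij)
      finite_type := ⟨d, hd, hpd⟩
      theta := α.symm.permCongr hτ.toPerm
      theta_theta := fun i => by simp [Equiv.permCongr_apply, hτ _]
      cartan_theta := fun i j => by
        simp only [Equiv.permCongr_apply, Equiv.symm_symm, Matrix.of_apply,
          Equiv.apply_symm_apply]
        exact pairingIn_twist S hS hSH _ _
      painted := {i | τ (α i) = α i ∧ twistCoeff S hS hSH (α i) = -1}
      theta_of_painted := fun i hi => by
        simp [Equiv.permCongr_apply, hi.1]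
      weight := fun i => w (α i)
      weight_le := fun i => hw2 _
      weight_theta := fun i => by
        simp only [Equiv.permCongr_apply, Equiv.symm_symm, Equiv.apply_symm_apply]
        have h1 : ((w (τ (α i)) : ℕ) : ℂ) = w (α i) := by
          rw [← hwz, ← hwz, twist_apply]
          congr 1
          exact Subtype.ext hz
        exact_mod_cast h1 }
  have hθ : ∀ i, α (Γ.theta i) = τ (α i) := fun i => by
    simp [Γ, Equiv.permCongr_apply]
  refine ⟨_, α, Γ, fun i j => rfl, fun i => by rw [hθ], fun i => ?_, fun i => hwz _⟩
  rw [← α.injective.eq_iff, hθ]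
  rfl

theorem map_rootSpace_eq_iff (β γ : H.root) :
    (rootSpace H (β : Weight ℂ H L)).toSubmodule.map (S : L →ₗ[ℂ] L) =
      (rootSpace H (γ : Weight ℂ H L)).toSubmodule ↔ twist S hS hSH β = γ := by
  constructor
  · intro h
    have h1 : S (rootVector β) ∈ rootSpace H (γ : Weight ℂ H L) :=
      h.le ⟨_, rootVector_mem β, rfl⟩
    have h2 := map_mem_rootSpace S hS hSH (rootVector_mem β)
    have h0 : S (rootVector β) ≠ 0 := fun h0 =>
      rootVector_ne_zero β ((map_eq_zero_iff S S.injective).mp h0)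
    rw [mem_rootSpace_iff] at h1 h2
    refine (eq_twist_of_forall S hS hSH fun z => ?_).symm
    exact smul_left_injective ℂ h0 ((h1 z).symm.trans (h2 z))
  · rintro rfl
    apply le_antisymm
    · rintro _ ⟨x, hx, rfl⟩
      exact map_mem_rootSpace S hS hSH hx
    · intro x hx
      refine ⟨S x, ?_, hS x⟩
      have := map_mem_rootSpace S hS hSH hx
      have hβ : (fun z : H => (twist S hS hSH β : Weight ℂ H L) ⟨S z, hSH z z.2⟩) =
          (β : Weight ℂ H L) := by
        ext z; simp [hS]
      rwa [hβ] at this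

theorem twistCoeff_eq_neg_one_iff {β : H.root} (hβ : twist S hS hSH β = β) :
    twistCoeff S hS hSH β = -1 ↔ ∀ x ∈ rootSpace H (β : Weight ℂ H L), S x = -x := by
  constructor
  · intro h x hx
    rw [map_of_twist_eq S hS hSH hβ hx, h, neg_one_smul]
  · intro h
    refine twistCoeff_eq_of_map S hS hSH hβ (rootVector_ne_zero β) (rootVector_mem β) ?_
    rw [h _ (rootVector_mem β), neg_one_smul]

end DiagramExists

section Associated

open Module LieAlgebra LieAlgebra.IsKilling LieModule

variable {L₀ : Type*} [LieRing L₀] [LieAlgebra ℝ L₀] [FiniteDimensional ℝ L₀]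
  [LieAlgebra.IsSemisimple ℝ L₀] {θ : L₀ ≃ₗ⁅ℝ⁆ L₀} (hθ : IsCartanInvolution θ)

include hθ in
omit [FiniteDimensional ℝ L₀] [LieAlgebra.IsSemisimple ℝ L₀] in
theorem thetaEquiv_thetaEquiv (x : ℂ ⊗[ℝ] L₀) :
    thetaEquiv θ hθ.involutive (thetaEquiv θ hθ.involutive x) = x :=
  complexTheta_complexTheta hθ.involutive x

include hθ in
theorem isAssociated_iff {n : ℕ} (Γ : WeightedVoganDiagram n) (h : ℂ ⊗[ℝ] L₀) :
    Γ.IsAssociated θ h ↔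
      ∃ (H : LieSubalgebra ℂ (ℂ ⊗[ℝ] L₀)) (_ : H.IsCartanSubalgebra)
        (b : (rootSystem H).Base) (α : Fin n ≃ b.support) (hh : h ∈ H)
        (hSH : ∀ x ∈ H, thetaEquiv θ hθ.involutive x ∈ H),
        (∀ x ∈ kSpace θ, (∀ y ∈ H, y ∈ kSpace θ → ⁅x, y⁆ = 0) → x ∈ H) ∧
        IsDiagramOf (thetaEquiv θ hθ.involutive) (thetaEquiv_thetaEquiv hθ) hSH
          α Γ ⟨h, hh⟩ := by
  have key : ∀ (H : LieSubalgebra ℂ (ℂ ⊗[ℝ] L₀)) (_ : H.IsCartanSubalgebra)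
      (b : (rootSystem H).Base) (α : Fin n ≃ b.support)
      (hSH : ∀ x ∈ H, thetaEquiv θ hθ.involutive x ∈ H)
      (h1 : ∀ i, twist (thetaEquiv θ hθ.involutive) (thetaEquiv_thetaEquiv hθ) hSH
        (α i) = α (Γ.theta i)) (i : Fin n), (Γ.theta i = i ∧ twistCoeff (thetaEquiv θ hθ.involutive)
        (thetaEquiv_thetaEquiv hθ) hSH (α i) = -1) ↔
      (Γ.theta i = i ∧ (rootSpace H ((α i).1 : Weight ℂ H (ℂ ⊗[ℝ] L₀))).toSubmodule ≤
        pSpace θ) := by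
    intro H _ b α hSH h1 i
    refine and_congr_right fun hi => ?_
    rw [twistCoeff_eq_neg_one_iff _ _ _ (by rw [h1, hi])]
    refine forall₂_congr fun x _ => ?_
    rw [mem_pSpace]; rfl
  constructor
  · rintro ⟨H, hH, b, α, hh, hSH, hmax, hc, hmap, hp, hw⟩
    have h1 : ∀ i, twist (thetaEquiv θ hθ.involutive) (thetaEquiv_thetaEquiv hθ) hSH
        (α i) = α (Γ.theta i) := fun i => (map_rootSpace_eq_iff _ _ _ _ _).mp (hmap i)
    exact ⟨H, hH, b, α, hh, hSH, hmax, hc, h1, fun i => (hp i).trans (key H hH b α hSH h1 i).symm,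
      hw⟩
  · rintro ⟨H, hH, b, α, hh, hSH, hmax, hc, h1, hp, hw⟩
    exact ⟨H, hH, b, α, hh, hSH, hmax, hc, fun i => (map_rootSpace_eq_iff _ _ _ _ _).mpr (h1 i),
      fun i => (hp i).trans (key H hH b α hSH h1 i), hw⟩

include hθ in
theorem IsKSTriple.exists_isAssociated {h e f : ℂ ⊗[ℝ] L₀} (t : IsKSTriple θ h e f) :
    ∃ (n : ℕ) (Γ : WeightedVoganDiagram n), Γ.IsAssociated θ h := by
  obtain ⟨y, hy, rfl⟩ := t.h_mem
  obtain ⟨H, hH, hyH, hSH, hmax, y', hy'H, hy', hreg⟩ := hθ.exists_cartan hy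
  have hfix : ∀ u : L₀, θ u = u → complexTheta θ (Complex.I ⊗ₜ[ℝ] u) = Complex.I ⊗ₜ[ℝ] u :=
    fun u hu => by
      rw [I_tmul_eq_cplx, complexTheta_cplx, hu, map_zero]
  obtain ⟨b, hb, hb0, hbpos⟩ := exists_stable_base (thetaEquiv θ hθ.involutive)
    (thetaEquiv_thetaEquiv hθ) hSH ⟨_, hyH⟩ ⟨_, hy'H⟩ (hfix y hy) (hfix y' hy')
    (hθ.root_im_eq_zero y' hy' hy'H) hreg
  obtain ⟨n, α, Γ, hD⟩ := exists_isDiagramOf (thetaEquiv θ hθ.involutive)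
    (thetaEquiv_thetaEquiv hθ) hSH ⟨_, hyH⟩ (hfix y hy) hb fun β hβ =>
      exists_weight_le_two t.sl2 hbpos hβ (hb0 β (b.isPos_of_mem_support hβ))
  exact ⟨n, Γ, (isAssociated_iff hθ Γ _).mpr ⟨H, hH, b, α, hyH, hSH, hmax, hD⟩⟩

include hθ in
theorem IsKSTriple.isNoticed_iff_of_isAssociated {h e f : ℂ ⊗[ℝ] L₀} (t : IsKSTriple θ h e f)
    {n : ℕ} {Γ : WeightedVoganDiagram n} (hΓ : Γ.IsAssociated θ h) :
    Γ.IsNoticed ↔ IsNoticed θ e := by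
  obtain ⟨H, hH, b, α, hh, hSH, -, hD⟩ := (isAssociated_iff hθ Γ h).mp hΓ
  rw [t.isNoticed_iff hθ, t.not_hasCompactCentralizer_iff hθ]
  refine hD.isNoticed_iff (mem_kSpace.mp ?_) _ _ (fun x => ?_) fun x => ?_
  · exact mem_kSpace.mpr t.theta_h
  · rw [Submodule.mem_inf, mem_kSpace, Module.End.mem_eigenspace_iff, zero_smul]
    rfl
  · rw [Submodule.mem_inf, mem_pSpace, Module.End.mem_eigenspace_iff]
    rfl

end Associated

/-! ### Invariance under the real adjoint group -/

section RealOrbit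

variable {L₀ : Type*} [LieRing L₀] [LieAlgebra ℝ L₀] [FiniteDimensional ℝ L₀]

/-- Having an element of negative Killing norm in the centralizer depends only on the orbit. -/
theorem exists_killingForm_neg_of_realOrbit_eq {x x' : L₀} (hO : realOrbit x = realOrbit x')
    (h : ∃ y : L₀, ⁅x, y⁆ = 0 ∧ killingForm ℝ L₀ y y < 0) :
    ∃ y : L₀, ⁅x', y⁆ = 0 ∧ killingForm ℝ L₀ y y < 0 := by
  obtain ⟨y, hy, hyy⟩ := h
  obtain ⟨⟨φ, hφ⟩, rfl⟩ : x' ∈ realOrbit x := hO ▸ MulAction.mem_orbit_self x'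
  refine ⟨φ y, ?_, ?_⟩
  · change ⁅φ x, φ y⁆ = 0
    rw [← adGroup_apply_lie hφ, hy, map_zero]
  · have := LieAlgebra.killingForm_of_equiv_apply (lieEquivOfAdGroup hφ) y y
    rw [lieEquivOfAdGroup_apply] at this
    rwa [this]

variable [LieAlgebra.IsSemisimple ℝ L₀] {θ : L₀ ≃ₗ⁅ℝ⁆ L₀} (hθ : IsCartanInvolution θ)

include hθ in
/-- Whether the Cayley transform is noticed depends only on the real orbit. -/
theorem IsRealCayleyTriple.isNoticed_of_realOrbit_eq {h₀ e₀ f₀ h₁ e₁ f₁ : L₀}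
    (t₀ : IsRealCayleyTriple θ h₀ e₀ f₀) (t₁ : IsRealCayleyTriple θ h₁ e₁ f₁)
    (hO : realOrbit e₀ = realOrbit e₁) (hn : IsNoticed θ (cayleyE h₁ e₁ f₁)) :
    IsNoticed θ (cayleyE h₀ e₀ f₀) := by
  rw [(t₁.isKSTriple hθ.involutive).isNoticed_iff hθ, t₁.hasCompactCentralizer_iff hθ] at hn
  rw [(t₀.isKSTriple hθ.involutive).isNoticed_iff hθ, t₀.hasCompactCentralizer_iff hθ]
  exact fun h => hn (exists_killingForm_neg_of_realOrbit_eq hO h)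

end RealOrbit

end NoticedOrbits

end

theorem mainTheorem1 {L₀ : Type*} [LieRing L₀] [LieAlgebra ℝ L₀] [FiniteDimensional ℝ L₀]
    [LieAlgebra.IsSemisimple ℝ L₀] (θ : L₀ ≃ₗ⁅ℝ⁆ L₀) (hθ : NoticedOrbits.IsCartanInvolution θ)
    (h e f : TensorProduct ℝ ℂ L₀) (hKS : NoticedOrbits.IsKSTriple θ h e f) :
    (∃ (n : ℕ) (Γ : NoticedOrbits.WeightedVoganDiagram n), Γ.IsAssociated θ h) ∧
    (∃ O₀ : Set L₀, NoticedOrbits.KSCorrespond θ O₀ (NoticedOrbits.kOrbit θ e)) ∧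
    ∀ (n : ℕ) (Γ : NoticedOrbits.WeightedVoganDiagram n), Γ.IsAssociated θ h →
      ∀ O₀ : Set L₀, NoticedOrbits.KSCorrespond θ O₀ (NoticedOrbits.kOrbit θ e) →
        List.TFAE
          [NoticedOrbits.IsNoticedKSTriple θ h e f,
           NoticedOrbits.IsNoticedKOrbit θ (NoticedOrbits.kOrbit θ e),
           NoticedOrbits.IsNoticedRealOrbit θ O₀,
           Γ.IsNoticed] := by
  refine ⟨hKS.exists_isAssociated hθ, ?_, fun n Γ hΓ O₀ hO₀ => ?_⟩
  · obtain ⟨h₀, e₀, f₀, t₀, rfl⟩ := hKS.exists_realCayleyTriple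
    exact ⟨_, h₀, e₀, f₀, t₀, rfl, rfl⟩
  tfae_have 1 → 2 := fun h1 => ⟨e, h1.2, rfl⟩
  tfae_have 2 → 3 := fun h2 => ⟨_, hO₀, h2⟩
  tfae_have 3 → 1 := by
    rintro ⟨O, ⟨h₁, e₁, f₁, t₁, hO₁, rfl⟩, x, hx, hOx⟩
    obtain ⟨h₀, e₀, f₀, t₀, rfl, hO⟩ := hO₀
    have h1 := (t₁.isKSTriple hθ.involutive).isNoticed_of_orbit hθ hx hOx
    exact ⟨hKS, hKS.isNoticed_of_orbit hθ (t₀.isNoticed_of_realOrbit_eq hθ t₁ hO₁ h1) hO⟩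
  tfae_have 1 ↔ 4 := (and_iff_right hKS).trans (hKS.isNoticed_iff_of_isAssociated hθ hΓ).symm
  tfae_finish
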